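/- **Setting.** Let $M$ be a smooth $6$-manifold and $J\subset\mathbb R$ a non-degenerate interval. An $\mathrm{SU}(3)$-structure on $M$ is a triple of smooth forms $(\omega,\psi_+,\psi_-)$ that around each point can be written, in some coframe $e^1,\dots,e^6$, as $\omega=e^{12}+e^{34}+e^{56}$, $\psi_+=e^{135}-e^{146}-e^{236}-e^{245}$, $\psi_-=-e^{246}+e^{235}+e^{145}+e^{136}$. Its torsion forms are the functions $\pi_0,\sigma_0$, the $1$-forms $\pi_1,\nu_1$, the $2$-forms $\pi_2,\sigma_2\in\Omega^2_8=\{\sigma : \sigma\wedge\psi_+=0,\ \sigma\wedge\omega^2=0\}$ and the $3$-form $\nu_3\in\Omega^3_{12}=\{\gamma : \gamma\wedge\omega=0,\ \gamma\wedge\psi_\pm=0\}$ (all smooth) determined by $$d\omega=-\tfrac32\sigma_0\psi_++\tfrac32\pi_0\psi_-+\nu_1\wedge\omega+\nu_3,$$ $$d\psi_+=\pi_0\omega^2+\pi_1\wedge\psi_+-\pi_2\wedge\omega,\qquad d\psi_-=\sigma_0\omega^2+\pi_1\wedge\psi_--\sigma_2\wedge\omega .$$ A $\mathrm G_2$-structure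 on a $7$-manifold is a smooth $3$-form $\varphi$ that around each point can be written, in some coframe, as $\varphi=e^{127}+e^{347}+e^{567}+e^{135}-e^{146}-e^{236}-e^{245}$; it induces the metric and orientation for which $e^1,\dots,e^7$ is orthonormal and positive, with Hodge star $\ast_\varphi$, and the Hodge Laplacian $\Delta_\varphi=\ast_\varphi d\ast_\varphi d-d\ast_\varphi d\,\ast_\varphi$ on $3$-forms. A family $\varphi(t)$, $t\in J$, of $\mathrm G_2$-structures solves the Laplacian flow if $\frac{\partial}{\partial t}\varphi(t)=\Delta_{\varphi(t)}\varphi(t)$ and $d\varphi(t)=0$ for all $t\in J$. **Statement.** Let $\alpha,\beta\in\mathbb R$ with $\alpha^2+\beta^2=1$, let $f:J\to\mathbb R\setminus\{0\}$ be differentiable (so that at each time the warping function is constant on $M$), and let $(\omega(t),\psi_+(t),\psi_-(t))$, $t\in J$, be a family of $\mathrm{SU}(3)$-structures on $M$, differentiable in $t$, with torsion forms $\pi_0(t),\dots,\nu_3(t)$. On $M\times S^1$, with $s$ the angular coordinate on $S^1$, consider $$\varphi(t)=f(t)\,\omega(t)\wedge ds+\alpha\,\psi_+(t)-\beta\,\psi_-(t),$$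 and suppose that $d\varphi(t)=0$ for all $t\in J$. Then $\alpha\pi_2(t)-\beta\sigma_2(t)=0$ for all $t\in J$, and $\varphi(t)$ solves the Laplacian flow if and only if, for all $t\in J$, $$\begin{cases} f'(t)\,\omega(t)+f(t)\,\dfrac{\partial}{\partial t}\omega(t)=0,\\[4pt] \alpha\,\dfrac{\partial}{\partial t}\psi_+(t)-\beta\,\dfrac{\partial}{\partial t}\psi_-(t)=-d_6\big(\alpha\,\sigma_2(t)+\beta\,\pi_2(t)\big),\end{cases}$$ where $d_6$ is the exterior derivative on $M$. In particular, for $(\alpha,\beta)=(1,0)$, that is, for $\varphi(t)=f(t)\,\omega(t)\wedge ds+\psi_+(t)$, one has $\pi_2(t)=0$, and the Laplacian flow is equivalent to the Fino–Raffero system $f'(t)\,\omega(t)+f(t)\frac{\partial}{\partial t}\omega(t)=0$, $\ \frac{\partial}{\partial t}\psi_+(t)=-d_6\sigma_2(t)$. -/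

import Mathlib

open Set
open scoped Manifold

noncomputable section

namespace WarpedG2

/-! ### Exterior algebra of a real vector space -/

section Algebra

variable {V : Type*} [AddCommGroup V] [Module ℝ V] [TopologicalSpace V]

/-- The exterior product `a ∧ b`: Mathlib's exterior product `AlternatingMap.domCoprod` followed by
the multiplication `ℝ ⊗ ℝ → ℝ`, that is
`(a ∧ b)(v₁, …, vₖ₊ₗ) = ∑ sign σ · a(v_{σ 1}, …, v_{σ k}) · b(v_{σ (k+1)}, …, v_{σ (k+l)})`,
the sum being over all `(k, l)`-shuffles `σ`. -/
def wedge {k l : ℕ} (a : V [⋀^Fin k]→L[ℝ] ℝ) (b : V [⋀^Fin l]→L[ℝ] ℝ) :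
    V [⋀^Fin (k + l)]→L[ℝ] ℝ :=
  { ((LinearMap.mul' ℝ ℝ).compAlternatingMap
      (a.toAlternatingMap.domCoprod b.toAlternatingMap)).domDomCongr finSumFinEquiv with
    cont := by
      change Continuous fun v : Fin (k + l) → V =>
        LinearMap.mul' ℝ ℝ (a.toAlternatingMap.domCoprod b.toAlternatingMap
          (fun i => v (finSumFinEquiv i)))
      simp only [AlternatingMap.domCoprod_apply, sum_apply, map_sum]
      refine continuous_finsetSum _ fun σ _ => ?_
      induction σ using Quotient.inductionOn' with
      | h σ =>
        simp only [AlternatingMap.domCoprod.summand_mk'', smul_apply,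
          MultilinearMap.domDomCongr_apply, MultilinearMap.domCoprod_apply, map_zsmul_unit,
          LinearMap.mul'_apply]
        refine Continuous.const_smul (Continuous.mul ?_ ?_) _
        · exact a.cont.comp (continuous_pi fun i => continuous_apply _)
        · exact b.cont.comp (continuous_pi fun i => continuous_apply _) }

variable [IsTopologicalAddGroup V] [ContinuousSMul ℝ V] [T2Space V]

theorem continuous_coord {n : ℕ} (b : Module.Basis (Fin n) ℝ V) (i : Fin n) :
    Continuous (b.coord i) :=
  haveI : FiniteDimensional ℝ V := Module.Finite.of_basis b
  LinearMap.continuous_of_finiteDimensional _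

/-- The 1-form `eⁱ` of the coframe dual to the frame `b` (indices start at `0`). -/
def e1 {n : ℕ} (b : Module.Basis (Fin n) ℝ V) (i : Fin n) : V [⋀^Fin 1]→L[ℝ] ℝ :=
  ContinuousAlternatingMap.ofSubsingleton ℝ V ℝ (0 : Fin 1) ⟨b.coord i, continuous_coord b i⟩

/-- `eⁱʲ = eⁱ ∧ eʲ`. -/
def e2 {n : ℕ} (b : Module.Basis (Fin n) ℝ V) (i j : Fin n) : V [⋀^Fin 2]→L[ℝ] ℝ :=
  wedge (e1 b i) (e1 b j)

/-- `eⁱʲᵏ = eⁱ ∧ eʲ ∧ eᵏ`. -/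
def e3 {n : ℕ} (b : Module.Basis (Fin n) ℝ V) (i j k : Fin n) : V [⋀^Fin 3]→L[ℝ] ℝ :=
  wedge (e2 b i j) (e1 b k)

theorem append_update {α : Type*} {k l : ℕ} (u : Fin k → α) (v : Fin l → α)
    (j : Fin l) (x : α) :
    Fin.append u (Function.update v j x) =
      Function.update (Fin.append u v) (Fin.natAdd k j) x := by
  funext i
  refine Fin.addCases (fun a => ?_) (fun a => ?_) i
  · rw [Fin.append_left, Function.update_of_ne, Fin.append_left]
    intro h
    have := congrArg Fin.val h
    simp at this
    omega
  · rw [Fin.append_right]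
    by_cases h : a = j
    · subst h; simp
    · rw [Function.update_of_ne h, Function.update_of_ne, Fin.append_right]
      intro h'
      exact h (Fin.natAdd_injective l k h')

/-- The Hodge star operator of the inner product for which the frame `b` is orthonormal and of the
orientation for which `b` is positive:
`(⋆η)(v₁, …, vₗ) = (1 / k!) ∑_{i₁, …, iₖ} η(b_{i₁}, …, b_{iₖ}) vol(b_{i₁}, …, b_{iₖ}, v₁, …, vₗ)`
with `vol = e¹ ∧ … ∧ eⁿ = b.det`. Equivalently, `ζ ∧ ⋆η = ⟨ζ, η⟩ vol` for all `k`-forms `ζ`. -/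
def hodgeStar {n k l : ℕ} (h : k + l = n) (b : Module.Basis (Fin n) ℝ V)
    (η : V [⋀^Fin k]→L[ℝ] ℝ) : V [⋀^Fin l]→L[ℝ] ℝ where
  toFun v := ((k.factorial : ℝ))⁻¹ * ∑ i : Fin k → Fin n,
    η (fun a => b (i a)) * b.det (Fin.append (fun a => b (i a)) v ∘ Fin.cast h.symm)
  map_update_add' := by
    intro inst v j x y
    subst h
    obtain rfl : inst = instDecidableEqFin l := Subsingleton.elim _ _
    simp only [Fin.cast_refl, Function.comp_id, append_update, AlternatingMap.map_update_add,
      mul_add, Finset.sum_add_distrib]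
  map_update_smul' := by
    intro inst v j c x
    subst h
    obtain rfl : inst = instDecidableEqFin l := Subsingleton.elim _ _
    simp only [Fin.cast_refl, Function.comp_id, append_update, AlternatingMap.map_update_smul,
      smul_eq_mul, Finset.mul_sum]
    exact Finset.sum_congr rfl fun i _ => by ring
  cont := by
    subst h
    have hc : ∀ i : Fin (k + l), Continuous (b.coord i) := continuous_coord b
    refine continuous_const.mul (continuous_finsetSum _ fun i _ => continuous_const.mul ?_)
    simp only [Module.Basis.det_apply]
    refine Continuous.matrix_det (continuous_matrix fun p q => ?_)
    refine (hc p).comp ?_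
    refine Fin.addCases (fun a => ?_) (fun a => ?_) q
    · simpa using continuous_const
    · simpa using continuous_apply a
  map_eq_zero_of_eq' := by
    intro v i j hv hij
    subst h
    refine mul_eq_zero_of_right _ (Finset.sum_eq_zero fun a _ => mul_eq_zero_of_right _ ?_)
    refine b.det.map_eq_zero_of_eq _ (i := Fin.natAdd k i) (j := Fin.natAdd k j) ?_ ?_
    · simpa using hv
    · exact fun h' => hij (Fin.natAdd_injective l k h')

/-- `b` is an adapted frame of the `SU(3)`-structure `(ω, ψ₊, ψ₋)` on a 6-dimensional space: in the
dual coframe `e¹, …, e⁶` one has `ω = e¹² + e³⁴ + e⁵⁶`, `ψ₊ = e¹³⁵ - e¹⁴⁶ - e²³⁶ - e²⁴⁵` and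
`ψ₋ = -e²⁴⁶ + e²³⁵ + e¹⁴⁵ + e¹³⁶`. -/
def IsSU3Frame (ω : V [⋀^Fin 2]→L[ℝ] ℝ) (ψp ψm : V [⋀^Fin 3]→L[ℝ] ℝ)
    (b : Module.Basis (Fin 6) ℝ V) : Prop :=
  ω = e2 b 0 1 + e2 b 2 3 + e2 b 4 5 ∧
  ψp = e3 b 0 2 4 - e3 b 0 3 5 - e3 b 1 2 5 - e3 b 1 3 4 ∧
  ψm = -e3 b 1 3 5 + e3 b 1 2 4 + e3 b 0 3 4 + e3 b 0 2 5

/-- `b` is an adapted frame of the `G₂`-form `φ` on a 7-dimensional space: in the dual coframe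
`φ = e¹²⁷ + e³⁴⁷ + e⁵⁶⁷ + e¹³⁵ - e¹⁴⁶ - e²³⁶ - e²⁴⁵`. -/
def IsG2Frame (φ : V [⋀^Fin 3]→L[ℝ] ℝ) (b : Module.Basis (Fin 7) ℝ V) : Prop :=
  φ = e3 b 0 1 6 + e3 b 2 3 6 + e3 b 4 5 6
    + e3 b 0 2 4 - e3 b 0 3 5 - e3 b 1 2 5 - e3 b 1 3 4

open Classical in
/-- The Hodge star operator of the metric and orientation induced by a `G₂`-form `φ`, i.e. those for
which adapted frames are orthonormal and positive. Two adapted frames differ by an element of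
`G₂ ⊂ SO(7)`, so the operator does not depend on the frame chosen (and it is `0` by convention if
`φ` is not a `G₂`-form). -/
def hodgeStarG2 {k l : ℕ} (h : k + l = 7) (φ : V [⋀^Fin 3]→L[ℝ] ℝ)
    (η : V [⋀^Fin k]→L[ℝ] ℝ) : V [⋀^Fin l]→L[ℝ] ℝ :=
  if hφ : ∃ b : Module.Basis (Fin 7) ℝ V, IsG2Frame φ b then hodgeStar h hφ.choose η else 0

end Algebra

/-! ### Differential forms on manifolds without boundary -/

section Forms

variable {E : Type*} [NormedAddCommGroup E] [NormedSpace ℝ E]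
  {H : Type*} [TopologicalSpace H] (I : ModelWithCorners ℝ E H)
  {E' : Type*} [NormedAddCommGroup E'] [NormedSpace ℝ E']
  {H' : Type*} [TopologicalSpace H'] (I' : ModelWithCorners ℝ E' H')
  (M : Type*) [TopologicalSpace M] [ChartedSpace H M]
  {N : Type*} [TopologicalSpace N] [ChartedSpace H' N]

instance instT2SpaceTangentSpace (x : M) : T2Space (TangentSpace I x) :=
  inferInstanceAs (T2Space E)

/-- (Not necessarily smooth) differential `k`-forms on `M`. -/
abbrev DForm (k : ℕ) : Type _ := (x : M) → TangentSpace I x [⋀^Fin k]→L[ℝ] ℝ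

variable {I I' M} {k l : ℕ}

/-- The coordinate expression of the form `η` in the preferred chart at `x₀`: the pull-back of `η`
by the inverse of the chart. -/
def DForm.inChart (η : DForm I M k) (x₀ : M) : E → E [⋀^Fin k]→L[ℝ] ℝ := fun y =>
  (η ((extChartAt I x₀).symm y)).compContinuousLinearMap
    (mfderiv 𝓘(ℝ, E) I (extChartAt I x₀).symm y)

/-- A form is smooth if its coordinate expressions are smooth. -/
def DForm.IsSmooth (η : DForm I M k) : Prop :=
  ∀ x₀ : M, ContDiffOn ℝ (⊤ : ℕ∞) (η.inChart x₀) (extChartAt I x₀).target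

/-- The exterior derivative, computed at `x` in the preferred chart at `x` and transported back to
the tangent space at `x` (for manifolds without boundary). -/
def DForm.d (η : DForm I M k) : DForm I M (k + 1) := fun x =>
  (extDeriv (η.inChart x) (extChartAt I x x)).compContinuousLinearMap
    (mfderiv I 𝓘(ℝ, E) (extChartAt I x) x)

/-- The exterior product of differential forms. -/
def DForm.wedge (η : DForm I M k) (ζ : DForm I M l) : DForm I M (k + l) := fun x =>
  WarpedG2.wedge (η x) (ζ x)

/-- The pull-back of a differential form by a map. -/
def DForm.pullback (F : M → N) (η : DForm I' N k) : DForm I M k := fun x =>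
  (η (F x)).compContinuousLinearMap (mfderiv I I' F x)

/-- The product of a function and a form. -/
def DForm.fsmul (g : M → ℝ) (η : DForm I M k) : DForm I M k := fun x => g x • η x

/-! ### `G₂`-structures and the Laplacian flow -/

/-- The smooth 3-form `φ` is a `G₂`-structure: it has an adapted frame at every point. -/
structure IsG2Structure (φ : DForm I M 3) : Prop where
  smooth : φ.IsSmooth
  frame : ∀ x, ∃ b : Module.Basis (Fin 7) ℝ (TangentSpace I x), IsG2Frame (φ x) b

/-- The Hodge star operator `⋆₇` on forms of the `G₂`-structure `φ`. -/
def DForm.star7 (φ : DForm I M 3) (h : k + l = 7) (η : DForm I M k) : DForm I M l := fun x =>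
  hodgeStarG2 h (φ x) (η x)

/-- The Hodge Laplacian `Δ₇ = ⋆₇ d ⋆₇ d - d ⋆₇ d ⋆₇` of the `G₂`-structure `φ`, on 3-forms. -/
def DForm.laplacian7 (φ η : DForm I M 3) : DForm I M 3 :=
  φ.star7 (k := 4) (l := 3) rfl (φ.star7 (k := 4) (l := 3) rfl η.d).d
    - (φ.star7 (k := 5) (l := 2) rfl (φ.star7 (k := 3) (l := 4) rfl η).d).d

/-- `φ(t)`, `t ∈ J`, is a solution of the Laplacian flow: `φ(t)` are `G₂`-structures with
`∂φ(t)/∂t = Δ_t φ(t)` and `d φ(t) = 0`. -/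
structure IsLaplacianFlow (J : Set ℝ) (φ : ℝ → DForm I M 3) : Prop where
  isG2 : ∀ t ∈ J, IsG2Structure (φ t)
  evolution : ∀ t ∈ J, ∀ x,
    HasDerivWithinAt (fun τ => φ τ x) ((φ t).laplacian7 (φ t) x) J t
  closed : ∀ t ∈ J, (φ t).d = 0

/-- The pointwise time derivative `∂η/∂t` of a family of forms defined for `t ∈ J`. -/
def timeDeriv (J : Set ℝ) (η : ℝ → DForm I M k) (t : ℝ) : DForm I M k := fun x =>
  derivWithin (fun τ => η τ x) J t

/-- The family of forms `η(t)`, `t ∈ J`, is differentiable with respect to `t`. -/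
def TimeDifferentiable (J : Set ℝ) (η : ℝ → DForm I M k) : Prop :=
  ∀ x, DifferentiableOn ℝ (fun τ => η τ x) J

end Forms

/-! ### `SU(3)`-structures and their torsion forms -/

section SU3

variable (M : Type*) [TopologicalSpace M] [ChartedSpace (EuclideanSpace ℝ (Fin 6)) M]

/-- An `SU(3)`-structure `(ω, ψ₊, ψ₋)` on a 6-manifold: smooth forms that admit an adapted frame at
every point. -/
structure SU3Structure where
  ω : DForm (𝓡 6) M 2
  ψp : DForm (𝓡 6) M 3
  ψm : DForm (𝓡 6) M 3
  smooth_ω : ω.IsSmooth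
  smooth_ψp : ψp.IsSmooth
  smooth_ψm : ψm.IsSmooth
  frame : ∀ x, ∃ b : Module.Basis (Fin 6) ℝ (TangentSpace (𝓡 6) x),
    IsSU3Frame (ω x) (ψp x) (ψm x) b

/-- Candidates for the torsion forms of an `SU(3)`-structure. -/
structure TorsionData where
  π0 : M → ℝ
  σ0 : M → ℝ
  π1 : DForm (𝓡 6) M 1
  ν1 : DForm (𝓡 6) M 1
  π2 : DForm (𝓡 6) M 2
  σ2 : DForm (𝓡 6) M 2
  ν3 : DForm (𝓡 6) M 3

variable {M}

/-- `σ ∈ Ω²₈`, the primitive 2-forms of type `(1,1)`: `σ ∧ ψ₊ = 0` says that the component of `σ` in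
`Ω²₆` vanishes, and `σ ∧ ω² = 0` says that the component of `σ` in `Ω²₁ = ⟨ω⟩` vanishes. -/
def SU3Structure.IsOmega28 (S : SU3Structure M) (σ : DForm (𝓡 6) M 2) : Prop :=
  σ.IsSmooth ∧ σ.wedge S.ψp = 0 ∧ σ.wedge (S.ω.wedge S.ω) = 0

/-- `γ ∈ Ω³₁₂`: `γ ∧ ω = 0` and `γ ∧ ψ± = 0`. -/
def SU3Structure.IsOmega312 (S : SU3Structure M) (γ : DForm (𝓡 6) M 3) : Prop :=
  γ.IsSmooth ∧ γ.wedge S.ω = 0 ∧ γ.wedge S.ψp = 0 ∧ γ.wedge S.ψm = 0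

/-- The functions and forms `T` are the torsion forms of the `SU(3)`-structure `S`, i.e. they give
the type decomposition of `dω`, `dψ₊` and `dψ₋`:
* `dω = -(3/2) σ₀ ψ₊ + (3/2) π₀ ψ₋ + ν₁ ∧ ω + ν₃`,
* `dψ₊ = π₀ ω² + π₁ ∧ ψ₊ - π₂ ∧ ω`,
* `dψ₋ = σ₀ ω² + π₁ ∧ ψ₋ - σ₂ ∧ ω`,
with `π₂, σ₂ ∈ Ω²₈` and `ν₃ ∈ Ω³₁₂`. Every `SU(3)`-structure has exactly one such `T`. -/
structure SU3Structure.IsTorsion (S : SU3Structure M) (T : TorsionData M) : Prop where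
  smooth_π0 : ContMDiff (𝓡 6) 𝓘(ℝ) (⊤ : ℕ∞) T.π0
  smooth_σ0 : ContMDiff (𝓡 6) 𝓘(ℝ) (⊤ : ℕ∞) T.σ0
  smooth_π1 : T.π1.IsSmooth
  smooth_ν1 : T.ν1.IsSmooth
  mem_π2 : S.IsOmega28 T.π2
  mem_σ2 : S.IsOmega28 T.σ2
  mem_ν3 : S.IsOmega312 T.ν3
  dω_eq : S.ω.d = (-(3 / 2) : ℝ) • S.ψp.fsmul T.σ0 + (3 / 2 : ℝ) • S.ψm.fsmul T.π0
    + (T.ν1.wedge S.ω : DForm (𝓡 6) M 3) + T.ν3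
  dψp_eq : S.ψp.d = (S.ω.wedge S.ω).fsmul T.π0
    + (T.π1.wedge S.ψp : DForm (𝓡 6) M 4) - T.π2.wedge S.ω
  dψm_eq : S.ψm.d = (S.ω.wedge S.ω).fsmul T.σ0
    + (T.π1.wedge S.ψm : DForm (𝓡 6) M 4) - T.σ2.wedge S.ω

/-! ### Warped `G₂`-structures on `M × S¹` -/

/-- The 1-form `ds` on the circle, `s` being the angular coordinate `z = exp(i s)`:
`ds = Im(z⁻¹ dz)`. -/
def ds : DForm (𝓡 1) Circle 1 := fun z =>
  ContinuousAlternatingMap.ofSubsingleton ℝ (TangentSpace (𝓡 1) z) ℝ (0 : Fin 1)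
    (Complex.imCLM ∘L
      ((z : ℂ)⁻¹ • mvfderiv (𝓡 1) (fun w : Circle => (w : ℂ)) z))

/-- The pull-back of a form on the base `M` to `M × S¹`. -/
def liftBase {k : ℕ} (η : DForm (𝓡 6) M k) : DForm ((𝓡 6).prod (𝓡 1)) (M × Circle) k :=
  DForm.pullback Prod.fst η

/-- The pull-back of `ds` to `M × S¹`. -/
def dsLift : DForm ((𝓡 6).prod (𝓡 1)) (M × Circle) 1 :=
  DForm.pullback Prod.snd ds

/-- The warped `G₂`-form `φ = f ω ∧ ds + (α ψ₊ - β ψ₋)` on `M × S¹` with warping function `f`. -/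
def warpedForm (α β : ℝ) (f : M → ℝ) (S : SU3Structure M) :
    DForm ((𝓡 6).prod (𝓡 1)) (M × Circle) 3 :=
  DForm.fsmul (fun p => f p.1) ((liftBase S.ω).wedge dsLift)
    + (α • liftBase S.ψp - β • liftBase S.ψm)

end SU3

end WarpedG2

end

noncomputable section

set_option linter.unusedSectionVars false

namespace WarpedG2

/-! ### Decomposable forms -/

section Decomposable

variable {V : Type*} [AddCommGroup V] [Module ℝ V] [TopologicalSpace V] {k l m n : ℕ}

/-! Put `ρ = αψ₊ - βψ₋` and `ρ' = βψ₊ + αψ₋`, so that `ρ + iρ' = (α + iβ)(ψ₊ + iψ₋)`. Since `α + iβ`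
has modulus one, multiplying the first complex coordinate by it turns an adapted frame of `(ω, ψ₊,
ψ₋)` into one of `(ω, ρ, ρ')` (`IsSU3Frame.rot`). The form becomes `φ = f ω ∧ ds + ρ`, and adding `f
ds` as seventh covector gives a G₂ frame (`IsSU3Frame.isG2Frame`).

As `f` is constant on `M`, `dφ = f dω ∧ ds + dρ`. Forms `A ∧ ds + B` with `A`, `B` from `M`
determine `A` and `B` (`lift_components_eq_zero`), hence closedness means `dω = 0` and `dρ = 0`.
Uniqueness of the type decompositions then gives `σ₀ = π₀ = 0` from `dω`, and `π₁ = 0`, `απ₂ - βσ₂ =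
0` from `dρ`. What survives is `dρ' = -τ ∧ ω` with `τ = ασ₂ + βπ₂`.

Now `⋆φ = ½ω² + f ρ' ∧ ds`, and `d(ω²) = 0`, so `d⋆φ = -f τ ∧ ω ∧ ds`. Because `τ` is primitive of
type (1,1), `⋆(τ ∧ ω ∧ ds) = -f⁻¹τ`; the two factors cancel and `Δφ = -d(⋆d⋆φ) = -dτ`
(`laplacian_warpedForm`). Comparing the `ds` part and the base part with `∂φ/∂t = (f'ω + f ∂ω/∂t) ∧
ds + ∂ρ/∂t` gives the two equations.

Two supporting facts: the Hodge star of a G₂-form does not depend on the adapted frame, by `ι_u φ ∧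
ι_v φ ∧ φ = 6 g(u,v) vol` (`IsG2Frame.orthogonal`); and multilinear identities between forms are
reduced to determinants by checking them on decomposable forms (`form_induction`). -/

theorem wedge_apply (a : V [⋀^Fin k]→L[ℝ] ℝ) (b : V [⋀^Fin l]→L[ℝ] ℝ) (v : Fin (k + l) → V) :
    wedge a b v = LinearMap.mul' ℝ ℝ (a.toAlternatingMap.domCoprod b.toAlternatingMap
      (fun i => v (finSumFinEquiv i))) := rfl

/-- The decomposable form `λ₁ ∧ … ∧ λₖ`. -/
def decomp (lam : Fin k → V →L[ℝ] ℝ) : V [⋀^Fin k]→L[ℝ] ℝ :=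
  { MultilinearMap.alternatization ((MultilinearMap.mkPiAlgebra ℝ (Fin k) ℝ).compLinearMap
      fun a => (lam a : V →ₗ[ℝ] ℝ)) with
    cont := by
      change Continuous fun v : Fin k → V => MultilinearMap.alternatization
        ((MultilinearMap.mkPiAlgebra ℝ (Fin k) ℝ).compLinearMap
          fun a => (lam a : V →ₗ[ℝ] ℝ)) v
      simp only [MultilinearMap.alternatization_apply, MultilinearMap.domDomCongr_apply,
        MultilinearMap.compLinearMap_apply, MultilinearMap.mkPiAlgebra_apply]
      refine continuous_finsetSum _ fun σ _ => Continuous.const_smul ?_ _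
      refine continuous_finsetProd _ fun i _ => ?_
      exact (lam i).continuous.comp (continuous_apply _) }

theorem decomp_apply (lam : Fin k → V →L[ℝ] ℝ) (v : Fin k → V) :
    decomp lam v = Matrix.det (Matrix.of fun a c => lam c (v a)) := by
  change MultilinearMap.alternatization ((MultilinearMap.mkPiAlgebra ℝ (Fin k) ℝ).compLinearMap
          fun a => (lam a : V →ₗ[ℝ] ℝ)) v = _
  rw [MultilinearMap.alternatization_apply, Matrix.det_apply]
  rfl

theorem decomp_eq_sum (lam : Fin k → V →L[ℝ] ℝ) (v : Fin k → V) :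
    decomp lam v = ∑ σ : Equiv.Perm (Fin k), Equiv.Perm.sign σ • ∏ i, lam i (v (σ i)) := by
  rw [decomp_apply, Matrix.det_apply]
  rfl

/-- The product of two alternatizations is the alternatization of the tensor product. What remains
is to transport the sum over permutations of `Fin k ⊕ Fin l` to `Fin (k + l)`. -/
theorem wedge_decomp (lam : Fin k → V →L[ℝ] ℝ) (mu : Fin l → V →L[ℝ] ℝ) :
    wedge (decomp lam) (decomp mu) = decomp (Fin.append lam mu) := by
  ext v
  rw [wedge_apply]
  have h := MultilinearMap.domCoprod_alternization
    ((MultilinearMap.mkPiAlgebra ℝ (Fin k) ℝ).compLinearMap fun a => (lam a : V →ₗ[ℝ] ℝ))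
    ((MultilinearMap.mkPiAlgebra ℝ (Fin l) ℝ).compLinearMap fun a => (mu a : V →ₗ[ℝ] ℝ))
  change LinearMap.mul' ℝ ℝ ((AlternatingMap.domCoprod (MultilinearMap.alternatization _)
    (MultilinearMap.alternatization _)) _) = _
  rw [← h, MultilinearMap.alternatization_apply, decomp_eq_sum, map_sum]
  refine Fintype.sum_equiv (finSumFinEquiv.permCongr) _ _ fun σ => ?_
  rw [Equiv.Perm.sign_permCongr, map_zsmul_unit]
  congr 1
  simp only [MultilinearMap.domDomCongr_apply, MultilinearMap.domCoprod_apply,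
    MultilinearMap.compLinearMap_apply, MultilinearMap.mkPiAlgebra_apply, LinearMap.mul'_apply]
  rw [← finSumFinEquiv.prod_comp, Fintype.prod_sum_type]
  simp

theorem wedge_add_left (a a' : V [⋀^Fin k]→L[ℝ] ℝ) (b : V [⋀^Fin l]→L[ℝ] ℝ) :
    wedge (a + a') b = wedge a b + wedge a' b := by
  ext v
  simp only [wedge_apply, ContinuousAlternatingMap.add_apply, ← AlternatingMap.domCoprod'_apply]
  change LinearMap.mul' ℝ ℝ (AlternatingMap.domCoprod'
    ((a.toAlternatingMap + a'.toAlternatingMap) ⊗ₜ _) _) = _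
  rw [TensorProduct.add_tmul, map_add, AlternatingMap.add_apply, map_add]

theorem wedge_add_right (a : V [⋀^Fin k]→L[ℝ] ℝ) (b b' : V [⋀^Fin l]→L[ℝ] ℝ) :
    wedge a (b + b') = wedge a b + wedge a b' := by
  ext v
  simp only [wedge_apply, ContinuousAlternatingMap.add_apply, ← AlternatingMap.domCoprod'_apply]
  change LinearMap.mul' ℝ ℝ (AlternatingMap.domCoprod'
    (_ ⊗ₜ (b.toAlternatingMap + b'.toAlternatingMap)) _) = _
  rw [TensorProduct.tmul_add, map_add, AlternatingMap.add_apply, map_add]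

theorem wedge_smul_left (c : ℝ) (a : V [⋀^Fin k]→L[ℝ] ℝ) (b : V [⋀^Fin l]→L[ℝ] ℝ) :
    wedge (c • a) b = c • wedge a b := by
  ext v
  simp only [wedge_apply, ContinuousAlternatingMap.smul_apply, ← AlternatingMap.domCoprod'_apply]
  change LinearMap.mul' ℝ ℝ (AlternatingMap.domCoprod' ((c • a.toAlternatingMap) ⊗ₜ _) _) = _
  rw [← TensorProduct.smul_tmul', map_smul, AlternatingMap.smul_apply, map_smul]

theorem wedge_smul_right (c : ℝ) (a : V [⋀^Fin k]→L[ℝ] ℝ) (b : V [⋀^Fin l]→L[ℝ] ℝ) :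
    wedge a (c • b) = c • wedge a b := by
  ext v
  simp only [wedge_apply, ContinuousAlternatingMap.smul_apply, ← AlternatingMap.domCoprod'_apply]
  change LinearMap.mul' ℝ ℝ (AlternatingMap.domCoprod' (_ ⊗ₜ (c • b.toAlternatingMap)) _) = _
  rw [TensorProduct.tmul_smul, map_smul, AlternatingMap.smul_apply, map_smul]

/-- The exterior product as a bilinear map. -/
def wedgeₗ (k l : ℕ) :
    (V [⋀^Fin k]→L[ℝ] ℝ) →ₗ[ℝ] (V [⋀^Fin l]→L[ℝ] ℝ) →ₗ[ℝ] V [⋀^Fin (k + l)]→L[ℝ] ℝ :=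
  LinearMap.mk₂ ℝ wedge wedge_add_left wedge_smul_left wedge_add_right wedge_smul_right

theorem wedgeₗ_apply (a : V [⋀^Fin k]→L[ℝ] ℝ) (b : V [⋀^Fin l]→L[ℝ] ℝ) :
    wedgeₗ k l a b = wedge a b := rfl

theorem wedge_zero_left (b : V [⋀^Fin l]→L[ℝ] ℝ) : wedge (0 : V [⋀^Fin k]→L[ℝ] ℝ) b = 0 := by
  rw [← wedgeₗ_apply, map_zero, LinearMap.zero_apply]

theorem wedge_zero_right (a : V [⋀^Fin k]→L[ℝ] ℝ) : wedge a (0 : V [⋀^Fin l]→L[ℝ] ℝ) = 0 := by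
  rw [← wedgeₗ_apply, map_zero]

theorem wedge_neg_left (a : V [⋀^Fin k]→L[ℝ] ℝ) (b : V [⋀^Fin l]→L[ℝ] ℝ) :
    wedge (-a) b = -wedge a b := by
  simp only [← wedgeₗ_apply, map_neg, LinearMap.neg_apply]

theorem wedge_neg_right (a : V [⋀^Fin k]→L[ℝ] ℝ) (b : V [⋀^Fin l]→L[ℝ] ℝ) :
    wedge a (-b) = -wedge a b := by
  simp only [← wedgeₗ_apply, map_neg]

theorem wedge_sub_right (a : V [⋀^Fin k]→L[ℝ] ℝ) (b b' : V [⋀^Fin l]→L[ℝ] ℝ) :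
    wedge a (b - b') = wedge a b - wedge a b' := by
  simp only [← wedgeₗ_apply, map_sub]

variable {W : Type*} [AddCommGroup W] [Module ℝ W] [TopologicalSpace W]

theorem wedge_compContinuousLinearMap (a : V [⋀^Fin k]→L[ℝ] ℝ) (b : V [⋀^Fin l]→L[ℝ] ℝ)
    (f : W →L[ℝ] V) :
    (wedge a b).compContinuousLinearMap f =
      wedge (a.compContinuousLinearMap f) (b.compContinuousLinearMap f) := by
  ext v
  rw [ContinuousAlternatingMap.compContinuousLinearMap_apply, wedge_apply, wedge_apply]
  simp only [AlternatingMap.domCoprod_apply, sum_apply, map_sum]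
  refine Finset.sum_congr rfl fun σ _ => ?_
  induction σ using Quotient.inductionOn' with
  | h σ => rfl

theorem ofSubsingleton_eq_decomp (lam : V →L[ℝ] ℝ) :
    ContinuousAlternatingMap.ofSubsingleton ℝ V ℝ (0 : Fin 1) lam = decomp ![lam] := by
  ext v
  simp [decomp_apply]

/-! ### Expansion of forms in a coframe -/

section Basis

variable [IsTopologicalAddGroup V] [ContinuousSMul ℝ V] [T2Space V]

/-- The dual coframe of a frame. -/
def coframe (b : Module.Basis (Fin n) ℝ V) (i : Fin n) : V →L[ℝ] ℝ :=
  ⟨b.coord i, continuous_coord b i⟩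

@[simp]
theorem coframe_apply (b : Module.Basis (Fin n) ℝ V) (i : Fin n) (v : V) :
    coframe b i v = b.repr v i := rfl

/-- The form `e^{i₁ … iₖ}`. -/
def eForm (b : Module.Basis (Fin n) ℝ V) (I : Fin k → Fin n) : V [⋀^Fin k]→L[ℝ] ℝ :=
  decomp fun a => coframe b (I a)

theorem eForm_apply (b : Module.Basis (Fin n) ℝ V) (I : Fin k → Fin n) (v : Fin k → V) :
    eForm b I v = Matrix.det (Matrix.of fun a c => b.repr (v a) (I c)) := decomp_apply _ _

theorem wedge_eForm (b : Module.Basis (Fin n) ℝ V) (I : Fin k → Fin n) (J : Fin l → Fin n) :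
    wedge (eForm b I) (eForm b J) = eForm b (Fin.append I J) := by
  rw [eForm, eForm, wedge_decomp, eForm]
  congr 1
  ext a
  refine Fin.addCases (fun a => ?_) (fun a => ?_) a <;> simp

theorem e1_eq (b : Module.Basis (Fin n) ℝ V) (i : Fin n) : e1 b i = eForm b ![i] := by
  rw [e1, ofSubsingleton_eq_decomp, eForm]
  congr 1
  ext a
  fin_cases a
  rfl

theorem e2_eq (b : Module.Basis (Fin n) ℝ V) (i j : Fin n) : e2 b i j = eForm b ![i, j] := by
  rw [e2, e1_eq, e1_eq, wedge_eForm]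
  congr 1
  ext a
  fin_cases a <;> rfl

theorem e3_eq (b : Module.Basis (Fin n) ℝ V) (i j k : Fin n) :
    e3 b i j k = eForm b ![i, j, k] := by
  rw [e3, e2_eq, e1_eq, wedge_eForm]
  congr 1
  ext a
  fin_cases a <;> rfl

omit [IsTopologicalAddGroup V] [ContinuousSMul ℝ V] [T2Space V] in
theorem sum_prod_coframe (b : Module.Basis (Fin n) ℝ V) (a : V [⋀^Fin k]→ₗ[ℝ] ℝ)
    (v : Fin k → V) :
    a v = ∑ I : Fin k → Fin n, (∏ c, b.repr (v c) (I c)) * a fun c => b (I c) := by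
  conv_lhs => rw [show v = fun c => ∑ i, b.repr (v c) i • b i from
    funext fun c => (b.sum_repr (v c)).symm]
  change a.toMultilinearMap _ = _
  rw [MultilinearMap.map_sum]
  refine Finset.sum_congr rfl fun I _ => ?_
  rw [MultilinearMap.map_smul_univ]
  rfl

/-- Averaging over permutations replaces `k! a(v)` by a signed sum; expanding each term in the basis
produces the determinants. Summing over all index tuples, not only increasing ones, accounts for the
factor `k!` and avoids ordered multi-indices. -/
theorem factorial_mul_eq_sum (b : Module.Basis (Fin n) ℝ V) (a : V [⋀^Fin k]→ₗ[ℝ] ℝ)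
    (v : Fin k → V) :
    k.factorial * a v = ∑ I : Fin k → Fin n, (a fun c => b (I c)) * eForm b I v := by
  have h : ∀ σ : Equiv.Perm (Fin k), a v = Equiv.Perm.sign σ • a (v ∘ σ) := fun σ => by
    rw [a.map_perm, smul_smul, Int.units_mul_self, one_smul]
  have hs : (k.factorial : ℝ) * a v =
      ∑ σ : Equiv.Perm (Fin k), Equiv.Perm.sign σ • a (v ∘ σ) := by
    rw [Finset.sum_congr rfl fun σ _ => (h σ).symm, Finset.sum_const, Finset.card_univ,
      Fintype.card_perm, Fintype.card_fin, nsmul_eq_mul]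
  rw [hs]
  simp only [eForm, decomp_eq_sum, Finset.mul_sum]
  rw [Finset.sum_comm]
  refine Finset.sum_congr rfl fun σ _ => ?_
  rw [sum_prod_coframe b a, Finset.smul_sum]
  refine Finset.sum_congr rfl fun I _ => ?_
  rw [mul_smul_comm, mul_comm]
  rfl

theorem factorial_smul_eq_sum (b : Module.Basis (Fin n) ℝ V) (a : V [⋀^Fin k]→L[ℝ] ℝ) :
    (k.factorial : ℝ) • a = ∑ I : Fin k → Fin n, (a fun c => b (I c)) • eForm b I := by
  ext v
  simp only [ContinuousAlternatingMap.smul_apply, ContinuousAlternatingMap.sum_apply, smul_eq_mul]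
  exact factorial_mul_eq_sum b a.toAlternatingMap v

theorem eq_sum_eForm (b : Module.Basis (Fin n) ℝ V) (a : V [⋀^Fin k]→L[ℝ] ℝ) :
    a = (k.factorial : ℝ)⁻¹ • ∑ I : Fin k → Fin n, (a fun c => b (I c)) • eForm b I := by
  rw [← factorial_smul_eq_sum, inv_smul_smul₀ (by exact_mod_cast k.factorial_ne_zero)]

/-- Linear statements about forms need only be checked on decomposable forms. -/
theorem form_induction (b : Module.Basis (Fin n) ℝ V) {P : (V [⋀^Fin k]→L[ℝ] ℝ) → Prop}
    (zero : P 0) (add : ∀ a a', P a → P a' → P (a + a')) (smul : ∀ (c : ℝ) a, P a → P (c • a))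
    (decomposable : ∀ lam, P (decomp lam)) (a : V [⋀^Fin k]→L[ℝ] ℝ) : P a := by
  rw [eq_sum_eForm b a]
  exact smul _ _ (Finset.sum_induction _ P add zero fun I _ => smul _ _ (decomposable _))

theorem form_ext_basis (b : Module.Basis (Fin n) ℝ V) {a a' : V [⋀^Fin k]→L[ℝ] ℝ}
    (h : ∀ I : Fin k → Fin n, (a fun c => b (I c)) = a' fun c => b (I c)) : a = a' := by
  rw [eq_sum_eForm b a, eq_sum_eForm b a']
  simp only [h]

end Basis

end Decomposable

section Basis

variable {V : Type*} [AddCommGroup V] [Module ℝ V] [TopologicalSpace V]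
  [IsTopologicalAddGroup V] [ContinuousSMul ℝ V] [T2Space V] {k l m n : ℕ}

/-! ### Signs -/

/-- The sign of a sequence of indices, computed from its inversions (it is `0` if there are
repetitions). -/
def seqSign (K : Fin n → Fin n) : ℤ :=
  ∏ j, ∏ i ∈ Finset.Iio j, if K i < K j then 1 else if K j < K i then -1 else 0

theorem seqSign_perm (σ : Equiv.Perm (Fin n)) : seqSign σ = Equiv.Perm.sign σ := by
  rw [Equiv.Perm.sign_eq_prod_prod_Iio, seqSign]
  push_cast
  refine Finset.prod_congr rfl fun j _ => Finset.prod_congr rfl fun i hi => ?_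
  have hne : σ i ≠ σ j := fun h => (Finset.mem_Iio.1 hi).ne (σ.injective h)
  rcases lt_or_gt_of_ne hne with h | h
  · simp [h]
  · simp [h, h.not_gt]

theorem injective_of_seqSign_ne_zero {K : Fin n → Fin n} (h : seqSign K ≠ 0) :
    Function.Injective K := by
  have key : ∀ i j, i < j → K i ≠ K j := fun i j hij he => h <| by
    refine Finset.prod_eq_zero (Finset.mem_univ j)
      (Finset.prod_eq_zero (Finset.mem_Iio.2 hij) ?_)
    simp [he]
  intro i j he
  rcases lt_trichotomy i j with hij | hij | hij
  · exact absurd he (key _ _ hij)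
  · exact hij
  · exact absurd he.symm (key _ _ hij)

theorem exists_perm_of_seqSign_ne_zero {K : Fin n → Fin n} (h : seqSign K ≠ 0) :
    ∃ σ : Equiv.Perm (Fin n), ⇑σ = K ∧ (Equiv.Perm.sign σ : ℤ) = seqSign K := by
  have hb := Finite.injective_iff_bijective.1 (injective_of_seqSign_ne_zero h)
  refine ⟨Equiv.ofBijective K hb, rfl, ?_⟩
  rw [← seqSign_perm]
  rfl

/-! ### Evaluation of top-degree exterior products -/

/-- Permuting the rows by `(I, J)` makes the last `l` columns a zero block over an identity block,
so only the upper left minor is left, up to the sign of the permutation. -/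
theorem det_of_last_columns {M : Matrix (Fin (k + l)) (Fin (k + l)) ℝ}
    {I : Fin k → Fin (k + l)} {J : Fin l → Fin (k + l)} (h : seqSign (Fin.append I J) ≠ 0)
    (hM : ∀ c j, M c (Fin.natAdd k j) = if c = J j then 1 else 0) :
    M.det = seqSign (Fin.append I J) *
      (Matrix.of fun i j => M (I i) (Fin.castAdd l j)).det := by
  obtain ⟨σ, hσ, hs⟩ := exists_perm_of_seqSign_ne_zero h
  have hI : ∀ i, σ (Fin.castAdd l i) = I i := fun i => by rw [hσ, Fin.append_left]
  have hJ : ∀ i, σ (Fin.natAdd k i) = J i := fun i => by rw [hσ, Fin.append_right]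
  have h2 : (M.submatrix σ id).det = (Matrix.of fun i j => M (I i) (Fin.castAdd l j)).det := by
    rw [← Matrix.det_submatrix_equiv_self finSumFinEquiv,
      show ((M.submatrix σ id).submatrix finSumFinEquiv finSumFinEquiv) = Matrix.fromBlocks
        (Matrix.of fun i j => M (I i) (Fin.castAdd l j)) 0
        (Matrix.of fun i j => M (J i) (Fin.castAdd l j)) 1 from ?_,
      Matrix.det_fromBlocks_zero₁₂, Matrix.det_one, mul_one]
    ext i j
    rcases i with i | i <;> rcases j with j | j
    · simp [hI]
    · have : I i ≠ J j := by
        rw [← hI, ← hJ]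
        intro he
        have := congrArg Fin.val (σ.injective he)
        simp at this
        omega
      simp [hM, hI, this]
    · simp [hJ]
    · have : J i = J j ↔ i = j := by
        rw [← hJ, ← hJ, σ.injective.eq_iff, (Fin.natAdd_injective _ _).eq_iff]
      simp [hM, hJ, this, Matrix.one_apply]
  rw [← h2, Matrix.det_permute, ← hs, ← mul_assoc, ← Int.cast_mul, ← Units.val_mul,
    Int.units_mul_self, Units.val_one, Int.cast_one, one_mul]

theorem det_of_first_columns {M : Matrix (Fin (k + l)) (Fin (k + l)) ℝ}
    {I : Fin k → Fin (k + l)} {J : Fin l → Fin (k + l)} (h : seqSign (Fin.append I J) ≠ 0)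
    (hM : ∀ c j, M c (Fin.castAdd l j) = if c = I j then 1 else 0) :
    M.det = seqSign (Fin.append I J) *
      (Matrix.of fun i j => M (J i) (Fin.natAdd k j)).det := by
  obtain ⟨σ, hσ, hs⟩ := exists_perm_of_seqSign_ne_zero h
  have hI : ∀ i, σ (Fin.castAdd l i) = I i := fun i => by rw [hσ, Fin.append_left]
  have hJ : ∀ i, σ (Fin.natAdd k i) = J i := fun i => by rw [hσ, Fin.append_right]
  have h2 : (M.submatrix σ id).det = (Matrix.of fun i j => M (J i) (Fin.natAdd k j)).det := by
    rw [← Matrix.det_submatrix_equiv_self finSumFinEquiv,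
      show ((M.submatrix σ id).submatrix finSumFinEquiv finSumFinEquiv) = Matrix.fromBlocks
        1 (Matrix.of fun i j => M (I i) (Fin.natAdd k j)) 0
        (Matrix.of fun i j => M (J i) (Fin.natAdd k j)) from ?_,
      Matrix.det_fromBlocks_zero₂₁, Matrix.det_one, one_mul]
    ext i j
    rcases i with i | i <;> rcases j with j | j
    · have : I i = I j ↔ i = j := by
        rw [← hI, ← hI, σ.injective.eq_iff, (Fin.castAdd_injective _ _).eq_iff]
      simp [hM, hI, this, Matrix.one_apply]
    · simp [hI]
    · have : J i ≠ I j := by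
        rw [← hI, ← hJ]
        intro he
        have := congrArg Fin.val (σ.injective he)
        simp at this
        omega
      simp [hM, hJ, this]
    · simp [hJ]
  rw [← h2, Matrix.det_permute, ← hs, ← mul_assoc, ← Int.cast_mul, ← Units.val_mul,
    Int.units_mul_self, Units.val_one, Int.cast_one, one_mul]

theorem det_append_coframe (b : Module.Basis (Fin (k + l)) ℝ V) (lam : Fin k → V →L[ℝ] ℝ)
    (I : Fin k → Fin (k + l)) (J : Fin l → Fin (k + l)) (h : seqSign (Fin.append I J) ≠ 0) :
    decomp (Fin.append lam fun j => coframe b (J j)) b =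
      seqSign (Fin.append I J) * decomp lam fun a => b (I a) := by
  rw [decomp_apply, decomp_apply, det_of_last_columns h]
  · simp
  · intro c j
    simp [Finsupp.single_apply]

/-- On the full frame, only the component of `a` complementary to `J` contributes. The degree
equation is a hypothesis so that numerals such as `2 + 4 = 6` can be used, and the sign is a
parameter so that `decide` can supply it. -/
theorem wedge_eForm_top (hn : k + l = n) (b : Module.Basis (Fin n) ℝ V) (a : V [⋀^Fin k]→L[ℝ] ℝ)
    (I : Fin k → Fin n) (J : Fin l → Fin n) {s : ℤ}
    (hs : seqSign (Fin.append I J ∘ Fin.cast hn.symm) = s) (h : s ≠ 0) :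
    (wedge a (eForm b J) fun i => b (Fin.cast hn i)) = s * a fun i => b (I i) := by
  subst hn hs
  simp only [Fin.cast_refl, Function.comp_id, id_eq] at h ⊢
  induction a using form_induction b with
  | zero => simp [wedge_zero_left]
  | add a a' h h' =>
    rw [wedge_add_left, ContinuousAlternatingMap.add_apply, h, h',
      ContinuousAlternatingMap.add_apply, mul_add]
  | smul c a h =>
    rw [wedge_smul_left, ContinuousAlternatingMap.smul_apply, h,
      ContinuousAlternatingMap.smul_apply, smul_eq_mul, smul_eq_mul, mul_left_comm]
  | decomposable lam => rw [eForm, wedge_decomp, det_append_coframe b lam I J h]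

/-! ### The Hodge star operator on a coframe -/

/-- Both sides are determinants of Kronecker deltas, transposes of each other. -/
theorem eForm_basis_comm (b : Module.Basis (Fin n) ℝ V) (I J : Fin k → Fin n) :
    (eForm b I fun c => b (J c)) = eForm b J fun c => b (I c) := by
  rw [eForm_apply, eForm_apply, ← Matrix.det_transpose]
  congr 1
  ext i j
  simp [Finsupp.single_apply, eq_comm]

theorem sum_mul_eForm (b : Module.Basis (Fin n) ℝ V) (a : V [⋀^Fin k]→ₗ[ℝ] ℝ)
    (I : Fin k → Fin n) :
    ∑ i : Fin k → Fin n, (a fun c => b (i c)) * (eForm b I fun c => b (i c)) =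
      k.factorial * a fun c => b (I c) := by
  rw [factorial_mul_eq_sum b a]
  exact Finset.sum_congr rfl fun i _ => by rw [eForm_basis_comm]

theorem det_append_right (b : Module.Basis (Fin (k + l)) ℝ V)
    (I : Fin k → Fin (k + l)) (J : Fin l → Fin (k + l)) (h : seqSign (Fin.append I J) ≠ 0)
    (v : Fin k → V) :
    b.det (Fin.append v fun j => b (J j)) = seqSign (Fin.append I J) * eForm b I v := by
  rw [Module.Basis.det_apply, det_of_last_columns h, eForm_apply, ← Matrix.det_transpose]
  · congr 2
    ext i j
    simp [Module.Basis.toMatrix_apply]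
  · intro c j
    simp [Module.Basis.toMatrix_apply, Finsupp.single_apply, eq_comm]

theorem det_append_left (b : Module.Basis (Fin (k + l)) ℝ V)
    (I : Fin k → Fin (k + l)) (J : Fin l → Fin (k + l)) (h : seqSign (Fin.append I J) ≠ 0)
    (v : Fin l → V) :
    b.det (Fin.append (fun i => b (I i)) v) = seqSign (Fin.append I J) * eForm b J v := by
  rw [Module.Basis.det_apply, det_of_first_columns h, eForm_apply, ← Matrix.det_transpose]
  · congr 2
    ext i j
    simp [Module.Basis.toMatrix_apply]
  · intro c j
    simp [Module.Basis.toMatrix_apply, Finsupp.single_apply, eq_comm]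

theorem append_update_left {α : Type*} (u : Fin k → α) (v : Fin l → α) (j : Fin k) (x : α) :
    Fin.append (Function.update u j x) v =
      Function.update (Fin.append u v) (Fin.castAdd l j) x := by
  funext i
  refine Fin.addCases (fun a => ?_) (fun a => ?_) i
  · rw [Fin.append_left]
    by_cases h : a = j
    · subst h; simp
    · rw [Function.update_of_ne h, Function.update_of_ne, Fin.append_left]
      exact fun h' => h (Fin.castAdd_injective k l h')
  · rw [Fin.append_right, Function.update_of_ne, Fin.append_right]
    intro h
    have := congrArg Fin.val h
    simp at this
    omega

/-- The contraction of an alternating map with a tuple of vectors in its last arguments. -/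
def contractRight (D : V [⋀^Fin (k + l)]→ₗ[ℝ] ℝ) (v : Fin l → V) : V [⋀^Fin k]→ₗ[ℝ] ℝ where
  toFun w := D (Fin.append w v)
  map_update_add' := by
    intro inst w j x y
    obtain rfl : inst = instDecidableEqFin k := Subsingleton.elim _ _
    simp only [append_update_left, AlternatingMap.map_update_add]
  map_update_smul' := by
    intro inst w j c x
    obtain rfl : inst = instDecidableEqFin k := Subsingleton.elim _ _
    simp only [append_update_left, AlternatingMap.map_update_smul]
  map_eq_zero_of_eq' := by
    intro w i j hw hij
    refine D.map_eq_zero_of_eq _ (i := Fin.castAdd l i) (j := Fin.castAdd l j) ?_ ?_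
    · simpa using hw
    · exact fun h' => hij (Fin.castAdd_injective k l h')

theorem hodgeStar_apply (b : Module.Basis (Fin (k + l)) ℝ V) (a : V [⋀^Fin k]→L[ℝ] ℝ)
    (v : Fin l → V) :
    hodgeStar rfl b a v = ((k.factorial : ℝ))⁻¹ * ∑ i : Fin k → Fin (k + l),
      a (fun c => b (i c)) * b.det (Fin.append (fun c => b (i c)) v) := rfl

/-- With `b_J` inserted, the determinant in the definition of the star becomes `± e^I` on the summed
vectors, so the sum collapses to `k!` times the `I` component. -/
theorem hodgeStar_apply_basis (hn : k + l = n) (b : Module.Basis (Fin n) ℝ V) (a : V [⋀^Fin k]→L[ℝ] ℝ)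
    (I : Fin k → Fin n) (J : Fin l → Fin n) {s : ℤ}
    (hs : seqSign (Fin.append I J ∘ Fin.cast hn.symm) = s) (h : s ≠ 0) :
    (hodgeStar hn b a fun j => b (J j)) = s * a fun i => b (I i) := by
  subst hn hs
  simp only [Fin.cast_refl, Function.comp_id] at h ⊢
  have hs := sum_mul_eForm b a.toAlternatingMap I
  simp only [ContinuousAlternatingMap.coe_toAlternatingMap] at hs
  rw [hodgeStar_apply]
  simp only [det_append_right b I J h, mul_left_comm _ (seqSign (Fin.append I J) : ℝ),
    ← Finset.mul_sum]
  rw [hs]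
  have hk : (k.factorial : ℝ) ≠ 0 := by exact_mod_cast k.factorial_ne_zero
  field_simp

/-- Here the sum is evaluated the other way: pairing `e^I` with the contraction of the volume form
by `v` gives `k! vol(b_I, v)`, which is `± k! e^J(v)`. -/
theorem hodgeStar_eForm (hn : k + l = n) (b : Module.Basis (Fin n) ℝ V)
    (I : Fin k → Fin n) (J : Fin l → Fin n) {s : ℤ}
    (hs : seqSign (Fin.append I J ∘ Fin.cast hn.symm) = s) (h : s ≠ 0) :
    hodgeStar hn b (eForm b I) = (s : ℝ) • eForm b J := by
  subst hn hs
  simp only [Fin.cast_refl, Function.comp_id] at h ⊢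
  ext v
  have hs := sum_mul_eForm b (contractRight b.det v) I
  rw [hodgeStar_apply]
  simp only [mul_comm (eForm b I _)]
  refine (congrArg _ hs).trans ?_
  rw [inv_mul_cancel_left₀ (by exact_mod_cast k.factorial_ne_zero)]
  exact det_append_left b I J h v

/-- Frames that differ by an element of `SO(n)` define the same Hodge star operator. -/
theorem hodgeStar_eq_of_orthogonal (hn : k + l = n) (b c : Module.Basis (Fin n) ℝ V) (hdet : b.det = c.det)
    (horth : b.toMatrix c * (b.toMatrix c).transpose = 1) (a : V [⋀^Fin k]→L[ℝ] ℝ) :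
    hodgeStar hn c a = hodgeStar hn b a := by
  subst hn
  ext v
  rw [hodgeStar_apply, hodgeStar_apply, ← hdet]
  congr 1
  -- Expand both factors, the form and the contracted volume form, from the frame `c` to the frame
  -- `b`.
  have h1 : ∀ i : Fin k → Fin (k + l), a (fun d => c (i d)) * b.det (Fin.append (fun d => c (i d)) v)
      = ∑ p : Fin k → Fin (k + l), ∑ q : Fin k → Fin (k + l),
        (∏ d, b.toMatrix c (p d) (i d) * b.toMatrix c (q d) (i d)) *
          (a (fun d => b (p d)) * b.det (Fin.append (fun d => b (q d)) v)) := fun i => by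
    have h2 := sum_prod_coframe b a.toAlternatingMap fun d => c (i d)
    have h3 := sum_prod_coframe b (contractRight b.det v) fun d => c (i d)
    change a (fun d => c (i d)) = ∑ I : Fin k → Fin (k + l), _ * a (fun d => b (I d)) at h2
    change b.det (Fin.append (fun d => c (i d)) v) = ∑ I : Fin k → Fin (k + l), _ *
      b.det (Fin.append (fun d => b (I d)) v) at h3
    rw [h2, h3, Finset.sum_mul_sum]
    refine Finset.sum_congr rfl fun p _ => Finset.sum_congr rfl fun q _ => ?_
    rw [Finset.prod_mul_distrib]
    simp only [Module.Basis.toMatrix_apply]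
    ring
  simp only [h1]
  rw [Finset.sum_comm]
  refine Finset.sum_congr rfl fun p _ => ?_
  rw [Finset.sum_comm]
  simp only [← Finset.sum_mul]
  -- The sum over tuples factors into one sum per slot, and each of these is an entry of `P Pᵀ = 1`.
  have h4 : ∀ q : Fin k → Fin (k + l), ∑ i : Fin k → Fin (k + l),
      ∏ d, b.toMatrix c (p d) (i d) * b.toMatrix c (q d) (i d) = if p = q then 1 else 0 := by
    intro q
    have h5 := Finset.prod_univ_sum (fun _ : Fin k => (Finset.univ : Finset (Fin (k + l))))
      fun d i => b.toMatrix c (p d) i * b.toMatrix c (q d) i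
    rw [Fintype.piFinset_univ] at h5
    rw [← h5]
    have h6 : ∀ d, ∑ i, b.toMatrix c (p d) i * b.toMatrix c (q d) i =
        if p d = q d then 1 else 0 := fun d => by
      have := congrFun (congrFun horth (p d)) (q d)
      rwa [Matrix.mul_apply, Matrix.one_apply] at this
    simp only [h6, Finset.prod_ite_zero, Finset.prod_const_one]
    simp [funext_iff]
  simp only [h4, ite_mul, one_mul, zero_mul, Finset.sum_ite_eq, Finset.mem_univ, if_true]

end Basis

section Shuffle

variable {V : Type*} [AddCommGroup V] [Module ℝ V] [TopologicalSpace V]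
  [IsTopologicalAddGroup V] [ContinuousSMul ℝ V] [T2Space V] {k l m n : ℕ}

/-! ### Explicit exterior products in low degrees -/

/-- An expansion of exterior products need only be checked on decomposable forms. -/
theorem wedge_apply_of_decomp (b : Module.Basis (Fin n) ℝ V) (v : Fin (k + l) → V)
    (L : List (ℝ × (Fin k → V) × (Fin l → V)))
    (h : ∀ lam mu, decomp (Fin.append lam mu) v =
      (L.map fun t => t.1 * decomp lam t.2.1 * decomp mu t.2.2).sum)
    (x : V [⋀^Fin k]→L[ℝ] ℝ) (y : V [⋀^Fin l]→L[ℝ] ℝ) :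
    wedge x y v = (L.map fun t => t.1 * x t.2.1 * y t.2.2).sum := by
  induction x using form_induction b with
  | zero => simp [wedge_zero_left]
  | add x x' h h' =>
    simp only [wedge_add_left, ContinuousAlternatingMap.add_apply, h, h', ← List.sum_map_add]
    simp only [mul_add, add_mul]
  | smul c x h =>
    simp only [wedge_smul_left, ContinuousAlternatingMap.smul_apply, h, smul_eq_mul,
      ← List.sum_map_mul_left]
    congr 2
    ext t
    ring
  | decomposable lam =>
    induction y using form_induction b with
    | zero => simp [wedge_zero_right]
    | add x x' h h' =>
      simp only [wedge_add_right, ContinuousAlternatingMap.add_apply, h, h', ← List.sum_map_add]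
      simp only [mul_add]
    | smul c x h =>
      simp only [wedge_smul_right, ContinuousAlternatingMap.smul_apply, h, smul_eq_mul,
        ← List.sum_map_mul_left]
      congr 2
      ext t
      ring
    | decomposable mu => rw [wedge_decomp, h]

theorem wedge_one_two_apply (b : Module.Basis (Fin n) ℝ V) (x : V [⋀^Fin 1]→L[ℝ] ℝ)
    (y : V [⋀^Fin 2]→L[ℝ] ℝ) (v₀ v₁ v₂ : V) :
    wedge x y ![v₀, v₁, v₂] =
      x ![v₀] * y ![v₁, v₂] - x ![v₁] * y ![v₀, v₂] + x ![v₂] * y ![v₀, v₁] := by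
  rw [wedge_apply_of_decomp b _ [(1, ![v₀], ![v₁, v₂]), (-1, ![v₁], ![v₀, v₂]),
    (1, ![v₂], ![v₀, v₁])]]
  · simp
    ring
  · intro lam mu
    simp [decomp_apply, Matrix.det_succ_row_zero, Fin.sum_univ_succ, Fin.append, Fin.addCases,
      Fin.succAbove]
    ring

theorem wedge_one_three_apply (b : Module.Basis (Fin n) ℝ V) (x : V [⋀^Fin 1]→L[ℝ] ℝ)
    (y : V [⋀^Fin 3]→L[ℝ] ℝ) (v₀ v₁ v₂ v₃ : V) :
    wedge x y ![v₀, v₁, v₂, v₃] =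
      x ![v₀] * y ![v₁, v₂, v₃] - x ![v₁] * y ![v₀, v₂, v₃] + x ![v₂] * y ![v₀, v₁, v₃]
        - x ![v₃] * y ![v₀, v₁, v₂] := by
  rw [wedge_apply_of_decomp b _ [(1, ![v₀], ![v₁, v₂, v₃]), (-1, ![v₁], ![v₀, v₂, v₃]),
    (1, ![v₂], ![v₀, v₁, v₃]), (-1, ![v₃], ![v₀, v₁, v₂])]]
  · simp
    ring
  · intro lam mu
    simp [decomp_apply, Matrix.det_succ_row_zero, Fin.sum_univ_succ, Fin.append, Fin.addCases,
      Fin.succAbove]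
    ring

theorem wedge_two_two_apply (b : Module.Basis (Fin n) ℝ V) (x : V [⋀^Fin 2]→L[ℝ] ℝ)
    (y : V [⋀^Fin 2]→L[ℝ] ℝ) (v₀ v₁ v₂ v₃ : V) :
    wedge x y ![v₀, v₁, v₂, v₃] =
      x ![v₀, v₁] * y ![v₂, v₃] - x ![v₀, v₂] * y ![v₁, v₃] + x ![v₀, v₃] * y ![v₁, v₂]
        + x ![v₁, v₂] * y ![v₀, v₃] - x ![v₁, v₃] * y ![v₀, v₂] + x ![v₂, v₃] * y ![v₀, v₁] := by
  rw [wedge_apply_of_decomp b _ [(1, ![v₀, v₁], ![v₂, v₃]), (-1, ![v₀, v₂], ![v₁, v₃]),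
    (1, ![v₀, v₃], ![v₁, v₂]), (1, ![v₁, v₂], ![v₀, v₃]), (-1, ![v₁, v₃], ![v₀, v₂]),
    (1, ![v₂, v₃], ![v₀, v₁])]]
  · simp
    ring
  · intro lam mu
    simp [decomp_apply, Matrix.det_succ_row_zero, Fin.sum_univ_succ, Fin.append, Fin.addCases,
      Fin.succAbove]
    ring

theorem det_fin_four (M : Matrix (Fin 4) (Fin 4) ℝ) :
    M.det =
      M 0 0 * (M 1 1 * (M 2 2 * M 3 3 - M 2 3 * M 3 2) - M 1 2 * (M 2 1 * M 3 3 - M 2 3 * M 3 1)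
        + M 1 3 * (M 2 1 * M 3 2 - M 2 2 * M 3 1))
      - M 0 1 * (M 1 0 * (M 2 2 * M 3 3 - M 2 3 * M 3 2) - M 1 2 * (M 2 0 * M 3 3 - M 2 3 * M 3 0)
        + M 1 3 * (M 2 0 * M 3 2 - M 2 2 * M 3 0))
      + M 0 2 * (M 1 0 * (M 2 1 * M 3 3 - M 2 3 * M 3 1) - M 1 1 * (M 2 0 * M 3 3 - M 2 3 * M 3 0)
        + M 1 3 * (M 2 0 * M 3 1 - M 2 1 * M 3 0))
      - M 0 3 * (M 1 0 * (M 2 1 * M 3 2 - M 2 2 * M 3 1) - M 1 1 * (M 2 0 * M 3 2 - M 2 2 * M 3 0)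
        + M 1 2 * (M 2 0 * M 3 1 - M 2 1 * M 3 0)) := by
  rw [Matrix.det_succ_row_zero]
  simp only [Fin.sum_univ_four, Matrix.det_fin_three, Matrix.submatrix_apply]
  simp [Fin.succAbove]
  ring

/-- Only one level of expansion, with the minors in a shape that `det_fin_four` then expands. -/
theorem det_fin_five (M : Matrix (Fin 5) (Fin 5) ℝ) :
    M.det = M 0 0 * (M.submatrix ![1, 2, 3, 4] ![1, 2, 3, 4]).det
      - M 0 1 * (M.submatrix ![1, 2, 3, 4] ![0, 2, 3, 4]).det
      + M 0 2 * (M.submatrix ![1, 2, 3, 4] ![0, 1, 3, 4]).det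
      - M 0 3 * (M.submatrix ![1, 2, 3, 4] ![0, 1, 2, 4]).det
      + M 0 4 * (M.submatrix ![1, 2, 3, 4] ![0, 1, 2, 3]).det := by
  rw [Matrix.det_succ_row_zero, Fin.sum_univ_five,
    show (Fin.succ : Fin 4 → Fin 5) = ![1, 2, 3, 4] by decide,
    show (Fin.succAbove (0 : Fin 5)) = ![1, 2, 3, 4] by decide,
    show (Fin.succAbove (1 : Fin 5)) = ![0, 2, 3, 4] by decide,
    show (Fin.succAbove (2 : Fin 5)) = ![0, 1, 3, 4] by decide,
    show (Fin.succAbove (3 : Fin 5)) = ![0, 1, 2, 4] by decide,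
    show (Fin.succAbove (4 : Fin 5)) = ![0, 1, 2, 3] by decide]
  norm_num
  ring

theorem append_two_three {α : Type*} (f : Fin 2 → α) (g : Fin 3 → α) :
    Fin.append f g = ![f 0, f 1, g 0, g 1, g 2] := by
  ext i
  fin_cases i <;> rfl

theorem wedge_two_three_apply (b : Module.Basis (Fin n) ℝ V) (x : V [⋀^Fin 2]→L[ℝ] ℝ)
    (y : V [⋀^Fin 3]→L[ℝ] ℝ) (v₀ v₁ v₂ v₃ v₄ : V) :
    wedge x y ![v₀, v₁, v₂, v₃, v₄] =
      x ![v₀, v₁] * y ![v₂, v₃, v₄] - x ![v₀, v₂] * y ![v₁, v₃, v₄]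
        + x ![v₀, v₃] * y ![v₁, v₂, v₄] - x ![v₀, v₄] * y ![v₁, v₂, v₃]
        + x ![v₁, v₂] * y ![v₀, v₃, v₄] - x ![v₁, v₃] * y ![v₀, v₂, v₄]
        + x ![v₁, v₄] * y ![v₀, v₂, v₃] + x ![v₂, v₃] * y ![v₀, v₁, v₄]
        - x ![v₂, v₄] * y ![v₀, v₁, v₃] + x ![v₃, v₄] * y ![v₀, v₁, v₂] := by
  rw [wedge_apply_of_decomp b _ [(1, ![v₀, v₁], ![v₂, v₃, v₄]), (-1, ![v₀, v₂], ![v₁, v₃, v₄]),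
    (1, ![v₀, v₃], ![v₁, v₂, v₄]), (-1, ![v₀, v₄], ![v₁, v₂, v₃]),
    (1, ![v₁, v₂], ![v₀, v₃, v₄]), (-1, ![v₁, v₃], ![v₀, v₂, v₄]),
    (1, ![v₁, v₄], ![v₀, v₂, v₃]), (1, ![v₂, v₃], ![v₀, v₁, v₄]),
    (-1, ![v₂, v₄], ![v₀, v₁, v₃]), (1, ![v₃, v₄], ![v₀, v₁, v₂])]]
  · simp
    ring
  · intro lam mu
    rw [append_two_three]
    refine (decomp_apply _ _).trans ((det_fin_five _).trans ?_)
    simp only [decomp_apply, det_fin_four, Matrix.submatrix_apply,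
      Matrix.of_apply, Matrix.cons_val, List.map_cons, List.map_nil, List.sum_cons, List.sum_nil,
      Matrix.det_fin_three, Matrix.det_fin_two]
    ring

end Shuffle

/-! ### Linear algebra of SU(3)-structures in dimension six -/

section SixDim

variable {V : Type*} [AddCommGroup V] [Module ℝ V] [TopologicalSpace V]
  [IsTopologicalAddGroup V] [ContinuousSMul ℝ V] [T2Space V] {k l m n : ℕ}

theorem eForm_eq_zero (b : Module.Basis (Fin n) ℝ V) {I : Fin k → Fin n} {i j : Fin k}
    (hij : i ≠ j) (h : I i = I j) : eForm b I = 0 := by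
  ext v
  rw [eForm_apply]
  exact Matrix.det_zero_of_column_eq hij fun a => by simp [h]

theorem append_two_two {α : Type*} (f : Fin 2 → α) (g : Fin 2 → α) :
    Fin.append f g = ![f 0, f 1, g 0, g 1] := by
  ext i
  fin_cases i <;> rfl

/-! ### Rotation of adapted frames -/

/-- The rotation by an angle with cosine `α` and sine `β` in the first two coordinates. -/
def rotEquiv (α β : ℝ) (h : α ^ 2 + β ^ 2 = 1) : (Fin 6 → ℝ) ≃ₗ[ℝ] (Fin 6 → ℝ) where
  toFun x := ![α * x 0 - β * x 1, β * x 0 + α * x 1, x 2, x 3, x 4, x 5]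
  invFun x := ![α * x 0 + β * x 1, -β * x 0 + α * x 1, x 2, x 3, x 4, x 5]
  map_add' x y := by
    ext i
    fin_cases i <;> simp <;> ring
  map_smul' c x := by
    ext i
    fin_cases i <;> simp <;> ring
  left_inv x := by
    ext i
    fin_cases i <;> simp
    · linear_combination x 0 * h
    · linear_combination x 1 * h
  right_inv x := by
    ext i
    fin_cases i <;> simp
    · linear_combination x 0 * h
    · linear_combination x 1 * h

/-- The frame obtained by rotating the first two vectors of `b`. -/
def rotFrame (α β : ℝ) (h : α ^ 2 + β ^ 2 = 1) (b : Module.Basis (Fin 6) ℝ V) :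
    Module.Basis (Fin 6) ℝ V :=
  Module.Basis.ofEquivFun (b.equivFun.trans (rotEquiv α β h))

omit [TopologicalSpace V] [IsTopologicalAddGroup V] [ContinuousSMul ℝ V] [T2Space V] in
theorem rotFrame_repr (α β : ℝ) (h : α ^ 2 + β ^ 2 = 1) (b : Module.Basis (Fin 6) ℝ V) (v : V)
    (i : Fin 6) :
    (rotFrame α β h b).repr v i = ![α * b.repr v 0 - β * b.repr v 1,
      β * b.repr v 0 + α * b.repr v 1, b.repr v 2, b.repr v 3, b.repr v 4, b.repr v 5] i := rfl

/-- In complex coordinates `ψ₊ + iψ₋ = dz₁ ∧ dz₂ ∧ dz₃`. The new frame replaces `z₁` by `(α + iβ)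
z₁`, which multiplies this form by `α + iβ` and keeps `ω` because the factor is unitary. -/
theorem IsSU3Frame.rot {ω : V [⋀^Fin 2]→L[ℝ] ℝ} {ψp ψm : V [⋀^Fin 3]→L[ℝ] ℝ}
    {b : Module.Basis (Fin 6) ℝ V} (hb : IsSU3Frame ω ψp ψm b) {α β : ℝ}
    (h : α ^ 2 + β ^ 2 = 1) :
    IsSU3Frame ω (α • ψp - β • ψm) (β • ψp + α • ψm) (rotFrame α β h b) := by
  obtain ⟨rfl, rfl, rfl⟩ := hb
  refine ⟨?_, ?_, ?_⟩
  · ext v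
    simp [e2_eq, eForm_apply, Matrix.det_fin_two, rotFrame_repr]
    linear_combination (-(b.repr (v 0) 0 * b.repr (v 1) 1) + b.repr (v 0) 1 * b.repr (v 1) 0) * h
  · ext v
    simp [e3_eq, eForm_apply, Matrix.det_fin_three, rotFrame_repr]
    ring
  · ext v
    simp [e3_eq, eForm_apply, Matrix.det_fin_three, rotFrame_repr]
    ring

/-! ### Values on adapted frames -/

variable {ω : V [⋀^Fin 2]→L[ℝ] ℝ} {ψp ψm : V [⋀^Fin 3]→L[ℝ] ℝ} {b : Module.Basis (Fin 6) ℝ V}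

theorem IsSU3Frame.ω_apply (hb : IsSU3Frame ω ψp ψm b) (v w : V) :
    ω ![v, w] = b.repr v 0 * b.repr w 1 - b.repr v 1 * b.repr w 0
      + (b.repr v 2 * b.repr w 3 - b.repr v 3 * b.repr w 2)
      + (b.repr v 4 * b.repr w 5 - b.repr v 5 * b.repr w 4) := by
  rw [hb.1]
  simp [e2_eq, eForm_apply, Matrix.det_fin_two]

/-- The `3 × 3` minor of three vectors, with respect to the coordinates `i, j, k`. -/
def minor3 (b : Module.Basis (Fin n) ℝ V) (i j k : Fin n) (u v w : V) : ℝ :=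
  b.repr u i * (b.repr v j * b.repr w k - b.repr v k * b.repr w j)
    - b.repr u j * (b.repr v i * b.repr w k - b.repr v k * b.repr w i)
    + b.repr u k * (b.repr v i * b.repr w j - b.repr v j * b.repr w i)

theorem eForm_three_apply (b : Module.Basis (Fin n) ℝ V) (i j k : Fin n) (u v w : V) :
    eForm b ![i, j, k] ![u, v, w] = minor3 b i j k u v w := by
  simp [eForm_apply, Matrix.det_fin_three, minor3]
  ring

theorem IsSU3Frame.ψp_apply (hb : IsSU3Frame ω ψp ψm b) (u v w : V) :
    ψp ![u, v, w] = minor3 b 0 2 4 u v w - minor3 b 0 3 5 u v w - minor3 b 1 2 5 u v w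
      - minor3 b 1 3 4 u v w := by
  rw [hb.2.1]
  simp [e3_eq, eForm_three_apply]

theorem IsSU3Frame.ψm_apply (hb : IsSU3Frame ω ψp ψm b) (u v w : V) :
    ψm ![u, v, w] = -minor3 b 1 3 5 u v w + minor3 b 1 2 4 u v w + minor3 b 0 3 4 u v w
      + minor3 b 0 2 5 u v w := by
  rw [hb.2.2]
  simp [e3_eq, eForm_three_apply]

/-! ### Primitive forms of type `(1,1)` -/

omit [IsTopologicalAddGroup V] [ContinuousSMul ℝ V] [T2Space V] in
theorem two_form_swap (σ : V [⋀^Fin 2]→L[ℝ] ℝ) (v w : V) : σ ![v, w] = -σ ![w, v] := by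
  have h := σ.toAlternatingMap.map_swap ![w, v] (i := 0) (j := 1) (by decide)
  rw [show (![w, v] : Fin 2 → V) ∘ Equiv.swap 0 1 = ![v, w] by
    ext i
    fin_cases i <;> rfl] at h
  exact h

omit [IsTopologicalAddGroup V] [ContinuousSMul ℝ V] [T2Space V] in
theorem two_form_self (σ : V [⋀^Fin 2]→L[ℝ] ℝ) (v : V) : σ ![v, v] = 0 := by
  linarith [two_form_swap σ v v]

theorem two_form_ext (b : Module.Basis (Fin n) ℝ V) {σ τ : V [⋀^Fin 2]→L[ℝ] ℝ}
    (h : ∀ i j, i < j → σ ![b i, b j] = τ ![b i, b j]) : σ = τ := by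
  refine form_ext_basis b fun I => ?_
  rw [show (fun c => b (I c)) = ![b (I 0), b (I 1)] by
    ext i
    fin_cases i <;> rfl]
  rcases lt_trichotomy (I 0) (I 1) with hI | hI | hI
  · exact h _ _ hI
  · rw [hI, two_form_self, two_form_self]
  · rw [two_form_swap σ, two_form_swap τ, h _ _ hI]

/-- The components of a primitive 2-form of type `(1,1)` with respect to an adapted frame. -/
structure IsPrimitive11 (b : Module.Basis (Fin 6) ℝ V) (σ : V [⋀^Fin 2]→L[ℝ] ℝ) : Prop where
  h02 : σ ![b 0, b 2] = σ ![b 1, b 3]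
  h03 : σ ![b 0, b 3] = -σ ![b 1, b 2]
  h04 : σ ![b 0, b 4] = σ ![b 1, b 5]
  h05 : σ ![b 0, b 5] = -σ ![b 1, b 4]
  h24 : σ ![b 2, b 4] = σ ![b 3, b 5]
  h25 : σ ![b 2, b 5] = -σ ![b 3, b 4]
  trace : σ ![b 0, b 1] + σ ![b 2, b 3] + σ ![b 4, b 5] = 0

theorem wedge_ω_ω (hb : IsSU3Frame ω ψp ψm b) :
    wedge ω ω = (2 : ℝ) • (eForm b ![0, 1, 2, 3] + eForm b ![0, 1, 4, 5]
      + eForm b ![2, 3, 4, 5]) := by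
  have hz : ∀ i j : Fin 6, eForm b ![i, j, i, j] = 0 := fun i j =>
    eForm_eq_zero b (i := 0) (j := 2) (by decide) rfl
  have hs : ∀ i j p q : Fin 6, eForm b ![i, j, p, q] = eForm b ![p, q, i, j] := by
    intro i j p q
    ext v
    simp only [eForm_apply, det_fin_four, Matrix.of_apply, Matrix.cons_val]
    ring
  rw [hb.1]
  simp only [e2_eq, wedge_add_left, wedge_add_right, wedge_eForm, append_two_two, Matrix.cons_val,
    hz]
  rw [hs 2 3 0 1, hs 4 5 0 1, hs 4 5 2 3]
  module

/-- The value of `σ ∧ ω²` on the frame is twice the trace. -/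
theorem trace_eq_zero_of_wedge (hb : IsSU3Frame ω ψp ψm b) {σ : V [⋀^Fin 2]→L[ℝ] ℝ}
    (hσ : wedge σ (wedge ω ω) = 0) :
    σ ![b 0, b 1] + σ ![b 2, b 3] + σ ![b 4, b 5] = 0 := by
  have h₁ : wedge σ ((2 : ℝ) • (eForm b ![0, 1, 2, 3] + eForm b ![0, 1, 4, 5]
      + eForm b ![2, 3, 4, 5])) = 0 := (congrArg (wedge σ) (wedge_ω_ω hb)).symm.trans hσ
  have h : (wedge σ ((2 : ℝ) • (eForm b ![0, 1, 2, 3] + eForm b ![0, 1, 4, 5]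
      + eForm b ![2, 3, 4, 5])) fun i => b (Fin.cast (rfl : 2 + 4 = 6) i)) = 0 := by
    rw [h₁]
    rfl
  have hv : ∀ i j : Fin 6, (fun a => b (![i, j] a)) = ![b i, b j] := fun i j => by
    ext a
    fin_cases a <;> rfl
  have key : ∀ (I : Fin 2 → Fin 6) (J : Fin 4 → Fin 6),
      seqSign (Fin.append I J ∘ Fin.cast (rfl : 6 = 2 + 4)) = 1 →
        (wedge σ (eForm b J) fun i => b (Fin.cast (rfl : 2 + 4 = 6) i)) = σ fun a => b (I a) :=
    fun I J hs => (wedge_eForm_top (k := 2) (l := 4) (n := 6) rfl b σ I J hs one_ne_zero).trans (by simp)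
  rw [wedge_smul_right, wedge_add_right, wedge_add_right] at h
  simp only [ContinuousAlternatingMap.smul_apply, ContinuousAlternatingMap.add_apply,
    smul_eq_mul] at h
  have k1 := key ![4, 5] ![0, 1, 2, 3] (by decide +kernel)
  have k2 := key ![2, 3] ![0, 1, 4, 5] (by decide +kernel)
  have k3 := key ![0, 1] ![2, 3, 4, 5] (by decide +kernel)
  rw [hv] at k1 k2 k3
  simp only [k1, k2, k3] at h
  linarith

/-- The combination `αψ₊ + βψ₋` is there because the lemma is applied to the rotated pair `(ρ, ρ')`,
for which `αρ + βρ'` is the original `ψ₊`. -/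
theorem isPrimitive11_of_wedge (hb : IsSU3Frame ω ψp ψm b) {α β : ℝ} (h : α ^ 2 + β ^ 2 = 1)
    {σ : V [⋀^Fin 2]→L[ℝ] ℝ} (hσ : wedge σ (α • ψp + β • ψm) = 0)
    (hσ' : wedge σ (wedge ω ω) = 0) : IsPrimitive11 b σ := by
  have key : ∀ v₀ v₁ v₂ v₃ v₄ : V, wedge σ (α • ψp + β • ψm) ![v₀, v₁, v₂, v₃, v₄] = 0 :=
    fun _ _ _ _ _ => by rw [hσ]; rfl
  have h0 := key (b 1) (b 2) (b 3) (b 4) (b 5)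
  have h1 := key (b 0) (b 2) (b 3) (b 4) (b 5)
  have h2 := key (b 0) (b 1) (b 3) (b 4) (b 5)
  have h3 := key (b 0) (b 1) (b 2) (b 4) (b 5)
  have h4 := key (b 0) (b 1) (b 2) (b 3) (b 5)
  have h5 := key (b 0) (b 1) (b 2) (b 3) (b 4)
  simp [wedge_two_three_apply b, hb.ψp_apply, hb.ψm_apply, minor3] at h0 h1 h2 h3 h4 h5
  constructor
  -- The six components of the 5-form group into three pairs. Each pair is a rotation by `(α, β)`,
  -- up to signs, of two of the wanted relations, and is inverted using `α² + β² = 1`.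
  · linear_combination α * h5 + β * h4 - (σ ![b 0, b 2] - σ ![b 1, b 3]) * h
  · linear_combination β * h5 - α * h4 - (σ ![b 0, b 3] + σ ![b 1, b 2]) * h
  · linear_combination -α * h3 - β * h2 - (σ ![b 0, b 4] - σ ![b 1, b 5]) * h
  · linear_combination α * h2 - β * h3 - (σ ![b 0, b 5] + σ ![b 1, b 4]) * h
  · linear_combination α * h1 + β * h0 - (σ ![b 2, b 4] - σ ![b 3, b 5]) * h
  · linear_combination β * h1 - α * h0 - (σ ![b 2, b 5] + σ ![b 3, b 4]) * h
  · exact trace_eq_zero_of_wedge hb hσ'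

/-- `⟨ω²⟩ ⊕ {q ∧ ψ₊} ⊕ {σ ∧ ω : σ ∈ Ω²₈}` is a direct sum. -/
theorem four_form_decomposition_unique (hb : IsSU3Frame ω ψp ψm b) {p : ℝ}
    {q : V [⋀^Fin 1]→L[ℝ] ℝ} {σ : V [⋀^Fin 2]→L[ℝ] ℝ} (hσ : IsPrimitive11 b σ)
    (h : p • wedge ω ω + (wedge q ψp : V [⋀^Fin 4]→L[ℝ] ℝ) - wedge σ ω = 0) :
    p = 0 ∧ q = 0 ∧ σ = 0 := by
  obtain ⟨r1, r2, r3, r4, r5, r6, r7⟩ := hσ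
  have key : ∀ v₀ v₁ v₂ v₃ : V, p * wedge ω ω ![v₀, v₁, v₂, v₃] + wedge q ψp ![v₀, v₁, v₂, v₃]
      - wedge σ ω ![v₀, v₁, v₂, v₃] = 0 :=
    fun v₀ v₁ v₂ v₃ => congrArg (fun η : V [⋀^Fin 4]→L[ℝ] ℝ => η ![v₀, v₁, v₂, v₃]) h
  have a0123 := key (b 0) (b 1) (b 2) (b 3)
  have a0124 := key (b 0) (b 1) (b 2) (b 4)
  have a0125 := key (b 0) (b 1) (b 2) (b 5)
  have a0134 := key (b 0) (b 1) (b 3) (b 4)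
  have a0135 := key (b 0) (b 1) (b 3) (b 5)
  have a0145 := key (b 0) (b 1) (b 4) (b 5)
  have a0234 := key (b 0) (b 2) (b 3) (b 4)
  have a0235 := key (b 0) (b 2) (b 3) (b 5)
  have a0245 := key (b 0) (b 2) (b 4) (b 5)
  have a0345 := key (b 0) (b 3) (b 4) (b 5)
  have a1234 := key (b 1) (b 2) (b 3) (b 4)
  have a1235 := key (b 1) (b 2) (b 3) (b 5)
  have a1245 := key (b 1) (b 2) (b 4) (b 5)
  have a1345 := key (b 1) (b 3) (b 4) (b 5)
  have a2345 := key (b 2) (b 3) (b 4) (b 5)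
  clear key
  simp [wedge_two_two_apply b, wedge_one_three_apply b, hb.ω_apply, hb.ψp_apply, minor3] at *
  -- Among the index pairs {0,1}, {2,3}, {4,5}, a component containing exactly one of them involves
  -- one value of `q` and one off-diagonal value of `σ`. Two such components have `σ` values tied by
  -- a (1,1) relation and together force that value of `q` to vanish.
  have hq : ∀ i, q ![b i] = 0 := by
    intro i
    fin_cases i <;> simp only [Fin.zero_eta, Fin.mk_one, Fin.reduceFinMk] <;> linarith
  -- The three components made of two index pairs contain no `q`; their sum is `6p` minus twice the
  -- trace of `σ`.
  have hp : p = 0 := by linarith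
  refine ⟨hp, form_ext_basis b fun I => ?_, two_form_ext b fun i j hij => ?_⟩
  · rw [show (fun c => b (I c)) = ![b (I 0)] by
      ext i
      fin_cases i
      rfl]
    exact hq _
  · change σ ![b i, b j] = 0
    have := hq 0
    have := hq 1
    have := hq 2
    have := hq 3
    have := hq 4
    have := hq 5
    fin_cases i <;> fin_cases j <;> first
      | exact absurd hij (by decide)
      | (simp only [Fin.zero_eta, Fin.mk_one, Fin.reduceFinMk]; linarith)

/-- The components of `dω` in `⟨ψ₊⟩ ⊕ ⟨ψ₋⟩` are determined by `dω`. -/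
theorem three_form_decomposition_unique (hb : IsSU3Frame ω ψp ψm b) {x y : ℝ}
    {ν : V [⋀^Fin 1]→L[ℝ] ℝ} {γ : V [⋀^Fin 3]→L[ℝ] ℝ} (hp : wedge γ ψp = 0)
    (hm : wedge γ ψm = 0)
    (h : x • ψp + y • ψm + (wedge ν ω : V [⋀^Fin 3]→L[ℝ] ℝ) + γ = 0) : x = 0 ∧ y = 0 := by
  have hv : ∀ i j k : Fin 6, (fun a => b (![i, j, k] a)) = ![b i, b j, b k] := fun i j k => by
    ext a
    fin_cases a <;> rfl
  have hp' : (wedge γ ψp fun i => b (Fin.cast (rfl : 3 + 3 = 6) i)) = 0 := by rw [hp]; rfl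
  have hm' : (wedge γ ψm fun i => b (Fin.cast (rfl : 3 + 3 = 6) i)) = 0 := by rw [hm]; rfl
  have key : ∀ (i j k : Fin 6) (J : Fin 3 → Fin 6) (s : ℤ),
      seqSign (Fin.append ![i, j, k] J ∘ Fin.cast (rfl : 6 = 3 + 3)) = s → s ≠ 0 →
        (wedge γ (eForm b J) fun i => b (Fin.cast (rfl : 3 + 3 = 6) i)) = s * γ ![b i, b j, b k] :=
    fun i j k J s hs h0 => by
      rw [← hv]
      exact wedge_eForm_top (k := 3) (l := 3) (n := 6) rfl b γ ![i, j, k] J hs h0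
  -- Solve for `γ` and substitute. In `γ ∧ ψ₊ = 0` the terms `ψ₊ ∧ ψ₊` and `ν ∧ ω ∧ ψ₊` vanish,
  -- which leaves a multiple of `y`; in the same way `γ ∧ ψ₋ = 0` isolates `x`.
  have hγ : ∀ u v w : V, γ ![u, v, w] = -x * ψp ![u, v, w] - y * ψm ![u, v, w]
      - wedge ν ω ![u, v, w] := fun u v w => by
    have := congrArg (fun η : V [⋀^Fin 3]→L[ℝ] ℝ => η ![u, v, w]) h
    change x * ψp ![u, v, w] + y * ψm ![u, v, w] + wedge ν ω ![u, v, w] + γ ![u, v, w] = 0 at this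
    linarith
  rw [hb.2.1] at hp'
  rw [hb.2.2] at hm'
  simp only [e3_eq, wedge_add_right, wedge_sub_right, wedge_neg_right,
    ContinuousAlternatingMap.add_apply, ContinuousAlternatingMap.sub_apply,
    ContinuousAlternatingMap.neg_apply] at hp' hm'
  simp only [key 1 3 5 ![0, 2, 4] 1 (by decide +kernel) (by decide),
    key 1 2 4 ![0, 3, 5] 1 (by decide +kernel) (by decide),
    key 0 3 4 ![1, 2, 5] 1 (by decide +kernel) (by decide),
    key 0 2 5 ![1, 3, 4] 1 (by decide +kernel) (by decide)] at hp'
  simp only [key 0 2 4 ![1, 3, 5] (-1) (by decide +kernel) (by decide),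
    key 0 3 5 ![1, 2, 4] (-1) (by decide +kernel) (by decide),
    key 1 2 5 ![0, 3, 4] (-1) (by decide +kernel) (by decide),
    key 1 3 4 ![0, 2, 5] (-1) (by decide +kernel) (by decide)] at hm'
  simp [hγ, wedge_one_two_apply b, hb.ω_apply, hb.ψp_apply, hb.ψm_apply, minor3] at hp' hm'
  constructor <;> linarith

end SixDim

/-! ### G₂-forms in dimension seven and products with a line -/

section SevenDim

variable {V : Type*} [AddCommGroup V] [Module ℝ V] [TopologicalSpace V] {k l m n : ℕ}

/-- The contraction `ι_u η`. -/
def contract (η : V [⋀^Fin (n + 1)]→L[ℝ] ℝ) (u : V) : V [⋀^Fin n]→L[ℝ] ℝ :=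
  { η.toAlternatingMap.curryLeft u with
    cont := by
      change Continuous fun v : Fin n → V => η (Matrix.vecCons u v)
      exact η.cont.comp (continuous_const.matrixVecCons continuous_id) }

variable [IsTopologicalAddGroup V] [ContinuousSMul ℝ V] [T2Space V]

theorem IsG2Frame.apply {φ : V [⋀^Fin 3]→L[ℝ] ℝ} {b : Module.Basis (Fin 7) ℝ V}
    (hb : IsG2Frame φ b) (u v w : V) :
    φ ![u, v, w] = minor3 b 0 1 6 u v w + minor3 b 2 3 6 u v w + minor3 b 4 5 6 u v w
      + minor3 b 0 2 4 u v w - minor3 b 0 3 5 u v w - minor3 b 1 2 5 u v w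
      - minor3 b 1 3 4 u v w := by
  rw [hb]
  simp [e3_eq, eForm_three_apply]

/-- The seven components of `θ` that appear are those complementary to the terms of `φ`, that is,
the terms of `⋆φ`. -/
theorem IsG2Frame.wedge_top {φ : V [⋀^Fin 3]→L[ℝ] ℝ} {b : Module.Basis (Fin 7) ℝ V}
    (hb : IsG2Frame φ b) (θ : V [⋀^Fin 4]→L[ℝ] ℝ) :
    (wedge θ φ fun i => b (Fin.cast (rfl : 4 + 3 = 7) i)) =
      θ ![b 2, b 3, b 4, b 5] + θ ![b 0, b 1, b 4, b 5] + θ ![b 0, b 1, b 2, b 3]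
        - θ ![b 1, b 3, b 5, b 6] + θ ![b 1, b 2, b 4, b 6] + θ ![b 0, b 3, b 4, b 6]
        + θ ![b 0, b 2, b 5, b 6] := by
  have hv : ∀ i j k l : Fin 7, (fun a => b (![i, j, k, l] a)) = ![b i, b j, b k, b l] :=
    fun i j k l => by
      ext a
      fin_cases a <;> rfl
  have key : ∀ (i j k l : Fin 7) (J : Fin 3 → Fin 7) (s : ℤ),
      seqSign (Fin.append ![i, j, k, l] J ∘ Fin.cast (rfl : 7 = 4 + 3)) = s → s ≠ 0 →
        (wedge θ (eForm b J) fun i => b (Fin.cast (rfl : 4 + 3 = 7) i)) =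
          s * θ ![b i, b j, b k, b l] :=
    fun i j k l J s hs h0 => by
      rw [← hv]
      exact wedge_eForm_top (k := 4) (l := 3) (n := 7) rfl b θ ![i, j, k, l] J hs h0
  rw [hb]
  simp only [e3_eq, wedge_add_right, wedge_sub_right, ContinuousAlternatingMap.add_apply,
    ContinuousAlternatingMap.sub_apply]
  simp only [key 2 3 4 5 ![0, 1, 6] 1 (by decide +kernel) (by decide),
    key 0 1 4 5 ![2, 3, 6] 1 (by decide +kernel) (by decide),
    key 0 1 2 3 ![4, 5, 6] 1 (by decide +kernel) (by decide),
    key 1 3 5 6 ![0, 2, 4] (-1) (by decide +kernel) (by decide),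
    key 1 2 4 6 ![0, 3, 5] (-1) (by decide +kernel) (by decide),
    key 0 3 4 6 ![1, 2, 5] (-1) (by decide +kernel) (by decide),
    key 0 2 5 6 ![1, 3, 4] (-1) (by decide +kernel) (by decide)]
  push_cast
  ring

/-- The form `θ` is `ι_u φ ∧ ι_v φ`. -/
def IsContractSquare (φ : V [⋀^Fin 3]→L[ℝ] ℝ) (u v : V) (θ : V [⋀^Fin 4]→L[ℝ] ℝ) : Prop :=
  ∀ v₀ v₁ v₂ v₃ : V, θ ![v₀, v₁, v₂, v₃] =
    φ ![u, v₀, v₁] * φ ![v, v₂, v₃] - φ ![u, v₀, v₂] * φ ![v, v₁, v₃]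
      + φ ![u, v₀, v₃] * φ ![v, v₁, v₂] + φ ![u, v₁, v₂] * φ ![v, v₀, v₃]
      - φ ![u, v₁, v₃] * φ ![v, v₀, v₂] + φ ![u, v₂, v₃] * φ ![v, v₀, v₁]

theorem exists_isContractSquare (b : Module.Basis (Fin n) ℝ V) (φ : V [⋀^Fin 3]→L[ℝ] ℝ)
    (u v : V) : ∃ θ, IsContractSquare φ u v θ :=
  ⟨wedge (contract φ u) (contract φ v), fun v₀ v₁ v₂ v₃ =>
    wedge_two_two_apply b (contract φ u) (contract φ v) v₀ v₁ v₂ v₃⟩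

/-- `ι_u φ ∧ ι_v φ ∧ φ = 6 g(u, v) vol`. -/
theorem IsG2Frame.wedge_contract {φ : V [⋀^Fin 3]→L[ℝ] ℝ} {b : Module.Basis (Fin 7) ℝ V}
    (hb : IsG2Frame φ b) {u v : V} {θ : V [⋀^Fin 4]→L[ℝ] ℝ} (hθ : IsContractSquare φ u v θ) :
    (wedge θ φ fun i => b (Fin.cast (rfl : 4 + 3 = 7) i)) =
      6 * ∑ i, b.repr u i * b.repr v i := by
  have hφ : ∀ (u : V) (i j : Fin 7), φ ![u, b i, b j] = _ := fun u i j => hb.apply u (b i) (b j)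
  rw [hb.wedge_top, hθ, hθ, hθ, hθ, hθ, hθ, hθ]
  simp [hφ, minor3]
  simp [Fin.sum_univ_succ]
  ring

omit [IsTopologicalAddGroup V] [ContinuousSMul ℝ V] [T2Space V] in
theorem top_form_apply (h : m = n) (b c : Module.Basis (Fin n) ℝ V) (X : V [⋀^Fin m]→L[ℝ] ℝ) :
    (X fun i => c (Fin.cast h i)) = (X fun i => b (Fin.cast h i)) * b.det c := by
  subst h
  have := congrArg (fun F => F c) (AlternatingMap.eq_smul_basis_det b X.toAlternatingMap)
  exact this

/-- Two adapted frames of a `G₂`-form differ by an element of `SO(7)`. -/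
theorem IsG2Frame.orthogonal {φ : V [⋀^Fin 3]→L[ℝ] ℝ} {b c : Module.Basis (Fin 7) ℝ V}
    (hb : IsG2Frame φ b) (hc : IsG2Frame φ c) :
    b.det = c.det ∧ b.toMatrix c * (b.toMatrix c).transpose = 1 := by
  set P := b.toMatrix c with hP
  have hdet : b.det = b.det c • c.det := AlternatingMap.eq_smul_basis_det c b.det
  have h1 : ∀ u v, (∑ i, c.repr u i * c.repr v i) =
      P.det * ∑ i, b.repr u i * b.repr v i := fun u v => by
    obtain ⟨θ, hθ⟩ := exists_isContractSquare b φ u v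
    have hb' := hb.wedge_contract hθ
    have hc' := hc.wedge_contract hθ
    have h2 := top_form_apply (rfl : 4 + 3 = 7) b c (wedge θ φ)
    simp only [hc', hb', Module.Basis.det_apply] at h2
    linarith
  -- The 7-form `ι_u φ ∧ ι_v φ ∧ φ` is independent of the frame, but its value on a frame scales by
  -- `det P`; so the two metrics agree up to this factor.
  have h3 : P.det • (P.transpose * P) = 1 := by
    ext i j
    have := h1 (c i) (c j)
    rw [Matrix.smul_apply, Matrix.mul_apply, Matrix.one_apply, smul_eq_mul]
    simp only [Matrix.transpose_apply, hP, Module.Basis.toMatrix_apply]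
    rw [hP] at this
    rw [← this]
    simp [Finsupp.single_apply]
  -- In dimension seven the scalar contributes `(det P)^7` and `PᵀP` contributes `(det P)^2`. The
  -- exponent is odd, so the real number `det P` is `1`, which fixes the orientation as well as the
  -- metric.
  have h4 : P.det ^ 9 = 1 := by
    have := congrArg Matrix.det h3
    rw [Matrix.det_smul, Matrix.det_mul, Matrix.det_transpose, Matrix.det_one,
      Fintype.card_fin] at this
    linarith
  have h5 : P.det = 1 := by
    have h6 : (0 : ℝ) ≤ P.det := by
      by_contra hneg
      have := Odd.pow_neg (n := 9) (by decide) (not_le.1 hneg)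
      linarith
    exact (pow_eq_one_iff_of_nonneg h6 (by norm_num)).1 h4
  rw [h5, one_smul] at h3
  refine ⟨?_, mul_eq_one_comm.1 h3⟩
  rw [hdet, Module.Basis.det_apply, ← hP, h5, one_smul]

/-- Frees the star from the frame picked by choice: any adapted frame at hand may be used to compute
it. -/
theorem hodgeStarG2_eq {φ : V [⋀^Fin 3]→L[ℝ] ℝ} {b : Module.Basis (Fin 7) ℝ V}
    (hb : IsG2Frame φ b) (h : k + l = 7) (η : V [⋀^Fin k]→L[ℝ] ℝ) :
    hodgeStarG2 h φ η = hodgeStar h b η := by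
  have hex : ∃ b : Module.Basis (Fin 7) ℝ V, IsG2Frame φ b := ⟨b, hb⟩
  rw [hodgeStarG2, dif_pos hex]
  obtain ⟨h1, h2⟩ := hb.orthogonal hex.choose_spec
  exact hodgeStar_eq_of_orthogonal h b _ h1 h2 η

/-! ### Linearity of the Hodge star operator -/

/-- The Hodge star operator as a linear map. -/
def hodgeStarₗ (h : k + l = n) (b : Module.Basis (Fin n) ℝ V) :
    (V [⋀^Fin k]→L[ℝ] ℝ) →ₗ[ℝ] V [⋀^Fin l]→L[ℝ] ℝ where
  toFun := hodgeStar h b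
  map_add' x y := by
    ext v
    change (k.factorial : ℝ)⁻¹ * _ = (k.factorial : ℝ)⁻¹ * _ + (k.factorial : ℝ)⁻¹ * _
    rw [← mul_add, ← Finset.sum_add_distrib]
    simp only [ContinuousAlternatingMap.add_apply, add_mul]
  map_smul' c x := by
    ext v
    change (k.factorial : ℝ)⁻¹ * _ = c * ((k.factorial : ℝ)⁻¹ * _)
    simp only [ContinuousAlternatingMap.smul_apply, smul_eq_mul, mul_assoc, ← Finset.mul_sum]
    exact mul_left_comm _ _ _

theorem hodgeStarₗ_apply (h : k + l = n) (b : Module.Basis (Fin n) ℝ V)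
    (η : V [⋀^Fin k]→L[ℝ] ℝ) : hodgeStarₗ h b η = hodgeStar h b η := rfl

/-! ### Exterior product with a 1-form on the right -/

/-- On decomposable forms the value is a determinant whose last column is `λ(v)`, with only its
bottom entry nonzero; expand along that column. -/
theorem wedge_ofSubsingleton_apply (b : Module.Basis (Fin n) ℝ V) (x : V [⋀^Fin k]→L[ℝ] ℝ)
    (lam : V →L[ℝ] ℝ) (v : Fin (k + 1) → V) (hv : ∀ i : Fin k, lam (v i.castSucc) = 0) :
    wedge x (ContinuousAlternatingMap.ofSubsingleton ℝ V ℝ (0 : Fin 1) lam) v =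
      x (fun i => v i.castSucc) * lam (v (Fin.last k)) := by
  induction x using form_induction b with
  | zero => simp [wedge_zero_left]
  | add x x' h h' =>
    rw [wedge_add_left, ContinuousAlternatingMap.add_apply, h, h',
      ContinuousAlternatingMap.add_apply, add_mul]
  | smul c x h =>
    rw [wedge_smul_left, ContinuousAlternatingMap.smul_apply, h,
      ContinuousAlternatingMap.smul_apply, smul_eq_mul, smul_eq_mul, mul_assoc]
  | decomposable mu =>
    rw [ofSubsingleton_eq_decomp, wedge_decomp, decomp_apply, decomp_apply,
      Matrix.det_succ_column _ (Fin.last k), Fin.sum_univ_castSucc]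
    have h0 : ∀ w, (Fin.append mu ![lam]) (Fin.last k) w = lam w := fun w => by
      rw [show Fin.last k = Fin.natAdd k (0 : Fin 1) from rfl, Fin.append_right]
      rfl
    simp only [Matrix.of_apply, h0, hv]
    rw [Finset.sum_eq_zero (fun i _ => by ring), zero_add, Fin.val_last, Even.neg_one_pow ⟨k, rfl⟩,
      one_mul, mul_comm]
    congr 2
    ext i j
    simp only [Matrix.submatrix_apply, Fin.succAbove_last, Matrix.of_apply]
    exact congrArg (fun f : V →L[ℝ] ℝ => f (v i.castSucc)) (Fin.append_left mu ![lam] j)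

/-! ### Products with a line -/

variable {W : Type*} [AddCommGroup W] [Module ℝ W] [TopologicalSpace W]
  [IsTopologicalAddGroup W] [ContinuousSMul ℝ W] [T2Space W]

/-- The 1-form with the given values. -/
abbrev oneForm (lam : V →L[ℝ] ℝ) : V [⋀^Fin 1]→L[ℝ] ℝ :=
  ContinuousAlternatingMap.ofSubsingleton ℝ V ℝ (0 : Fin 1) lam

/-- Forms on a product with a line determine their components. -/
theorem components_eq_zero (b : Module.Basis (Fin n) ℝ V) (L : V →L[ℝ] W) (lam : V →L[ℝ] ℝ)
    (hbij : Function.Bijective (L.prod lam)) {A : W [⋀^Fin k]→L[ℝ] ℝ}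
    {B : W [⋀^Fin (k + 1)]→L[ℝ] ℝ}
    (h : wedge (A.compContinuousLinearMap L) (oneForm lam) + B.compContinuousLinearMap L = 0) :
    A = 0 ∧ B = 0 := by
  -- `s w` is the lift of `w` to the kernel of `λ`, and `e` is the vertical vector with `λ e = 1`.
  -- Evaluating on lifts followed by `e` isolates `A`, and on lifts alone isolates `B`.
  choose s hs using fun w : W => hbij.2 (w, 0)
  obtain ⟨e, he⟩ := hbij.2 (0, 1)
  have hs1 : ∀ w, L (s w) = w := fun w => congrArg Prod.fst (hs w)
  have hs2 : ∀ w, lam (s w) = 0 := fun w => congrArg Prod.snd (hs w)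
  have he1 : L e = 0 := congrArg Prod.fst he
  have he2 : lam e = 1 := congrArg Prod.snd he
  have hv : ∀ v : Fin (k + 1) → V, (∀ i : Fin k, lam (v i.castSucc) = 0) →
      (A fun i => L (v i.castSucc)) * lam (v (Fin.last k)) + (B fun i => L (v i)) = 0 :=
    fun v hv => by
      have h1 := congrArg (fun η => η v) h
      simp only [ContinuousAlternatingMap.add_apply, wedge_ofSubsingleton_apply b _ _ _ hv,
        ContinuousAlternatingMap.compContinuousLinearMap_apply] at h1
      exact h1
  constructor
  · ext w
    have h1 := hv (Fin.snoc (fun i => s (w i)) e) fun i => by simp [hs2]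
    have h2 : (B fun i => L ((Fin.snoc (fun i => s (w i)) e : Fin (k + 1) → V) i)) = 0 :=
      B.map_coord_zero (Fin.last k) (by simp [he1])
    rw [h2] at h1
    simpa [hs1, he2] using h1
  · ext w
    have h1 := hv (fun i => s (w i)) fun i => hs2 _
    simpa [hs1, hs2] using h1

/-- The frame of a product with a line given by a frame of the base and a coordinate `f • λ` on
the line. -/
def prodFrame (b : Module.Basis (Fin 6) ℝ W) (L : V →L[ℝ] W) (lam : V →L[ℝ] ℝ)
    (hbij : Function.Bijective (L.prod lam)) {f : ℝ} (hf : f ≠ 0) : Module.Basis (Fin 7) ℝ V :=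
  Module.Basis.ofEquivFun <| LinearEquiv.ofBijective
    ({ toFun := fun v => Fin.snoc (fun i => b.repr (L v) i) (f * lam v)
       map_add' := fun x y => by
        ext i
        refine Fin.lastCases ?_ (fun i => ?_) i <;> simp [-Fin.reduceLast, mul_add]
       map_smul' := fun c x => by
        ext i
        refine Fin.lastCases ?_ (fun i => ?_) i <;> simp [-Fin.reduceLast, mul_left_comm] } : V →ₗ[ℝ] Fin 7 → ℝ) <| by
    constructor
    · intro x y hxy
      have h1 : ∀ i : Fin 6, b.repr (L x) i = b.repr (L y) i := fun i => by
        simpa using congrFun hxy (Fin.castSucc i)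
      have h2 : f * lam x = f * lam y := by
        simpa [-Fin.reduceLast, hf] using congrFun hxy (Fin.last 6)
      exact hbij.1 (Prod.ext (b.repr.injective (Finsupp.ext h1)) (mul_left_cancel₀ hf h2))
    · intro z
      obtain ⟨v, hv⟩ := hbij.2 (b.equivFun.symm fun i => z (Fin.castSucc i), f⁻¹ * z (Fin.last 6))
      have h1 : L v = _ := congrArg Prod.fst hv
      have h2 : lam v = _ := congrArg Prod.snd hv
      refine ⟨v, ?_⟩
      ext i
      refine Fin.lastCases ?_ (fun i => ?_) i
      · simp [-Fin.reduceLast, h2, hf]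
      · simp only [LinearMap.coe_mk, AddHom.coe_mk, Fin.snoc_castSucc, h1,
          ← Module.Basis.equivFun_apply, LinearEquiv.apply_symm_apply]

section ProdFrame

variable (b : Module.Basis (Fin 6) ℝ W) (L : V →L[ℝ] W) (lam : V →L[ℝ] ℝ)
    (hbij : Function.Bijective (L.prod lam)) {f : ℝ} (hf : f ≠ 0)

theorem prodFrame_repr_castSucc (v : V) (i : Fin 6) :
    (prodFrame b L lam hbij hf).repr v i.castSucc = b.repr (L v) i :=
  Fin.snoc_castSucc (α := fun _ => ℝ) (f * lam v) (fun i => b.repr (L v) i) i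

theorem prodFrame_repr_last (v : V) :
    (prodFrame b L lam hbij hf).repr v (Fin.last 6) = f * lam v :=
  Fin.snoc_last (α := fun _ => ℝ) (f * lam v) (fun i => b.repr (L v) i)

theorem map_prodFrame_castSucc (i : Fin 6) : L (prodFrame b L lam hbij hf i.castSucc) = b i := by
  refine b.repr.injective (Finsupp.ext fun j => ?_)
  rw [← prodFrame_repr_castSucc b L lam hbij hf, Module.Basis.repr_self, Module.Basis.repr_self]
  simp [-Fin.reduceLast, Finsupp.single_apply]

theorem map_prodFrame_last : L (prodFrame b L lam hbij hf (Fin.last 6)) = 0 := by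
  refine b.repr.injective (Finsupp.ext fun j => ?_)
  rw [← prodFrame_repr_castSucc b L lam hbij hf, Module.Basis.repr_self]
  simp [-Fin.reduceLast]

theorem coord_prodFrame_castSucc (i : Fin 6) :
    lam (prodFrame b L lam hbij hf i.castSucc) = 0 := by
  refine mul_left_cancel₀ hf ?_
  rw [← prodFrame_repr_last b L lam hbij hf, Module.Basis.repr_self]
  simp [-Fin.reduceLast, (Fin.castSucc_lt_last i).ne]

theorem coord_prodFrame_last : lam (prodFrame b L lam hbij hf (Fin.last 6)) = f⁻¹ := by
  refine mul_left_cancel₀ hf ?_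
  rw [← prodFrame_repr_last b L lam hbij hf, Module.Basis.repr_self]
  simp [-Fin.reduceLast, hf]

theorem eForm_comp_prodFrame (I : Fin k → Fin 6) :
    (eForm b I).compContinuousLinearMap L =
      eForm (prodFrame b L lam hbij hf) fun i => (I i).castSucc := by
  ext v
  rw [ContinuousAlternatingMap.compContinuousLinearMap_apply, eForm_apply, eForm_apply]
  simp only [prodFrame_repr_castSucc]
  rfl

theorem oneForm_prodFrame :
    f • oneForm lam = eForm (prodFrame b L lam hbij hf) ![Fin.last 6] := by
  ext v
  simp [-Fin.reduceLast, eForm_apply, prodFrame_repr_last]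

end ProdFrame

end SevenDim

/-! ### The Hodge star on a product of a six-dimensional space with a line -/

section ProductStar

variable {V : Type*} [AddCommGroup V] [Module ℝ V] [TopologicalSpace V]
  [IsTopologicalAddGroup V] [ContinuousSMul ℝ V] [T2Space V] {k l m n : ℕ}
  {W : Type*} [AddCommGroup W] [Module ℝ W] [TopologicalSpace W]
  [IsTopologicalAddGroup W] [ContinuousSMul ℝ W] [T2Space W]

theorem add_comp (x y : W [⋀^Fin k]→L[ℝ] ℝ) (L : V →L[ℝ] W) :
    (x + y).compContinuousLinearMap L =
      x.compContinuousLinearMap L + y.compContinuousLinearMap L := rfl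

theorem sub_comp (x y : W [⋀^Fin k]→L[ℝ] ℝ) (L : V →L[ℝ] W) :
    (x - y).compContinuousLinearMap L =
      x.compContinuousLinearMap L - y.compContinuousLinearMap L := rfl

theorem neg_comp (x : W [⋀^Fin k]→L[ℝ] ℝ) (L : V →L[ℝ] W) :
    (-x).compContinuousLinearMap L = -x.compContinuousLinearMap L := rfl

theorem smul_comp (c : ℝ) (x : W [⋀^Fin k]→L[ℝ] ℝ) (L : V →L[ℝ] W) :
    (c • x).compContinuousLinearMap L = c • x.compContinuousLinearMap L := rfl

variable {ω : W [⋀^Fin 2]→L[ℝ] ℝ} {ρ ρ' : W [⋀^Fin 3]→L[ℝ] ℝ} {b : Module.Basis (Fin 6) ℝ W}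
  {L : V →L[ℝ] W} {lam : V →L[ℝ] ℝ}

theorem castSucc_two (i j : Fin 6) :
    (fun a => (![i, j] a).castSucc) = ![i.castSucc, j.castSucc] := by
  ext a
  fin_cases a <;> rfl

theorem castSucc_three (i j p : Fin 6) :
    (fun a => (![i, j, p] a).castSucc) = ![i.castSucc, j.castSucc, p.castSucc] := by
  ext a
  fin_cases a <;> rfl

theorem castSucc_four (i j p q : Fin 6) :
    (fun a => (![i, j, p, q] a).castSucc) =
      ![i.castSucc, j.castSucc, p.castSucc, q.castSucc] := by
  ext a
  fin_cases a <;> rfl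

theorem append_two_one {α : Type*} (f : Fin 2 → α) (g : Fin 1 → α) :
    Fin.append f g = ![f 0, f 1, g 0] := by
  ext i
  fin_cases i <;> rfl

theorem append_three_one {α : Type*} (f : Fin 3 → α) (g : Fin 1 → α) :
    Fin.append f g = ![f 0, f 1, f 2, g 0] := by
  ext i
  fin_cases i <;> rfl

/-- The factor `f` is absorbed into the seventh covector `e⁷ = f λ`, after which the two expressions
agree term by term. -/
theorem IsSU3Frame.isG2Frame (hb : IsSU3Frame ω ρ ρ' b) (hbij : Function.Bijective (L.prod lam))
    {f : ℝ} (hf : f ≠ 0) :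
    IsG2Frame (f • (wedge (ω.compContinuousLinearMap L) (oneForm lam) : V [⋀^Fin 3]→L[ℝ] ℝ)
      + ρ.compContinuousLinearMap L) (prodFrame b L lam hbij hf) := by
  rw [IsG2Frame, hb.1, hb.2.1, ← wedge_smul_right, oneForm_prodFrame b L lam hbij hf]
  simp only [add_comp, sub_comp, e2_eq, e3_eq, eForm_comp_prodFrame b L lam hbij hf,
    castSucc_two, castSucc_three, wedge_add_left, wedge_eForm, append_two_one, Matrix.cons_val]
  simp only [add_assoc, sub_eq_add_neg]
  rfl

/-- The terms `e^{ij7}` of `ω ∧ e⁷` go to the terms of `½ω²`, and the terms of `ρ` go to those of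
`ρ' ∧ e⁷`. -/
theorem IsSU3Frame.hodgeStar_three (hb : IsSU3Frame ω ρ ρ' b)
    (hbij : Function.Bijective (L.prod lam)) {f : ℝ} (hf : f ≠ 0) :
    hodgeStar (rfl : 3 + 4 = 7) (prodFrame b L lam hbij hf)
      (f • (wedge (ω.compContinuousLinearMap L) (oneForm lam) : V [⋀^Fin 3]→L[ℝ] ℝ)
        + ρ.compContinuousLinearMap L) =
      (1 / 2 : ℝ) • (wedge ω ω).compContinuousLinearMap L
        + f • (wedge (ρ'.compContinuousLinearMap L) (oneForm lam) : V [⋀^Fin 4]→L[ℝ] ℝ) := by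
  have key : ∀ (I : Fin 3 → Fin 7) (J : Fin 4 → Fin 7) (s : ℤ),
      seqSign (Fin.append I J ∘ Fin.cast (rfl : 7 = 3 + 4)) = s → s ≠ 0 →
        hodgeStarₗ (rfl : 3 + 4 = 7) (prodFrame b L lam hbij hf)
          (eForm (prodFrame b L lam hbij hf) I) = (s : ℝ) • eForm (prodFrame b L lam hbij hf) J :=
    fun I J s hs h0 =>
      hodgeStar_eForm (k := 3) (l := 4) (n := 7) rfl (prodFrame b L lam hbij hf) I J hs h0
  have h1 : (wedge ω ω).compContinuousLinearMap L = (2 : ℝ) • (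
      eForm (prodFrame b L lam hbij hf) ![0, 1, 2, 3]
      + eForm (prodFrame b L lam hbij hf) ![0, 1, 4, 5]
      + eForm (prodFrame b L lam hbij hf) ![2, 3, 4, 5]) := by
    refine (congrArg (fun η => η.compContinuousLinearMap L) (wedge_ω_ω hb)).trans ?_
    simp only [smul_comp, add_comp, eForm_comp_prodFrame b L lam hbij hf, castSucc_four]
    rfl
  have h2 : f • (wedge (ρ'.compContinuousLinearMap L) (oneForm lam) : V [⋀^Fin 4]→L[ℝ] ℝ) =
      -eForm (prodFrame b L lam hbij hf) ![1, 3, 5, 6]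
      + eForm (prodFrame b L lam hbij hf) ![1, 2, 4, 6]
      + eForm (prodFrame b L lam hbij hf) ![0, 3, 4, 6]
      + eForm (prodFrame b L lam hbij hf) ![0, 2, 5, 6] := by
    rw [← wedge_smul_right, oneForm_prodFrame b L lam hbij hf, hb.2.2]
    simp only [add_comp, neg_comp, e3_eq, eForm_comp_prodFrame b L lam hbij hf,
      castSucc_three, wedge_add_left, wedge_neg_left, wedge_eForm, append_three_one,
      Matrix.cons_val]
    rfl
  rw [h2, h1, hb.isG2Frame hbij hf, ← hodgeStarₗ_apply]
  simp only [e3_eq, map_add, map_sub]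
  simp only [key ![0, 1, 6] ![2, 3, 4, 5] 1 (by decide +kernel) (by decide),
    key ![2, 3, 6] ![0, 1, 4, 5] 1 (by decide +kernel) (by decide),
    key ![4, 5, 6] ![0, 1, 2, 3] 1 (by decide +kernel) (by decide),
    key ![0, 2, 4] ![1, 3, 5, 6] (-1) (by decide +kernel) (by decide),
    key ![0, 3, 5] ![1, 2, 4, 6] (-1) (by decide +kernel) (by decide),
    key ![1, 2, 5] ![0, 3, 4, 6] (-1) (by decide +kernel) (by decide),
    key ![1, 3, 4] ![0, 2, 5, 6] (-1) (by decide +kernel) (by decide)]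
  push_cast
  module

/-- This is `⋆₆(τ ∧ ω) = -τ`, valid for primitive forms of type (1,1). The factor `f⁻¹` appears
because the unit covector is `f λ`, not `λ`. Stating `θ` and `ζ` through equations keeps them opaque
during the component computations. -/
theorem IsSU3Frame.hodgeStar_five (hb : IsSU3Frame ω ρ ρ' b)
    (hbij : Function.Bijective (L.prod lam)) {f : ℝ} (hf : f ≠ 0) {τ : W [⋀^Fin 2]→L[ℝ] ℝ}
    (hτ : IsPrimitive11 b τ) {θ : W [⋀^Fin 4]→L[ℝ] ℝ} (hθ : θ = wedge τ ω)
    {ζ : V [⋀^Fin 5]→L[ℝ] ℝ} (hζ : ζ = wedge (θ.compContinuousLinearMap L) (oneForm lam)) :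
    hodgeStar (rfl : 5 + 2 = 7) (prodFrame b L lam hbij hf) ζ =
      -(f⁻¹ • τ.compContinuousLinearMap L) := by
  set e := prodFrame b L lam hbij hf with he
  have hL : ∀ i : Fin 6, L (e i.castSucc) = b i := map_prodFrame_castSucc b L lam hbij hf
  have hl : ∀ i : Fin 6, lam (e i.castSucc) = 0 := coord_prodFrame_castSucc b L lam hbij hf
  have hL6 : L (e (Fin.last 6)) = 0 := map_prodFrame_last b L lam hbij hf
  have hl6 : lam (e (Fin.last 6)) = f⁻¹ := coord_prodFrame_last b L lam hbij hf
  have hθ' : ∀ i j k l : Fin 6, θ ![b i, b j, b k, b l] = _ := fun i j k l =>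
    (congrArg (fun η => η ![b i, b j, b k, b l]) hθ).trans
      (wedge_two_two_apply b τ ω (b i) (b j) (b k) (b l))
  have hζ1 : ∀ (p q r t : Fin 6) (u : Fin 7),
      (ζ fun a => e (![p.castSucc, q.castSucc, r.castSucc, t.castSucc, u] a)) =
        θ ![b p, b q, b r, b t] * lam (e u) := fun p q r t u => by
    rw [hζ, wedge_ofSubsingleton_apply e]
    · congr 1
      rw [ContinuousAlternatingMap.compContinuousLinearMap_apply]
      congr 1
      ext i
      fin_cases i <;> exact hL _
    · intro i
      fin_cases i <;> exact hl _
  have key : ∀ (p q r t : Fin 6) (u i j : Fin 7) (s : ℤ),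
      seqSign (Fin.append ![p.castSucc, q.castSucc, r.castSucc, t.castSucc, u] ![i, j]
        ∘ Fin.cast (rfl : 7 = 5 + 2)) = s → s ≠ 0 →
        hodgeStar (rfl : 5 + 2 = 7) e ζ ![e i, e j] =
          s * (θ ![b p, b q, b r, b t] * lam (e u)) := fun p q r t u i j s hs h0 => by
    rw [← hζ1]
    refine Eq.trans ?_ (hodgeStar_apply_basis (k := 5) (l := 2) (n := 7) rfl e ζ _ _ hs h0)
    congr 1
    ext a
    fin_cases a <;> rfl
  obtain ⟨r1, r2, r3, r4, r5, r6, r7⟩ := hτ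
  -- Components along the base: the complement consists of four base indices and the last one, and
  -- the claim reduces to a relation between components of `τ ∧ ω` and of `τ`.
  have base : ∀ (p q r t i j : Fin 6) (s : ℤ),
      seqSign (Fin.append ![p.castSucc, q.castSucc, r.castSucc, t.castSucc, Fin.last 6]
        ![i.castSucc, j.castSucc] ∘ Fin.cast (rfl : 7 = 5 + 2)) = s → s ≠ 0 →
        s * θ ![b p, b q, b r, b t] = -τ ![b i, b j] →
        hodgeStar (rfl : 5 + 2 = 7) e ζ ![e i.castSucc, e j.castSucc] =
          (-(f⁻¹ • τ.compContinuousLinearMap L)) ![e i.castSucc, e j.castSucc] :=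
    fun p q r t i j s hs h0 h => by
      have hr : (-(f⁻¹ • τ.compContinuousLinearMap L)) ![e i.castSucc, e j.castSucc] =
          -(f⁻¹ * τ ![b i, b j]) := by
        rw [← hL, ← hL]
        change -(f⁻¹ * τ _) = _
        congr 3
        ext a
        fin_cases a <;> rfl
      rw [key p q r t _ _ _ s hs h0, hr, hl6]
      linear_combination f⁻¹ * h
  -- Components involving the line: the complementary indices all come from the base, where `λ`
  -- vanishes, and `τ` pulled back kills the vertical vector.
  have last : ∀ (p q r t u i : Fin 6) (s : ℤ),
      seqSign (Fin.append ![p.castSucc, q.castSucc, r.castSucc, t.castSucc, u.castSucc]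
        ![i.castSucc, Fin.last 6] ∘ Fin.cast (rfl : 7 = 5 + 2)) = s → s ≠ 0 →
        hodgeStar (rfl : 5 + 2 = 7) e ζ ![e i.castSucc, e (Fin.last 6)] =
          (-(f⁻¹ • τ.compContinuousLinearMap L)) ![e i.castSucc, e (Fin.last 6)] :=
    fun p q r t u i s hs h0 => by
      rw [key p q r t _ _ _ s hs h0, hl, mul_zero, mul_zero]
      change 0 = -(f⁻¹ * τ _)
      rw [τ.map_coord_zero (1 : Fin 2) hL6, mul_zero, neg_zero]
  refine two_form_ext e fun i j hij => ?_
  induction j using Fin.lastCases with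
  | last =>
    induction i using Fin.lastCases with
    | last => exact absurd hij (lt_irrefl _)
    | cast i =>
      fin_cases i
      · exact last 1 2 3 4 5 0 (-1) (by decide +kernel) (by decide)
      · exact last 0 2 3 4 5 1 1 (by decide +kernel) (by decide)
      · exact last 0 1 3 4 5 2 (-1) (by decide +kernel) (by decide)
      · exact last 0 1 2 4 5 3 1 (by decide +kernel) (by decide)
      · exact last 0 1 2 3 5 4 (-1) (by decide +kernel) (by decide)
      · exact last 0 1 2 3 4 5 1 (by decide +kernel) (by decide)
  | cast j =>
    induction i using Fin.lastCases with
    | last => exact absurd hij (Fin.castSucc_lt_last j).not_gt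
    | cast i =>
      rw [Fin.castSucc_lt_castSucc_iff] at hij
      have hω : ∀ i j : Fin 6, ω ![b i, b j] = _ := fun i j => hb.ω_apply (b i) (b j)
      fin_cases i <;> fin_cases j <;> first
        | exact absurd hij (by decide)
        | skip
      · refine base 2 3 4 5 0 1 1 (by decide +kernel) (by decide) ?_
        simp [hθ', hω]
        linarith
      · refine base 1 3 4 5 0 2 (-1) (by decide +kernel) (by decide) ?_
        simp [hθ', hω]
        linarith
      · refine base 1 2 4 5 0 3 1 (by decide +kernel) (by decide) ?_
        simp [hθ', hω]
        linarith
      · refine base 1 2 3 5 0 4 (-1) (by decide +kernel) (by decide) ?_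
        simp [hθ', hω]
        linarith
      · refine base 1 2 3 4 0 5 1 (by decide +kernel) (by decide) ?_
        simp [hθ', hω]
        linarith
      · refine base 0 3 4 5 1 2 1 (by decide +kernel) (by decide) ?_
        simp [hθ', hω]
        linarith
      · refine base 0 2 4 5 1 3 (-1) (by decide +kernel) (by decide) ?_
        simp [hθ', hω]
        linarith
      · refine base 0 2 3 5 1 4 1 (by decide +kernel) (by decide) ?_
        simp [hθ', hω]
        linarith
      · refine base 0 2 3 4 1 5 (-1) (by decide +kernel) (by decide) ?_
        simp [hθ', hω]
        linarith
      · refine base 0 1 4 5 2 3 1 (by decide +kernel) (by decide) ?_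
        simp [hθ', hω]
        linarith
      · refine base 0 1 3 5 2 4 (-1) (by decide +kernel) (by decide) ?_
        simp [hθ', hω]
        linarith
      · refine base 0 1 3 4 2 5 1 (by decide +kernel) (by decide) ?_
        simp [hθ', hω]
        linarith
      · refine base 0 1 2 5 3 4 1 (by decide +kernel) (by decide) ?_
        simp [hθ', hω]
        linarith
      · refine base 0 1 2 4 3 5 (-1) (by decide +kernel) (by decide) ?_
        simp [hθ', hω]
        linarith
      · refine base 0 1 2 3 4 5 1 (by decide +kernel) (by decide) ?_
        simp [hθ', hω]
        linarith

end ProductStar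

/-! ### The exterior derivative and the exterior product -/

section Calculus

variable {E : Type*} [NormedAddCommGroup E] [NormedSpace ℝ E] {k l n : ℕ}

/-- A crude bound, one summand `‖a‖ ‖b‖ ∏ ‖vᵢ‖` for each shuffle. It is needed only to make the
exterior product a continuous bilinear map, so that it can be differentiated. -/
theorem abs_wedge_apply_le (a : E [⋀^Fin k]→L[ℝ] ℝ) (b : E [⋀^Fin l]→L[ℝ] ℝ)
    (v : Fin (k + l) → E) :
    ‖wedge a b v‖ ≤ Fintype.card (Equiv.Perm.ModSumCongr (Fin k) (Fin l)) * ‖a‖ * ‖b‖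
      * ∏ i, ‖v i‖ := by
  rw [wedge_apply, AlternatingMap.domCoprod_apply, sum_apply, map_sum]
  refine (norm_sum_le _ _).trans ?_
  refine (Finset.sum_le_card_nsmul _ _ (‖a‖ * ‖b‖ * ∏ i, ‖v i‖) fun σ _ => ?_).trans ?_
  · induction σ using Quotient.inductionOn' with
    | h σ =>
      simp only [AlternatingMap.domCoprod.summand_mk'', smul_apply,
        MultilinearMap.domDomCongr_apply, MultilinearMap.domCoprod_apply, map_zsmul_unit,
        LinearMap.mul'_apply]
      rw [Units.smul_def, ← Int.cast_smul_eq_zsmul ℝ, norm_smul]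
      rw [show ‖((Equiv.Perm.sign σ : ℤ) : ℝ)‖ = 1 by
        rcases Int.units_eq_one_or (Equiv.Perm.sign σ) with h | h <;> simp [h], one_mul, norm_mul]
      have h := ((finSumFinEquiv.symm.trans σ.symm).trans finSumFinEquiv).symm.prod_comp
        fun i => ‖v i‖
      rw [← h, ← finSumFinEquiv.prod_comp, Fintype.prod_sum_type]
      calc _ ≤ (‖a‖ * ∏ i, ‖v (finSumFinEquiv (σ (Sum.inl i)))‖)
            * (‖b‖ * ∏ i, ‖v (finSumFinEquiv (σ (Sum.inr i)))‖) :=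
            mul_le_mul (a.le_opNorm _) (b.le_opNorm _) (norm_nonneg _) (by positivity)
        _ = _ := by simp; ring
  · rw [nsmul_eq_mul, Finset.card_univ]
    exact le_of_eq (by ring)

/-- The exterior product as a continuous bilinear map. -/
def wedgeL (k l : ℕ) :
    (E [⋀^Fin k]→L[ℝ] ℝ) →L[ℝ] (E [⋀^Fin l]→L[ℝ] ℝ) →L[ℝ] E [⋀^Fin (k + l)]→L[ℝ] ℝ :=
  (wedgeₗ k l).mkContinuous₂ (Fintype.card (Equiv.Perm.ModSumCongr (Fin k) (Fin l)))
    fun a b => ContinuousAlternatingMap.opNorm_le_bound _ (by positivity) (abs_wedge_apply_le a b)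

theorem wedgeL_apply (a : E [⋀^Fin k]→L[ℝ] ℝ) (b : E [⋀^Fin l]→L[ℝ] ℝ) :
    wedgeL k l a b = wedge a b := rfl

open ContinuousAlternatingMap (alternatizeUncurryFin alternatizeUncurryFin_apply
  alternatizeUncurryFin_add alternatizeUncurryFin_smul)

theorem alternatizeUncurryFin_zero :
    alternatizeUncurryFin (0 : E →L[ℝ] E [⋀^Fin k]→L[ℝ] ℝ) = 0 := by
  ext v
  simp [alternatizeUncurryFin_apply]

/-- Cofactor expansion of the determinant along its first column. -/
theorem alternatizeUncurryFin_smulRight_decomp (lam : E →L[ℝ] ℝ) (mu : Fin k → E →L[ℝ] ℝ) :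
    alternatizeUncurryFin (lam.smulRight (decomp mu)) = decomp (Fin.cons lam mu) := by
  ext v
  rw [alternatizeUncurryFin_apply, decomp_apply, Matrix.det_succ_column_zero]
  refine Finset.sum_congr rfl fun i _ => ?_
  rw [ContinuousLinearMap.smulRight_apply, ContinuousAlternatingMap.smul_apply, decomp_apply,
    ← Int.cast_smul_eq_zsmul ℝ]
  simp only [smul_eq_mul, Matrix.of_apply, Fin.cons_zero, mul_assoc]
  push_cast
  rfl

theorem eq_sum_smulRight {X : Type*} [NormedAddCommGroup X] [NormedSpace ℝ X]
    (b : Module.Basis (Fin n) ℝ E) (A : E →L[ℝ] X) :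
    A = ∑ i, (coframe b i).smulRight (A (b i)) := by
  ext v
  conv_lhs => rw [← b.sum_repr v, _root_.map_sum]
  rw [_root_.sum_apply]
  exact Finset.sum_congr rfl fun i _ => map_smul _ _ _

/-- Linear statements about form-valued linear maps need only be checked on tensor products of
functionals and decomposable forms. -/
theorem linearMap_form_induction (b : Module.Basis (Fin n) ℝ E)
    {P : (E →L[ℝ] E [⋀^Fin k]→L[ℝ] ℝ) → Prop} (zero : P 0)
    (add : ∀ A A', P A → P A' → P (A + A')) (smul : ∀ (c : ℝ) A, P A → P (c • A))
    (decomposable : ∀ (lam : E →L[ℝ] ℝ) mu, P (lam.smulRight (decomp mu)))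
    (A : E →L[ℝ] E [⋀^Fin k]→L[ℝ] ℝ) : P A := by
  rw [eq_sum_smulRight b A]
  refine Finset.sum_induction _ P add zero fun i _ => ?_
  generalize A (b i) = a
  induction a using form_induction b with
  | zero =>
    convert! zero
    ext; simp
  | add a a' h h' =>
    convert! add _ _ h h'
    ext; simp
  | smul c a h =>
    convert! smul c _ h
    ext; simp; ring
  | decomposable mu => exact decomposable _ mu

/-- The algebraic half of the Leibniz rule. On `λ ⊗ μ` and `ν` decomposable, both sides are `λ ∧ μ ∧
ν`; the cast only identifies `k + l + 1` with `k + 1 + l`. -/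
theorem alternatizeUncurryFin_wedge_left (b : Module.Basis (Fin n) ℝ E)
    (A : E →L[ℝ] E [⋀^Fin k]→L[ℝ] ℝ) (η : E [⋀^Fin l]→L[ℝ] ℝ) (v : Fin (k + l + 1) → E) :
    alternatizeUncurryFin (((wedgeL k l).flip η).comp A) v =
      wedge (alternatizeUncurryFin A) η (v ∘ Fin.cast (Nat.succ_add k l)) := by
  induction A using linearMap_form_induction b with
  | zero =>
    rw [ContinuousLinearMap.comp_zero, alternatizeUncurryFin_zero, alternatizeUncurryFin_zero,
      wedge_zero_left]
    rfl
  | add A A' h h' =>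
    rw [ContinuousLinearMap.comp_add, alternatizeUncurryFin_add, alternatizeUncurryFin_add,
      wedge_add_left, ContinuousAlternatingMap.add_apply,
      ContinuousAlternatingMap.add_apply, h, h']
  | smul c A h =>
    rw [ContinuousLinearMap.comp_smul, alternatizeUncurryFin_smul, alternatizeUncurryFin_smul,
      wedge_smul_left, ContinuousAlternatingMap.smul_apply,
      ContinuousAlternatingMap.smul_apply, h]
  | decomposable lam mu =>
    induction η using form_induction b with
    | zero => simp [alternatizeUncurryFin_apply, wedge_zero_right]
    | add η η' h h' =>
      rw [map_add, ContinuousLinearMap.add_comp, alternatizeUncurryFin_add,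
        wedge_add_right, ContinuousAlternatingMap.add_apply,
      ContinuousAlternatingMap.add_apply, h, h']
    | smul c η h =>
      rw [map_smul, ContinuousLinearMap.smul_comp, alternatizeUncurryFin_smul,
        wedge_smul_right, ContinuousAlternatingMap.smul_apply,
      ContinuousAlternatingMap.smul_apply, h]
    | decomposable nu =>
      have h : ((wedgeL k l).flip (decomp nu)).comp (lam.smulRight (decomp mu))
          = lam.smulRight (decomp (Fin.append mu nu)) := by
        rw [← wedge_decomp]
        ext u w
        simp [wedgeL_apply]
      rw [h, alternatizeUncurryFin_smulRight_decomp, alternatizeUncurryFin_smulRight_decomp,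
        wedge_decomp, Fin.append_cons, decomp_apply, decomp_apply]
      exact (Matrix.det_submatrix_equiv_self (finCongr (Nat.succ_add k l))
        (Matrix.of fun a c => (Fin.cons lam (Fin.append mu nu) : Fin (k + l + 1) → E →L[ℝ] ℝ) c
          (v a))).symm

theorem alternatizeUncurryFin_wedge_left_eq_zero (b : Module.Basis (Fin n) ℝ E)
    {A : E →L[ℝ] E [⋀^Fin k]→L[ℝ] ℝ} (hA : alternatizeUncurryFin A = 0)
    (η : E [⋀^Fin l]→L[ℝ] ℝ) :
    alternatizeUncurryFin (((wedgeL k l).flip η).comp A) = 0 := by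
  ext v
  rw [alternatizeUncurryFin_wedge_left b, hA, wedge_zero_left]
  rfl

/-- The functional `λ` occurs twice, first and last, so the determinant has two equal columns. -/
theorem alternatizeUncurryFin_wedge_right (b : Module.Basis (Fin n) ℝ E)
    (a : E [⋀^Fin k]→L[ℝ] ℝ) (lam : E →L[ℝ] ℝ) :
    alternatizeUncurryFin ((wedgeL k 1 a).comp (lam.smulRight (oneForm lam))) = 0 := by
  induction a using form_induction b with
  | zero =>  simpa using alternatizeUncurryFin_zero
  | add η η' h h' =>
    rw [map_add, ContinuousLinearMap.add_comp, alternatizeUncurryFin_add, h, h', add_zero]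
  | smul c η h =>
    rw [map_smul, ContinuousLinearMap.smul_comp, alternatizeUncurryFin_smul, h, smul_zero]
  | decomposable mu =>
    have h : (wedgeL k 1 (decomp mu)).comp (lam.smulRight (oneForm lam))
        = lam.smulRight (decomp (Fin.append mu ![lam])) := by
      rw [← wedge_decomp, ← ofSubsingleton_eq_decomp]
      ext u w
      simp [wedgeL_apply]
    rw [h, alternatizeUncurryFin_smulRight_decomp]
    ext v
    rw [decomp_apply]
    refine Matrix.det_zero_of_column_eq (i := 0) (j := Fin.last _) (Fin.last_pos.ne) fun i => ?_
    simp only [Matrix.of_apply, Fin.cons_zero]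
    rw [← Fin.succ_last, Fin.cons_succ]
    exact congrArg (fun μ : E →L[ℝ] ℝ => μ (v i)) (Fin.append_right mu ![lam] 0).symm

theorem hasFDerivAt_wedge {a : E → E [⋀^Fin k]→L[ℝ] ℝ} {η : E → E [⋀^Fin l]→L[ℝ] ℝ} {x : E}
    {a' : E →L[ℝ] E [⋀^Fin k]→L[ℝ] ℝ} {η' : E →L[ℝ] E [⋀^Fin l]→L[ℝ] ℝ}
    (ha : HasFDerivAt a a' x) (hη : HasFDerivAt η η' x) :
    HasFDerivAt (fun y => wedge (a y) (η y))
      (((wedgeL k l).flip (η x)).comp a' + (wedgeL k l (a x)).comp η') x := by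
  have h := (wedgeL k l).hasFDerivAt_of_bilinear ha hη
  exact h.congr_fderiv (add_comm _ _)

theorem contDiffOn_wedge {a : E → E [⋀^Fin k]→L[ℝ] ℝ} {η : E → E [⋀^Fin l]→L[ℝ] ℝ} {s : Set E}
    {r : WithTop ℕ∞} (ha : ContDiffOn ℝ r a s) (hη : ContDiffOn ℝ r η s) :
    ContDiffOn ℝ r (fun y => wedge (a y) (η y)) s :=
  (wedgeL k l).isBoundedBilinearMap.contDiff.comp₂_contDiffOn ha hη

/-- `d(a ∧ η) = da ∧ η` if `η` is a 1-form whose derivative is a multiple of `λ ⊗ λ`. -/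
theorem extDeriv_wedge_one (b : Module.Basis (Fin n) ℝ E)
    {a : E → E [⋀^Fin k]→L[ℝ] ℝ} {η : E → E [⋀^Fin 1]→L[ℝ] ℝ} {x : E}
    (ha : DifferentiableAt ℝ a x) {lam : E →L[ℝ] ℝ} {c : ℝ}
    (hη : HasFDerivAt η (c • lam.smulRight (oneForm lam)) x) :
    extDeriv (fun y => wedge (a y) (η y)) x = wedge (extDeriv a x) (η x) := by
  rw [extDeriv, (hasFDerivAt_wedge ha.hasFDerivAt hη).fderiv, alternatizeUncurryFin_add,
    ContinuousLinearMap.comp_smul, alternatizeUncurryFin_smul,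
    alternatizeUncurryFin_wedge_right b, smul_zero, add_zero]
  ext v
  exact alternatizeUncurryFin_wedge_left b _ _ v

theorem wedge_two_two_comm (b : Module.Basis (Fin n) ℝ E) (x y : E [⋀^Fin 2]→L[ℝ] ℝ) :
    wedge x y = wedge y x := by
  ext v
  have hv : v = ![v 0, v 1, v 2, v 3] := by
    ext i; fin_cases i <;> rfl
  rw [hv]
  refine (wedge_two_two_apply b x y _ _ _ _).trans
    (Eq.trans ?_ (wedge_two_two_apply b y x _ _ _ _).symm)
  ring

/-- By commutativity of 2-forms, both terms of the product rule have the form `da ∧ a`. -/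
theorem extDeriv_wedge_self (b : Module.Basis (Fin n) ℝ E)
    {a : E → E [⋀^Fin 2]→L[ℝ] ℝ} {x : E} (ha : DifferentiableAt ℝ a x) (h : extDeriv a x = 0) :
    extDeriv (fun y => wedge (a y) (a y)) x = 0 := by
  have h2 : (wedgeL 2 2 (a x)).comp (fderiv ℝ a x)
      = ((wedgeL 2 2).flip (a x)).comp (fderiv ℝ a x) := by
    ext1 u
    exact wedge_two_two_comm b _ _
  rw [extDeriv, (hasFDerivAt_wedge ha.hasFDerivAt ha.hasFDerivAt).fderiv, h2]
  have h3 := alternatizeUncurryFin_wedge_left_eq_zero b h (a x)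
  exact (alternatizeUncurryFin_add _ _).trans (by rw [h3, add_zero])

end Calculus

/-! ### Exterior calculus on manifolds -/

section Manifold

variable {E : Type*} [NormedAddCommGroup E] [NormedSpace ℝ E]
  {H : Type*} [TopologicalSpace H] {I : ModelWithCorners ℝ E H}
  {E' : Type*} [NormedAddCommGroup E'] [NormedSpace ℝ E']
  {H' : Type*} [TopologicalSpace H'] {I' : ModelWithCorners ℝ E' H'}
  {M : Type*} [TopologicalSpace M] [ChartedSpace H M]
  {N : Type*} [TopologicalSpace N] [ChartedSpace H' N] {k l : ℕ}

namespace DForm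

theorem inChart_add (η ζ : DForm I M k) (x : M) :
    (η + ζ).inChart x = η.inChart x + ζ.inChart x := rfl

theorem inChart_smul (c : ℝ) (η : DForm I M k) (x : M) :
    (c • η).inChart x = c • η.inChart x := rfl

theorem inChart_wedge (η : DForm I M k) (ζ : DForm I M l) (x : M) (y : E) :
    (η.wedge ζ).inChart x y = WarpedG2.wedge (η.inChart x y) (ζ.inChart x y) :=
  wedge_compContinuousLinearMap _ _ _

namespace IsSmooth

variable {η : DForm I M k} {ζ : DForm I M k}

theorem add (hη : η.IsSmooth) (hζ : ζ.IsSmooth) : (η + ζ).IsSmooth :=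
  fun x => (hη x).add (hζ x)

theorem sub (hη : η.IsSmooth) (hζ : ζ.IsSmooth) : (η - ζ).IsSmooth :=
  fun x => (hη x).sub (hζ x)

theorem smul (hη : η.IsSmooth) (c : ℝ) : (c • η).IsSmooth :=
  fun x => (hη x).const_smul c

theorem wedge {ζ : DForm I M l} (hη : η.IsSmooth) (hζ : ζ.IsSmooth) : (η.wedge ζ).IsSmooth :=
  fun x => (contDiffOn_wedge (hη x) (hζ x)).congr fun y _ => inChart_wedge η ζ x y

variable [I.Boundaryless]

theorem contDiffAt (hη : η.IsSmooth) (x : M) {y : E} (hy : y ∈ (extChartAt I x).target) :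
    ContDiffAt ℝ (⊤ : ℕ∞) (η.inChart x) y :=
  (hη x).contDiffAt ((isOpen_extChartAt_target x).mem_nhds hy)

theorem differentiableAt (hη : η.IsSmooth) (x : M) :
    DifferentiableAt ℝ (η.inChart x) (extChartAt I x x) :=
  (hη.contDiffAt x (mem_extChartAt_target x)).differentiableAt (by simp)

end IsSmooth

variable [I.Boundaryless]

theorem d_add {η ζ : DForm I M k} (hη : η.IsSmooth) (hζ : ζ.IsSmooth) :
    (η + ζ).d = η.d + ζ.d := by
  funext x
  simp only [d, inChart_add, Pi.add_apply,
    extDeriv_add (hη.differentiableAt x) (hζ.differentiableAt x)]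
  rfl

omit [I.Boundaryless] in
theorem d_smul (c : ℝ) (η : DForm I M k) : (c • η).d = c • η.d := by
  funext x
  simp only [d, inChart_smul, Pi.smul_apply, extDeriv_smul]
  rfl

theorem d_sub {η ζ : DForm I M k} (hη : η.IsSmooth) (hζ : ζ.IsSmooth) :
    (η - ζ).d = η.d - ζ.d := by
  have h : ∀ {m : ℕ} (θ ξ : DForm I M m), θ - ξ = θ + (-1 : ℝ) • ξ := fun θ ξ => funext fun x =>
    (sub_eq_add_neg (θ x) (ξ x)).trans (congrArg (θ x + ·) (neg_one_smul ℝ (ξ x)).symm)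
  rw [h, d_add hη (hζ.smul _), d_smul, ← h]

omit [I.Boundaryless] in
theorem d_zero : (0 : DForm I M k).d = 0 := by
  have h : ∀ {m : ℕ} (θ : DForm I M m), (0 : ℝ) • θ = 0 := fun θ => funext fun x =>
    zero_smul ℝ (θ x)
  rw [← h (0 : DForm I M k), d_smul, h]

theorem d_wedge_self [FiniteDimensional ℝ E] {η : DForm I M 2} (hη : η.IsSmooth)
    (h : ∀ x, extDeriv (η.inChart x) (extChartAt I x x) = 0) : (η.wedge η).d = 0 := by
  funext x
  have h1 : (η.wedge η).inChart x = fun y => WarpedG2.wedge (η.inChart x y) (η.inChart x y) :=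
    funext (inChart_wedge η η x)
  have h2 := extDeriv_wedge_self (Module.finBasis ℝ E) (hη.differentiableAt x) (h x)
  have h3 : extDeriv ((η.wedge η).inChart x) (extChartAt I x x) = 0 :=
    (congrArg (fun F => extDeriv F (extChartAt I x x)) h1).trans h2
  exact (congrArg (fun F => F.compContinuousLinearMap
    (mfderiv I 𝓘(ℝ, E) (extChartAt I x) x)) h3).trans rfl

omit [I.Boundaryless] in
-- The derivative of the preferred chart at its own base point is the identity, so nothing is lost
-- in passing from the chart to the tangent space.
theorem extDeriv_inChart_eq_zero [IsManifold I 1 M] {η : DForm I M k} (h : η.d = 0) (x : M) :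
    extDeriv (η.inChart x) (extChartAt I x x) = 0 := by
  have h1 := congrFun h x
  rw [d, mfderiv_extChartAt_self] at h1
  exact h1

end DForm

/-! ### Forms on products -/

section Product

variable [I.Boundaryless] [I'.Boundaryless] [IsManifold I 1 M] [IsManifold I' 1 N]

theorem mdifferentiableAt_extChartAt_symm (x : M) {y : E} (hy : y ∈ (extChartAt I x).target) :
    MDifferentiableAt 𝓘(ℝ, E) I (extChartAt I x).symm y := by
  have h := mdifferentiableWithinAt_extChartAt_symm hy
  rwa [I.range_eq_univ, mdifferentiableWithinAt_univ] at h

omit [I.Boundaryless] [I'.Boundaryless] [IsManifold I 1 M] [IsManifold I' 1 N] in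
theorem mem_target_prod {p : M × N} {w : E × E'} :
    w ∈ (extChartAt (I.prod I') p).target ↔
      w.1 ∈ (extChartAt I p.1).target ∧ w.2 ∈ (extChartAt I' p.2).target := by
  rw [extChartAt_prod]
  rfl

/-- The chain rule applied both ways around the square formed by the projection and the inverse
charts, which commutes because the chart of a product is the product of the charts. -/
theorem mfderiv_fst_comp_symm (p : M × N) {w : E × E'}
    (hw : w ∈ (extChartAt (I.prod I') p).target) :
    ((mfderiv (I.prod I') I Prod.fst ((extChartAt (I.prod I') p).symm w)) ∘L
      (mfderiv 𝓘(ℝ, E × E') (I.prod I') (extChartAt (I.prod I') p).symm w) : E × E' →L[ℝ] E) =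
    ((mfderiv 𝓘(ℝ, E) I (extChartAt I p.1).symm w.1) ∘L (ContinuousLinearMap.fst ℝ E E') :
      E × E' →L[ℝ] E) := by
  have h1 := mfderiv_comp (I := 𝓘(ℝ, E × E')) (I' := I.prod I') (I'' := I) w
    (mdifferentiableAt_fst (x := (extChartAt (I.prod I') p).symm w))
    (mdifferentiableAt_extChartAt_symm p hw)
  have h2 := mfderiv_comp (I := 𝓘(ℝ, E × E')) (I' := 𝓘(ℝ, E)) (I'' := I) w
    (mdifferentiableAt_extChartAt_symm p.1 (mem_target_prod.1 hw).1)
    (differentiableAt_fst (𝕜 := ℝ) (p := w)).mdifferentiableAt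
  rw [mfderiv_eq_fderiv, fderiv_fst] at h2
  exact h1.symm.trans h2

theorem mfderiv_snd_comp_symm (p : M × N) {w : E × E'}
    (hw : w ∈ (extChartAt (I.prod I') p).target) :
    ((mfderiv (I.prod I') I' Prod.snd ((extChartAt (I.prod I') p).symm w)) ∘L
      (mfderiv 𝓘(ℝ, E × E') (I.prod I') (extChartAt (I.prod I') p).symm w) : E × E' →L[ℝ] E') =
    ((mfderiv 𝓘(ℝ, E') I' (extChartAt I' p.2).symm w.2) ∘L (ContinuousLinearMap.snd ℝ E E') :
      E × E' →L[ℝ] E') := by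
  have h1 := mfderiv_comp (I := 𝓘(ℝ, E × E')) (I' := I.prod I') (I'' := I') w
    (mdifferentiableAt_snd (x := (extChartAt (I.prod I') p).symm w))
    (mdifferentiableAt_extChartAt_symm p hw)
  have h2 := mfderiv_comp (I := 𝓘(ℝ, E × E')) (I' := 𝓘(ℝ, E')) (I'' := I') w
    (mdifferentiableAt_extChartAt_symm p.2 (mem_target_prod.1 hw).2)
    (differentiableAt_snd (𝕜 := ℝ) (p := w)).mdifferentiableAt
  rw [mfderiv_eq_fderiv, fderiv_snd] at h2
  exact h1.symm.trans h2

theorem inChart_pullback_fst (η : DForm I M k) (p : M × N) {w : E × E'}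
    (hw : w ∈ (extChartAt (I.prod I') p).target) :
    (DForm.pullback (I := I.prod I') Prod.fst η).inChart p w =
      (η.inChart p.1 w.1).compContinuousLinearMap (ContinuousLinearMap.fst ℝ E E') :=
  congrArg (fun L : E × E' →L[ℝ] E => ContinuousAlternatingMap.compContinuousLinearMap
    (M := E) (η ((extChartAt I p.1).symm w.1)) L) (mfderiv_fst_comp_symm p hw)

theorem inChart_pullback_snd (η : DForm I' N k) (p : M × N) {w : E × E'}
    (hw : w ∈ (extChartAt (I.prod I') p).target) :
    (DForm.pullback (I := I.prod I') Prod.snd η).inChart p w =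
      (η.inChart p.2 w.2).compContinuousLinearMap (ContinuousLinearMap.snd ℝ E E') :=
  congrArg (fun L : E × E' →L[ℝ] E' => ContinuousAlternatingMap.compContinuousLinearMap
    (M := E') (η ((extChartAt I' p.2).symm w.2)) L) (mfderiv_snd_comp_symm p hw)

theorem DForm.IsSmooth.pullback_fst {η : DForm I M k} (hη : η.IsSmooth) :
    (DForm.pullback (I := I.prod I') (Prod.fst : M × N → M) η).IsSmooth := fun p => by
  refine ContDiffOn.congr ?_ fun w hw => inChart_pullback_fst η p hw
  exact (ContinuousAlternatingMap.compContinuousLinearMapCLM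
    (ContinuousLinearMap.fst ℝ E E')).contDiff.comp_contDiffOn
    ((hη p.1).comp contDiff_fst.contDiffOn fun w hw => ((mem_target_prod (I := I) (I' := I') (p := p)).1 hw).1)

theorem DForm.IsSmooth.pullback_snd {η : DForm I' N k} (hη : η.IsSmooth) :
    (DForm.pullback (I := I.prod I') (Prod.snd : M × N → N) η).IsSmooth := fun p => by
  refine ContDiffOn.congr ?_ fun w hw => inChart_pullback_snd η p hw
  exact (ContinuousAlternatingMap.compContinuousLinearMapCLM
    (ContinuousLinearMap.snd ℝ E E')).contDiff.comp_contDiffOn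
    ((hη p.2).comp contDiff_snd.contDiffOn fun w hw => ((mem_target_prod (I := I) (I' := I') (p := p)).1 hw).2)

theorem extDeriv_inChart_pullback_fst {η : DForm I M k} (hη : η.IsSmooth) (p : M × N) :
    extDeriv ((DForm.pullback (I := I.prod I') Prod.fst η).inChart p)
      (extChartAt (I.prod I') p p) =
      (extDeriv (η.inChart p.1) (extChartAt I p.1 p.1)).compContinuousLinearMap
        (ContinuousLinearMap.fst ℝ E E') := by
  have h1 : (DForm.pullback (I := I.prod I') Prod.fst η).inChart p
      =ᶠ[nhds (extChartAt (I.prod I') p p)] fun w => (η.inChart p.1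
        (ContinuousLinearMap.fst ℝ E E' w)).compContinuousLinearMap
        (fderiv ℝ (ContinuousLinearMap.fst ℝ E E') w) := by
    filter_upwards [extChartAt_target_mem_nhds p] with w hw
    rw [inChart_pullback_fst η p hw, ContinuousLinearMap.fderiv]
    rfl
  have h2 := extDeriv_pullback (r := 2) (x := extChartAt (I.prod I') p p)
    (f := ContinuousLinearMap.fst ℝ E E') (ω := η.inChart p.1)
    (hη.differentiableAt p.1) (ContinuousLinearMap.contDiff _).contDiffAt (by simp)
  rw [ContinuousLinearMap.fderiv] at h2
  exact h1.extDeriv_eq.trans h2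

omit [I.Boundaryless] [I'.Boundaryless] in
theorem fst_comp_mfderiv_extChartAt (p : M × N) :
    ((ContinuousLinearMap.fst ℝ E E') ∘L
      (mfderiv (I.prod I') 𝓘(ℝ, E × E') (extChartAt (I.prod I') p) p) : E × E' →L[ℝ] E) =
    ((mfderiv I 𝓘(ℝ, E) (extChartAt I p.1) p.1) ∘L
      (mfderiv (I.prod I') I Prod.fst p) : E × E' →L[ℝ] E) := by
  have h1 := mfderiv_comp (I := I.prod I') (I' := 𝓘(ℝ, E × E')) (I'' := 𝓘(ℝ, E)) p
    (differentiableAt_fst (𝕜 := ℝ) (p := extChartAt (I.prod I') p p)).mdifferentiableAt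
    (mdifferentiableAt_extChartAt (mem_chart_source (ModelProd H H') p))
  have h2 := mfderiv_comp (I := I.prod I') (I' := I) (I'' := 𝓘(ℝ, E)) p
    (mdifferentiableAt_extChartAt (I := I) (mem_chart_source H p.1))
    (mdifferentiableAt_fst (x := p))
  rw [mfderiv_eq_fderiv, fderiv_fst] at h1
  exact h1.symm.trans h2

/-- In product charts the projection is linear, so this is naturality of the exterior derivative in
a vector space, transported back to the tangent spaces. -/
theorem d_pullback_fst {η : DForm I M k} (hη : η.IsSmooth) :
    (DForm.pullback (I := I.prod I') (Prod.fst : M × N → M) η).d =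
      DForm.pullback Prod.fst η.d := by
  funext p
  refine (congrArg (fun F : (E × E') [⋀^Fin (k + 1)]→L[ℝ] ℝ => F.compContinuousLinearMap
    (mfderiv (I.prod I') 𝓘(ℝ, E × E') (extChartAt (I.prod I') p) p : E × E' →L[ℝ] E × E'))
    (extDeriv_inChart_pullback_fst hη p)).trans ?_
  exact congrArg (fun L : E × E' →L[ℝ] E => ContinuousAlternatingMap.compContinuousLinearMap
    (extDeriv (η.inChart p.1) (extChartAt I p.1 p.1)) L) (fst_comp_mfderiv_extChartAt p)

theorem inChart_compContinuousLinearMap_mfderiv (η : DForm I M k) (x : M) :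
    (η.inChart x (extChartAt I x x)).compContinuousLinearMap
      (mfderiv I 𝓘(ℝ, E) (extChartAt I x) x) = η x := by
  have h1 := mfderivWithin_extChartAt_symm_comp_mfderiv_extChartAt' (I := I)
    (mem_extChartAt_source (I := I) x)
  rw [I.range_eq_univ, mfderivWithin_univ] at h1
  refine (congrArg (fun L : E →L[ℝ] E => ContinuousAlternatingMap.compContinuousLinearMap
    (M := E) (η ((extChartAt I x).symm (extChartAt I x x))) L) h1).trans ?_
  exact congrArg (fun y => (show E [⋀^Fin k]→L[ℝ] ℝ from η y)) (extChartAt_to_inv (I := I) x)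

/-- The derivative of a 1-form on the line, pulled back to a product. -/
theorem hasFDerivAt_inChart_pullback_snd (b : Module.Basis (Fin 1) ℝ E') {ζ : DForm I' N 1}
    (hζ : ζ.IsSmooth) (p : M × N) : ∃ c : ℝ,
    HasFDerivAt ((DForm.pullback (I := I.prod I') Prod.snd ζ).inChart p)
      (c • ((coframe b 0).comp (ContinuousLinearMap.snd ℝ E E')).smulRight
        (oneForm ((coframe b 0).comp (ContinuousLinearMap.snd ℝ E E'))))
      (extChartAt (I.prod I') p p) := by
  obtain ⟨Z, hZ⟩ := hζ.differentiableAt p.2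
  have hb : ∀ u : E', u = b.repr u 0 • b 0 := fun u => by
    conv_lhs => rw [← b.sum_repr u]
    simp
  have h1 : (DForm.pullback (I := I.prod I') Prod.snd ζ).inChart p
      =ᶠ[nhds (extChartAt (I.prod I') p p)] fun w => (ζ.inChart p.2
        (ContinuousLinearMap.snd ℝ E E' w)).compContinuousLinearMap
        (ContinuousLinearMap.snd ℝ E E') := by
    filter_upwards [extChartAt_target_mem_nhds p] with w hw
    exact inChart_pullback_snd ζ p hw
  have h2 := (ContinuousAlternatingMap.compContinuousLinearMapCLM (F := ℝ) (ι := Fin 1)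
    (ContinuousLinearMap.snd ℝ E E')).hasFDerivAt.comp (extChartAt (I.prod I') p p)
    (HasFDerivAt.comp (extChartAt (I.prod I') p p) (g := ζ.inChart p.2) hZ
      (ContinuousLinearMap.snd ℝ E E').hasFDerivAt)
  -- The fibre is one-dimensional, so the derivative of the 1-form is a single number, its value on
  -- the basis vector.
  refine ⟨Z (b 0) fun _ => b 0, (HasFDerivAt.congr_of_eventuallyEq h2 h1).congr_fderiv ?_⟩
  refine ContinuousLinearMap.ext fun v => ContinuousAlternatingMap.ext fun u => ?_
  change Z v.2 (fun i => (u i).2) = Z (b 0) (fun _ => b 0) * (b.repr v.2 0 * b.repr (u 0).2 0)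
  have h3 : (fun i => (u i).2) = fun i : Fin 1 => b.repr (u 0).2 0 • b 0 := by
    funext i
    rw [Subsingleton.elim i 0, ← hb]
  have h4 := (Z (b 0)).map_smul_univ (fun _ => b.repr (u 0).2 0) (fun _ => b 0)
  conv_lhs => rw [hb v.2, h3]
  rw [map_smul, ContinuousAlternatingMap.smul_apply]
  refine (congrArg (b.repr v.2 0 * ·) h4).trans ?_
  simp
  ring

/-- The second term of the Leibniz rule drops out since every 1-form on a one-dimensional manifold
is closed. -/
theorem d_wedge_pullback_snd [FiniteDimensional ℝ E] [FiniteDimensional ℝ E']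
    (b : Module.Basis (Fin 1) ℝ E') {η : DForm I M k} (hη : η.IsSmooth)
    {ζ : DForm I' N 1} (hζ : ζ.IsSmooth) :
    ((DForm.pullback (I := I.prod I') (Prod.fst : M × N → M) η).wedge
      (DForm.pullback (I := I.prod I') (Prod.snd : M × N → N) ζ)).d =
    (DForm.pullback (I := I.prod I') (Prod.fst : M × N → M) η.d).wedge
      (DForm.pullback (I := I.prod I') (Prod.snd : M × N → N) ζ) := by
  funext p
  obtain ⟨c, hc⟩ := hasFDerivAt_inChart_pullback_snd (I := I) (M := M) b hζ p
  have h := extDeriv_wedge_one (Module.finBasis ℝ (E × E'))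
    ((hη.pullback_fst (N := N) (I' := I')).differentiableAt p) hc
  have h1 : ((DForm.pullback (I := I.prod I') (Prod.fst : M × N → M) η).wedge
      (DForm.pullback (I := I.prod I') (Prod.snd : M × N → N) ζ)).inChart p = fun w =>
      wedge ((DForm.pullback (I := I.prod I') (Prod.fst : M × N → M) η).inChart p w)
        ((DForm.pullback (I := I.prod I') (Prod.snd : M × N → N) ζ).inChart p w) :=
    funext (DForm.inChart_wedge _ _ p)
  refine (congrArg (fun F : (E × E') [⋀^Fin (k + 1 + 1)]→L[ℝ] ℝ => F.compContinuousLinearMap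
    (mfderiv (I.prod I') 𝓘(ℝ, E × E') (extChartAt (I.prod I') p) p : E × E' →L[ℝ] E × E'))
    ((congrArg (fun F => extDeriv F (extChartAt (I.prod I') p p)) h1).trans h)).trans ?_
  refine (wedge_compContinuousLinearMap _ _ _).trans ?_
  exact congrArg₂ wedge (congrFun (d_pullback_fst hη) p)
    (inChart_compContinuousLinearMap_mfderiv _ p)

end Product

end Manifold

/-! ### The angular form on the circle -/

section Circle

attribute [local instance] finrank_real_complex_fact'

/-- The value of `ds` as a linear functional. -/
def dsFunctional (z : Circle) : TangentSpace (𝓡 1) z →L[ℝ] ℝ :=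
  Complex.imCLM ∘L ((z : ℂ)⁻¹ • mvfderiv (𝓡 1) (fun w : Circle => (w : ℂ)) z)

theorem contMDiff_coe_circle :
    ContMDiff (𝓡 1) 𝓘(ℝ, ℂ) (⊤ : ℕ∞) (fun w : Circle => (w : ℂ)) :=
  contMDiff_coe_sphere (E := ℂ) (n := 1)

/-- A tangent vector of the circle at `z` is orthogonal to `z`, so its product with `z⁻¹` is purely
imaginary; if the imaginary part also vanishes, so does the vector. -/
theorem dsFunctional_injective (z : Circle) : Function.Injective (dsFunctional z) := by
  rw [injective_iff_map_eq_zero]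
  intro u hu
  have hinj : Function.Injective (mvfderiv (𝓡 1) (fun w : Circle => (w : ℂ)) z) :=
    injective_mvfderiv_subtypeVal_sphere (E := ℂ) (n := 1) z
  have hrange : mvfderiv (𝓡 1) (fun w : Circle => (w : ℂ)) z u ∈ (Submodule.span ℝ {(z : ℂ)})ᗮ := by
    have h := range_mvfderiv_subtypeVal (E := ℂ) (n := 1) z
    exact h ▸ LinearMap.mem_range_self _ u
  refine hinj ?_
  rw [map_zero]
  change ((z : ℂ)⁻¹ * mvfderiv (𝓡 1) (fun w : Circle => (w : ℂ)) z u).im = 0 at hu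
  rw [Submodule.mem_orthogonal_singleton_iff_inner_right, Complex.inner, ← Circle.coe_inv_eq_conj,
    Circle.coe_inv] at hrange
  have h := Complex.ext (z := (z : ℂ)⁻¹ * mvfderiv (𝓡 1) (fun w : Circle => (w : ℂ)) z u) (w := 0)
    ((congrArg Complex.re (mul_comm _ _)).trans hrange) hu
  exact (mul_eq_zero.1 h).resolve_left (inv_ne_zero z.coe_ne_zero)

/-- If `g` is the inverse chart viewed as a map into `ℂ`, the coordinate expression is `Im(g⁻¹ dg)`,
smooth because `g` never vanishes. -/
theorem ds_isSmooth : ds.IsSmooth := fun z₀ => by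
  set g : EuclideanSpace ℝ (Fin 1) → ℂ := fun y => ((extChartAt (𝓡 1) z₀).symm y : Circle)
  have hm : IsManifold (𝓡 1) (⊤ : ℕ∞) Circle := IsManifold.of_le (n := (⊤ : WithTop ℕ∞)) le_top
  have hm1 : IsManifold (𝓡 1) 1 Circle := IsManifold.of_le (n := (⊤ : WithTop ℕ∞)) le_top
  have ho := isOpen_extChartAt_target (I := 𝓡 1) z₀
  have hg : ContDiffOn ℝ (⊤ : ℕ∞) g (extChartAt (𝓡 1) z₀).target :=
    contMDiffOn_iff_contDiffOn.1 (contMDiff_coe_circle.comp_contMDiffOn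
      (contMDiffOn_extChartAt_symm z₀))
  have hg' : ContDiffOn ℝ (⊤ : ℕ∞) (fderiv ℝ g) (extChartAt (𝓡 1) z₀).target :=
    hg.fderiv_of_isOpen ho (by simp)
  have hi : ContDiffOn ℝ (⊤ : ℕ∞) (fun y => (g y)⁻¹) (extChartAt (𝓡 1) z₀).target :=
    hg.inv fun y _ => Circle.coe_ne_zero _
  have hc := (ContinuousAlternatingMap.ofSubsingletonLIE (𝕜 := ℝ) (E := EuclideanSpace ℝ (Fin 1))
    (F := ℝ) (0 : Fin 1)).contDiff (n := (⊤ : ℕ∞)) |>.comp_contDiffOn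
    ((contDiffOn_const (c := Complex.imCLM)).clm_comp
      (((ContinuousLinearMap.mul ℝ ℂ).contDiff.comp_contDiffOn hi).clm_comp hg'))
  refine hc.congr fun y hy => ?_
  have h1 := mfderiv_comp (I := 𝓘(ℝ, EuclideanSpace ℝ (Fin 1))) (I' := 𝓡 1) (I'' := 𝓘(ℝ, ℂ)) y
    (contMDiff_coe_circle.mdifferentiableAt (by simp))
    (mdifferentiableAt_extChartAt_symm z₀ hy)
  have h2 : fderiv ℝ g y = (mvfderiv (𝓡 1) (fun w : Circle => (w : ℂ))
      ((extChartAt (𝓡 1) z₀).symm y)).comp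
      (mfderiv 𝓘(ℝ, EuclideanSpace ℝ (Fin 1)) (𝓡 1) (extChartAt (𝓡 1) z₀).symm y) :=
    mfderiv_eq_fderiv.symm.trans h1
  simp only [Function.comp_apply]
  rw [h2]
  rfl

end Circle

/-! ### Lifts to the product with a circle -/

section Lift

variable {M : Type*} [TopologicalSpace M] [ChartedSpace (EuclideanSpace ℝ (Fin 6)) M] {k : ℕ}

/-- The projection of a tangent space of `M × S¹` to the tangent space of `M`. -/
def projBase (p : M × Circle) :
    TangentSpace ((𝓡 6).prod (𝓡 1)) p →L[ℝ] TangentSpace (𝓡 6) p.1 :=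
  ContinuousLinearMap.fst ℝ (TangentSpace (𝓡 6) p.1) (TangentSpace (𝓡 1) p.2)

/-- The value of the lift of `ds` as a linear functional. -/
def dsLiftFunctional (p : M × Circle) : TangentSpace ((𝓡 6).prod (𝓡 1)) p →L[ℝ] ℝ :=
  (dsFunctional p.2).comp
    (ContinuousLinearMap.snd ℝ (TangentSpace (𝓡 6) p.1) (TangentSpace (𝓡 1) p.2))

theorem liftBase_apply (η : DForm (𝓡 6) M k) (p : M × Circle) :
    liftBase η p = (η p.1).compContinuousLinearMap (projBase p) := by
  rw [liftBase, DForm.pullback, mfderiv_fst]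
  rfl

theorem dsLift_apply (p : M × Circle) : dsLift p = oneForm (dsLiftFunctional p) := by
  rw [dsLift, DForm.pullback, mfderiv_snd]
  rfl

theorem bijective_projBase_prod (p : M × Circle) :
    Function.Bijective ((projBase p).prod (dsLiftFunctional p)) := by
  have hi := dsFunctional_injective p.2
  have hs : Function.Surjective (dsFunctional p.2) := by
    have hf : FiniteDimensional ℝ (TangentSpace (𝓡 1) p.2) :=
      inferInstanceAs (FiniteDimensional ℝ (EuclideanSpace ℝ (Fin 1)))
    have h : Module.finrank ℝ (TangentSpace (𝓡 1) p.2) = Module.finrank ℝ ℝ :=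
      (finrank_euclideanSpace_fin (𝕜 := ℝ) (n := 1)).trans (Module.finrank_self ℝ).symm
    exact (LinearMap.injective_iff_surjective_of_finrank_eq_finrank
      (f := (dsFunctional p.2).toLinearMap) h).1 hi
  exact Function.bijective_id.prodMap ⟨hi, hs⟩

end Lift

/-! ### Rotation-invariant forms on `M × S¹` and their exterior derivative -/

section LiftCalculus

variable {M : Type*} [TopologicalSpace M] [ChartedSpace (EuclideanSpace ℝ (Fin 6)) M] {k : ℕ}

theorem liftBase_add (η ζ : DForm (𝓡 6) M k) : liftBase (η + ζ) = liftBase η + liftBase ζ := rfl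

theorem liftBase_smul_wedge_dsLift (c : ℝ) (η : DForm (𝓡 6) M k) :
    (liftBase (c • η)).wedge dsLift = c • (liftBase η).wedge dsLift :=
  funext fun p => wedge_smul_left c (liftBase η p) (dsLift p)

theorem liftBase_wedge_dsLift_apply (η : DForm (𝓡 6) M k) (p : M × Circle) :
    (liftBase η).wedge dsLift p =
      wedge ((η p.1).compContinuousLinearMap (projBase p)) (oneForm (dsLiftFunctional p)) := by
  rw [DForm.wedge, liftBase_apply, dsLift_apply]

/-- Forms on `M × S¹` that are invariant under rotations determine their components. -/
theorem lift_components_eq_zero {A : DForm (𝓡 6) M k} {B : DForm (𝓡 6) M (k + 1)}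
    (h : (liftBase A).wedge dsLift + liftBase B = 0) : A = 0 ∧ B = 0 := by
  have key : ∀ x, A x = 0 ∧ B x = 0 := fun x => by
    -- Any point of the circle would do, since the components do not depend on it.
    have hx := congrFun h (x, 1)
    rw [Pi.add_apply, liftBase_wedge_dsLift_apply, liftBase_apply] at hx
    have hb : Nonempty (Module.Basis (Fin 7) ℝ
        (TangentSpace ((𝓡 6).prod (𝓡 1)) ((x, 1) : M × Circle))) :=
      ⟨(Module.finBasisOfFinrankEq ℝ (EuclideanSpace ℝ (Fin 6) × EuclideanSpace ℝ (Fin 1))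
        (by simp))⟩
    exact components_eq_zero hb.some (projBase (x, 1)) (dsLiftFunctional (x, 1)) (bijective_projBase_prod (x, 1)) hx
  exact ⟨funext fun x => (key x).1, funext fun x => (key x).2⟩

/-- The warping factor is constant on `M`, so it moves onto the base and no term `df ∧ ω ∧ ds`
arises in the derivative. -/
theorem warpedForm_eq (α β c : ℝ) (S : SU3Structure M) :
    warpedForm α β (fun _ => c) S =
      (liftBase (c • S.ω)).wedge dsLift + liftBase (α • S.ψp - β • S.ψm) := by
  rw [liftBase_smul_wedge_dsLift]
  rfl

variable [IsManifold (𝓡 6) (⊤ : ℕ∞) M]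

theorem isManifold_one : IsManifold (𝓡 6) 1 M :=
  IsManifold.of_le (n := ((⊤ : ℕ∞) : WithTop ℕ∞)) (by exact_mod_cast le_top)

theorem isManifold_circle : IsManifold (𝓡 1) 1 Circle :=
  IsManifold.of_le (n := (⊤ : WithTop ℕ∞)) le_top

attribute [local instance] isManifold_one isManifold_circle

theorem liftBase_isSmooth {η : DForm (𝓡 6) M k} (hη : η.IsSmooth) : (liftBase η).IsSmooth :=
  hη.pullback_fst

theorem dsLift_isSmooth : (dsLift : DForm ((𝓡 6).prod (𝓡 1)) (M × Circle) 1).IsSmooth :=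
  ds_isSmooth.pullback_snd

theorem d_liftBase {η : DForm (𝓡 6) M k} (hη : η.IsSmooth) : (liftBase η).d = liftBase η.d :=
  d_pullback_fst hη

theorem d_liftBase_wedge_dsLift {η : DForm (𝓡 6) M k} (hη : η.IsSmooth) :
    ((liftBase η).wedge dsLift).d = (liftBase η.d).wedge dsLift :=
  d_wedge_pullback_snd (EuclideanSpace.basisFun (Fin 1) ℝ).toBasis hη ds_isSmooth

theorem d_lift {A : DForm (𝓡 6) M k} {B : DForm (𝓡 6) M (k + 1)} (hA : A.IsSmooth)
    (hB : B.IsSmooth) :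
    ((liftBase A).wedge dsLift + liftBase B).d = (liftBase A.d).wedge dsLift + liftBase B.d := by
  rw [DForm.d_add ((liftBase_isSmooth hA).wedge dsLift_isSmooth) (liftBase_isSmooth hB),
    d_liftBase_wedge_dsLift hA, d_liftBase hB]

theorem d_eq_zero_of_warpedForm {α β c : ℝ} (hc : c ≠ 0) {S : SU3Structure M}
    (h : (warpedForm α β (fun _ => c) S).d = 0) :
    S.ω.d = 0 ∧ (α • S.ψp - β • S.ψm).d = 0 := by
  rw [warpedForm_eq, d_lift (S.smooth_ω.smul c)
    ((S.smooth_ψp.smul α).sub (S.smooth_ψm.smul β)), DForm.d_smul] at h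
  obtain ⟨h1, h2⟩ := lift_components_eq_zero h
  exact ⟨funext fun x => (smul_eq_zero.1 (congrFun h1 x)).resolve_left hc, h2⟩

end LiftCalculus

/-! ### The torsion of closed warped structures -/

section Torsion

variable {M : Type*} [TopologicalSpace M] [ChartedSpace (EuclideanSpace ℝ (Fin 6)) M]
  {S : SU3Structure M} {T : TorsionData M} {α β : ℝ}

theorem SU3Structure.IsTorsion.scalar_eq_zero (hT : S.IsTorsion T) (hω : S.ω.d = 0) (x : M) :
    T.σ0 x = 0 ∧ T.π0 x = 0 := by
  obtain ⟨b, hb⟩ := S.frame x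
  have h := congrFun (hω.symm.trans hT.dω_eq) x
  have h1 : (-(3 / 2) * T.σ0 x) • S.ψp x + (3 / 2 * T.π0 x) • S.ψm x
      + (wedge (T.ν1 x) (S.ω x) : TangentSpace (𝓡 6) x [⋀^Fin 3]→L[ℝ] ℝ) + T.ν3 x = 0 := by
    rw [mul_smul, mul_smul]
    exact h.symm
  obtain ⟨h2, h3⟩ := three_form_decomposition_unique hb (congrFun hT.mem_ν3.2.2.1 x)
    (congrFun hT.mem_ν3.2.2.2 x) h1
  constructor <;> linarith

/-- A combination of forms in `Ω²₈` is primitive of type `(1,1)` in the rotated frames. -/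
theorem SU3Structure.IsOmega28.isPrimitive11 {σ τ : DForm (𝓡 6) M 2} (hσ : S.IsOmega28 σ)
    (hτ : S.IsOmega28 τ) (c d : ℝ) (hαβ : α ^ 2 + β ^ 2 = 1) {x : M}
    {b : Module.Basis (Fin 6) ℝ (TangentSpace (𝓡 6) x)}
    (hb : IsSU3Frame (S.ω x) (α • S.ψp x - β • S.ψm x) (β • S.ψp x + α • S.ψm x) b) :
    IsPrimitive11 b (c • σ x + d • τ x) := by
  refine isPrimitive11_of_wedge hb hαβ ?_ ?_
  · have h1 : wedge (σ x) (S.ψp x) = 0 := congrFun hσ.2.1 x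
    have h2 : wedge (τ x) (S.ψp x) = 0 := congrFun hτ.2.1 x
    have h3 : α • (α • S.ψp x - β • S.ψm x) + β • (β • S.ψp x + α • S.ψm x) = S.ψp x := by
      have h4 : α • (α • S.ψp x - β • S.ψm x) + β • (β • S.ψp x + α • S.ψm x)
          = (α ^ 2 + β ^ 2) • S.ψp x := by module
      rw [h4, hαβ, one_smul]
    rw [h3, wedge_add_left, wedge_smul_left, wedge_smul_left, h1, h2, smul_zero, smul_zero,
      add_zero]
  · have h1 : wedge (σ x) (wedge (S.ω x) (S.ω x)) = 0 := congrFun hσ.2.2 x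
    have h2 : wedge (τ x) (wedge (S.ω x) (S.ω x)) = 0 := congrFun hτ.2.2 x
    rw [wedge_add_left, wedge_smul_left, wedge_smul_left, h1, h2, smul_zero, smul_zero, add_zero]

theorem SU3Structure.IsTorsion.d_combination (hT : S.IsTorsion T) (c d : ℝ) (x : M) :
    c • S.ψp.d x + d • S.ψm.d x =
      (c * T.π0 x + d * T.σ0 x) • wedge (S.ω x) (S.ω x)
        + (wedge (T.π1 x) (c • S.ψp x + d • S.ψm x) : TangentSpace (𝓡 6) x [⋀^Fin 4]→L[ℝ] ℝ)
        - wedge (c • T.π2 x + d • T.σ2 x) (S.ω x) := by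
  have h1 : S.ψp.d x = T.π0 x • wedge (S.ω x) (S.ω x)
      + (wedge (T.π1 x) (S.ψp x) : TangentSpace (𝓡 6) x [⋀^Fin 4]→L[ℝ] ℝ)
      - wedge (T.π2 x) (S.ω x) := congrFun hT.dψp_eq x
  have h2 : S.ψm.d x = T.σ0 x • wedge (S.ω x) (S.ω x)
      + (wedge (T.π1 x) (S.ψm x) : TangentSpace (𝓡 6) x [⋀^Fin 4]→L[ℝ] ℝ)
      - wedge (T.σ2 x) (S.ω x) := congrFun hT.dψm_eq x
  have h3 : (wedge (T.π1 x) (c • S.ψp x + d • S.ψm x) : TangentSpace (𝓡 6) x [⋀^Fin 4]→L[ℝ] ℝ)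
      = c • (wedge (T.π1 x) (S.ψp x) : TangentSpace (𝓡 6) x [⋀^Fin 4]→L[ℝ] ℝ)
        + d • (wedge (T.π1 x) (S.ψm x) : TangentSpace (𝓡 6) x [⋀^Fin 4]→L[ℝ] ℝ) := by
    refine (wedge_add_right _ _ _).trans ?_
    exact congrArg₂ (· + ·) (wedge_smul_right _ _ _) (wedge_smul_right _ _ _)
  rw [h1, h2, h3, wedge_add_left, wedge_smul_left, wedge_smul_left]
  module

theorem SU3Structure.exists_rotated_frame (S : SU3Structure M) (hαβ : α ^ 2 + β ^ 2 = 1) (x : M) :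
    ∃ b : Module.Basis (Fin 6) ℝ (TangentSpace (𝓡 6) x),
      IsSU3Frame (S.ω x) (α • S.ψp x - β • S.ψm x) (β • S.ψp x + α • S.ψm x) b := by
  obtain ⟨b, hb⟩ := S.frame x
  exact ⟨_, hb.rot hαβ⟩

/-- The torsion formulas combine to a type decomposition of `dρ` for the rotated structure `(ω, ρ,
ρ')`; uniqueness makes each component vanish. -/
theorem SU3Structure.IsTorsion.eq_zero_of_d_eq_zero (hT : S.IsTorsion T)
    (hαβ : α ^ 2 + β ^ 2 = 1) (hρ : (α • S.ψp - β • S.ψm).d = 0)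
    (hd : (α • S.ψp - β • S.ψm).d = α • S.ψp.d - β • S.ψm.d) (x : M) :
    T.π1 x = 0 ∧ α • T.π2 x - β • T.σ2 x = 0 := by
  obtain ⟨b, hb⟩ := S.exists_rotated_frame hαβ x
  have hneg : ∀ {m : ℕ} (η θ : TangentSpace (𝓡 6) x [⋀^Fin m]→L[ℝ] ℝ),
      α • η + (-β) • θ = α • η - β • θ := fun η θ => by module
  have hc := hT.d_combination α (-β) x
  rw [hneg, hneg, hneg] at hc
  have h0 : α • S.ψp.d x - β • S.ψm.d x = 0 := congrFun (hd.symm.trans hρ) x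
  have hp := hT.mem_π2.isPrimitive11 hT.mem_σ2 α (-β) hαβ hb
  rw [hneg] at hp
  exact (four_form_decomposition_unique hb hp (hc.symm.trans h0)).2

theorem SU3Structure.IsTorsion.d_rotated_eq (hT : S.IsTorsion T) (hω : S.ω.d = 0)
    (h1 : ∀ x, T.π1 x = 0) (hd : (β • S.ψp + α • S.ψm).d = β • S.ψp.d + α • S.ψm.d) :
    (β • S.ψp + α • S.ψm).d = -(α • T.σ2 + β • T.π2).wedge S.ω := by
  rw [hd]
  funext x
  obtain ⟨hs, hp⟩ := hT.scalar_eq_zero hω x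
  refine (hT.d_combination β α x).trans ?_
  rw [hs, hp, h1]
  have h0 : (wedge (0 : TangentSpace (𝓡 6) x [⋀^Fin 1]→L[ℝ] ℝ) (β • S.ψp x + α • S.ψm x) :
      TangentSpace (𝓡 6) x [⋀^Fin 4]→L[ℝ] ℝ) = 0 := wedge_zero_left _
  rw [h0, mul_zero, mul_zero, add_zero, add_zero, add_comm (β • T.π2 x)]
  exact (congrArg (· - _) (zero_smul ℝ _)).trans (zero_sub _)

end Torsion


/-! ### The Hodge Laplacian of a closed warped structure -/

section Laplacian

variable {M : Type*} [TopologicalSpace M] [ChartedSpace (EuclideanSpace ℝ (Fin 6)) M]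
  {S : SU3Structure M} {T : TorsionData M} {α β c : ℝ}

theorem warpedForm_apply (S : SU3Structure M) (α β c : ℝ) (p : M × Circle) :
    warpedForm α β (fun _ => c) S p =
      c • wedge ((S.ω p.1).compContinuousLinearMap (projBase p)) (oneForm (dsLiftFunctional p))
        + (α • S.ψp p.1 - β • S.ψm p.1).compContinuousLinearMap (projBase p) := by
  have h1 := liftBase_wedge_dsLift_apply S.ω p
  have h2 := liftBase_apply (α • S.ψp - β • S.ψm) p
  rw [← h1]
  exact congrArg (c • (liftBase S.ω).wedge dsLift p + ·) h2

theorem isG2Frame_warpedForm (hc : c ≠ 0) {p : M × Circle}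
    {b : Module.Basis (Fin 6) ℝ (TangentSpace (𝓡 6) p.1)}
    (hb : IsSU3Frame (S.ω p.1) (α • S.ψp p.1 - β • S.ψm p.1) (β • S.ψp p.1 + α • S.ψm p.1) b) :
    IsG2Frame (warpedForm α β (fun _ => c) S p)
      (prodFrame b (projBase p) (dsLiftFunctional p) (bijective_projBase_prod p) hc) := by
  rw [warpedForm_apply]
  exact hb.isG2Frame (bijective_projBase_prod p) hc

theorem star_warpedForm (hαβ : α ^ 2 + β ^ 2 = 1) (hc : c ≠ 0) :
    (warpedForm α β (fun _ => c) S).star7 (k := 3) (l := 4) rfl (warpedForm α β (fun _ => c) S) =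
      (liftBase (c • (β • S.ψp + α • S.ψm))).wedge dsLift
        + liftBase ((1 / 2 : ℝ) • S.ω.wedge S.ω) := by
  funext p
  obtain ⟨b, hb⟩ := S.exists_rotated_frame hαβ p.1
  refine (hodgeStarG2_eq (isG2Frame_warpedForm hc hb) _ _).trans ?_
  refine (congrArg (hodgeStar _ _) (warpedForm_apply S α β c p)).trans ?_
  refine (hb.hodgeStar_three (bijective_projBase_prod p) hc).trans ?_
  rw [add_comm, liftBase_smul_wedge_dsLift]
  exact congrArg₂ (· + ·)
    (congrArg (c • ·) (liftBase_wedge_dsLift_apply (β • S.ψp + α • S.ψm) p).symm)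
    (liftBase_apply ((1 / 2 : ℝ) • S.ω.wedge S.ω) p).symm

theorem liftBase_smul_neg_wedge_dsLift_apply {k : ℕ} (c : ℝ) (θ : DForm (𝓡 6) M k)
    (p : M × Circle) :
    (liftBase (c • -θ)).wedge dsLift p = (-c) •
      wedge ((θ p.1).compContinuousLinearMap (projBase p)) (oneForm (dsLiftFunctional p)) := by
  have h : c • -θ = (-c) • θ := funext fun x => by
    change c • -θ x = (-c) • θ x
    module
  rw [h, liftBase_smul_wedge_dsLift]
  exact congrArg ((-c) • ·) (liftBase_wedge_dsLift_apply θ p)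

theorem neg_smul_neg_inv_smul {X : Type*} [AddCommGroup X] [Module ℝ X] (hc : c ≠ 0) (x : X) :
    (-c) • -(c⁻¹ • x) = x := by
  rw [neg_smul, smul_neg, neg_neg, smul_inv_smul₀ hc]

/-- The factor `-c` in front of the 5-form cancels the `-c⁻¹` produced by the star, so the result
does not depend on the warping. -/
theorem star_warpedForm_five {σ τ : DForm (𝓡 6) M 2} (hσ : S.IsOmega28 σ) (hτ : S.IsOmega28 τ)
    (a d : ℝ) (hαβ : α ^ 2 + β ^ 2 = 1) (hc : c ≠ 0) {θ : DForm (𝓡 6) M 4}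
    (hθ : θ = (a • σ + d • τ).wedge S.ω) :
    (warpedForm α β (fun _ => c) S).star7 (k := 5) (l := 2) rfl
      ((liftBase (c • -θ)).wedge dsLift) = liftBase (a • σ + d • τ) := by
  funext p
  obtain ⟨b, hb⟩ := S.exists_rotated_frame hαβ p.1
  refine (hodgeStarG2_eq (isG2Frame_warpedForm hc hb) _ _).trans ?_
  obtain ⟨ζ, hζ⟩ : ∃ ζ : TangentSpace ((𝓡 6).prod (𝓡 1)) p [⋀^Fin (4 + 1)]→L[ℝ] ℝ,
    ζ = wedge ((θ p.1).compContinuousLinearMap (projBase p)) (oneForm (dsLiftFunctional p)) :=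
    ⟨_, rfl⟩
  have h1 := liftBase_smul_neg_wedge_dsLift_apply c θ p
  rw [← hζ] at h1
  have h := hb.hodgeStar_five (bijective_projBase_prod p) hc (hσ.isPrimitive11 hτ a d hαβ hb)
    (congrFun hθ p.1) hζ
  refine (congrArg (hodgeStar _ _) h1).trans ?_
  refine ((hodgeStarₗ (rfl : 5 + 2 = 7) _).map_smul (-c) ζ).trans ?_
  refine (congrArg ((-c) • ·) h).trans ?_
  exact (neg_smul_neg_inv_smul hc _).trans (liftBase_apply (a • σ + d • τ) p).symm

theorem star_warpedForm_zero (hαβ : α ^ 2 + β ^ 2 = 1) (hc : c ≠ 0) {k l : ℕ} (h : k + l = 7) :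
    (warpedForm α β (fun _ => c) S).star7 h (0 : DForm ((𝓡 6).prod (𝓡 1)) (M × Circle) k) = 0 := by
  funext p
  obtain ⟨b, hb⟩ := S.exists_rotated_frame hαβ p.1
  refine (hodgeStarG2_eq (isG2Frame_warpedForm hc hb) _ _).trans ?_
  exact (hodgeStarₗ h _).map_zero

variable [IsManifold (𝓡 6) (⊤ : ℕ∞) M]

attribute [local instance] isManifold_one isManifold_circle

theorem warpedForm_isG2Structure (S : SU3Structure M) (hαβ : α ^ 2 + β ^ 2 = 1) (hc : c ≠ 0) :
    IsG2Structure (warpedForm α β (fun _ => c) S) where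
  smooth := by
    rw [warpedForm_eq]
    exact ((liftBase_isSmooth (S.smooth_ω.smul c)).wedge dsLift_isSmooth).add
      (liftBase_isSmooth ((S.smooth_ψp.smul α).sub (S.smooth_ψm.smul β)))
  frame p := by
    obtain ⟨b, hb⟩ := S.exists_rotated_frame hαβ p.1
    exact ⟨_, isG2Frame_warpedForm hc hb⟩

theorem SU3Structure.IsTorsion.of_closed (hT : S.IsTorsion T) (hαβ : α ^ 2 + β ^ 2 = 1)
    (hc : c ≠ 0) (hclosed : (warpedForm α β (fun _ => c) S).d = 0) (x : M) :
    T.π1 x = 0 ∧ α • T.π2 x - β • T.σ2 x = 0 := by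
  obtain ⟨-, hρ⟩ := d_eq_zero_of_warpedForm hc hclosed
  refine hT.eq_zero_of_d_eq_zero hαβ hρ ?_ x
  rw [DForm.d_sub (S.smooth_ψp.smul α) (S.smooth_ψm.smul β), DForm.d_smul, DForm.d_smul]

/-- Closedness kills the summand `⋆d⋆dφ`. In the other one, `d⋆φ` is only `f dρ' ∧ ds`, and `⋆d⋆φ`
is the lift of `ασ₂ + βπ₂`. -/
theorem laplacian_warpedForm (hT : S.IsTorsion T) (hαβ : α ^ 2 + β ^ 2 = 1) (hc : c ≠ 0)
    (hclosed : (warpedForm α β (fun _ => c) S).d = 0) :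
    (warpedForm α β (fun _ => c) S).laplacian7 (warpedForm α β (fun _ => c) S) =
      -liftBase (α • T.σ2 + β • T.π2).d := by
  obtain ⟨hω, hρ⟩ := d_eq_zero_of_warpedForm hc hclosed
  have hρs : (β • S.ψp + α • S.ψm).IsSmooth := (S.smooth_ψp.smul β).add (S.smooth_ψm.smul α)
  obtain ⟨θ, hθ⟩ : ∃ θ : DForm (𝓡 6) M 4, θ = (α • T.σ2 + β • T.π2).wedge S.ω := ⟨_, rfl⟩
  have hρ' : (β • S.ψp + α • S.ψm).d = -θ := by
    rw [hθ]
    refine hT.d_rotated_eq hω (fun x => (hT.of_closed hαβ hc hclosed x).1) ?_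
    rw [DForm.d_add (S.smooth_ψp.smul β) (S.smooth_ψm.smul α), DForm.d_smul, DForm.d_smul]
  have hωω : ((1 / 2 : ℝ) • S.ω.wedge S.ω).d = 0 := by
    rw [DForm.d_smul, DForm.d_wedge_self S.smooth_ω (DForm.extDeriv_inChart_eq_zero hω)]
    exact funext fun x => smul_zero (A := TangentSpace (𝓡 6) x [⋀^Fin 5]→L[ℝ] ℝ) (1 / 2 : ℝ)
  have h1 : ((warpedForm α β (fun _ => c) S).star7 (k := 3) (l := 4) rfl
      (warpedForm α β (fun _ => c) S)).d =
      (liftBase (c • -θ)).wedge dsLift := by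
    rw [star_warpedForm hαβ hc]
    refine (d_lift (hρs.smul c) ((S.smooth_ω.wedge S.smooth_ω).smul (1 / 2))).trans ?_
    rw [DForm.d_smul, hρ']
    refine (congrArg (_ + liftBase ·) hωω).trans ?_
    exact add_zero _
  rw [DForm.laplacian7, h1, star_warpedForm_five hT.mem_σ2 hT.mem_π2 α β hαβ hc hθ,
    d_liftBase ((hT.mem_σ2.1.smul α).add (hT.mem_π2.1.smul β)), hclosed,
    star_warpedForm_zero hαβ hc, DForm.d_zero, star_warpedForm_zero hαβ hc, zero_sub]

end Laplacian


/-! ### Evolution of warped structures -/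

section Evolution

/-- An order-connected set with two points is convex with nonempty interior. Endpoints in `J` are
thus allowed, with one-sided derivatives. -/
theorem uniqueDiffOn_of_ordConnected {J : Set ℝ} (hJ : J.OrdConnected) (hJ' : J.Nontrivial) :
    UniqueDiffOn ℝ J := by
  obtain ⟨a, ha, b, hb, hab⟩ := hJ'.exists_lt
  refine uniqueDiffOn_convex hJ.convex ⟨(a + b) / 2, mem_interior.2
    ⟨Ioo a b, Ioo_subset_Icc_self.trans (hJ.out ha hb), isOpen_Ioo, ?_, ?_⟩⟩ <;> linarith

theorem hasDerivWithinAt_warped {E F : Type*} [NormedAddCommGroup E] [NormedSpace ℝ E]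
    [NormedAddCommGroup F] [NormedSpace ℝ F] (L : F →L[ℝ] E) (lam : F →L[ℝ] ℝ) (α β : ℝ)
    {f : ℝ → ℝ} {ω : ℝ → E [⋀^Fin 2]→L[ℝ] ℝ} {ψp ψm : ℝ → E [⋀^Fin 3]→L[ℝ] ℝ} {J : Set ℝ} {t : ℝ}
    (hf : DifferentiableWithinAt ℝ f J t) (hω : DifferentiableWithinAt ℝ ω J t)
    (hψp : DifferentiableWithinAt ℝ ψp J t) (hψm : DifferentiableWithinAt ℝ ψm J t) :
    HasDerivWithinAt (fun τ => (f τ • wedge ((ω τ).compContinuousLinearMap L) (oneForm lam)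
        + (α • ψp τ - β • ψm τ).compContinuousLinearMap L : F [⋀^Fin 3]→L[ℝ] ℝ))
      (wedge ((derivWithin f J t • ω t + f t • derivWithin ω J t).compContinuousLinearMap L)
          (oneForm lam)
        + (α • derivWithin ψp J t - β • derivWithin ψm J t).compContinuousLinearMap L) J t := by
  have h1 := (((wedgeL 2 1).flip (oneForm lam)).comp
    (ContinuousAlternatingMap.compContinuousLinearMapCLM (F := ℝ) (ι := Fin 2) L)).hasFDerivAt
    |>.comp_hasDerivWithinAt t (hf.hasDerivWithinAt.smul hω.hasDerivWithinAt)
  have h2 := (ContinuousAlternatingMap.compContinuousLinearMapCLM (F := ℝ) (ι := Fin 3)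
    L).hasFDerivAt.comp_hasDerivWithinAt t
    ((hψp.hasDerivWithinAt.const_smul α).sub (hψm.hasDerivWithinAt.const_smul β))
  have h3 := h1.add h2
  refine (h3.congr_deriv ?_).congr (fun τ _ => ?_) ?_
  · rw [add_comm (f t • _)]
    rfl
  · exact congrArg (· + _) (wedge_smul_left (f τ) _ _).symm
  · exact congrArg (· + _) (wedge_smul_left (f t) _ _).symm

theorem hasDerivWithinAt_iff_eq {X : Type*} [NormedAddCommGroup X] [NormedSpace ℝ X] {g : ℝ → X}
    {g' g'' : X} {J : Set ℝ} {t : ℝ} (h : HasDerivWithinAt g g' J t)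
    (hJ : UniqueDiffWithinAt ℝ J t) : HasDerivWithinAt g g'' J t ↔ g'' = g' :=
  ⟨fun h' => hJ.eq_deriv _ h' h, fun h' => h' ▸ h⟩

variable {M : Type*} [TopologicalSpace M] [ChartedSpace (EuclideanSpace ℝ (Fin 6)) M]
  {α β : ℝ} {J : Set ℝ} {f : ℝ → ℝ} {S : ℝ → SU3Structure M} {t : ℝ}

theorem hasDerivWithinAt_warpedForm_iff (hJ : UniqueDiffWithinAt ℝ J t)
    (hf : DifferentiableWithinAt ℝ f J t)
    (hω : ∀ x, DifferentiableWithinAt ℝ (fun τ => (S τ).ω x) J t)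
    (hψp : ∀ x, DifferentiableWithinAt ℝ (fun τ => (S τ).ψp x) J t)
    (hψm : ∀ x, DifferentiableWithinAt ℝ (fun τ => (S τ).ψm x) J t)
    {η : DForm (𝓡 6) M 3} :
    (∀ p, HasDerivWithinAt (fun τ => warpedForm α β (fun _ => f τ) (S τ) p) (-liftBase η p) J t) ↔
      derivWithin f J t • (S t).ω + f t • timeDeriv J (fun τ => (S τ).ω) t = 0 ∧
        α • timeDeriv J (fun τ => (S τ).ψp) t - β • timeDeriv J (fun τ => (S τ).ψm) t = -η := by
  obtain ⟨A, hA⟩ : ∃ A : DForm (𝓡 6) M 2,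
    A = derivWithin f J t • (S t).ω + f t • timeDeriv J (fun τ => (S τ).ω) t := ⟨_, rfl⟩
  obtain ⟨B, hB⟩ : ∃ B : DForm (𝓡 6) M 3,
    B = α • timeDeriv J (fun τ => (S τ).ψp) t - β • timeDeriv J (fun τ => (S τ).ψm) t := ⟨_, rfl⟩
  rw [← hA, ← hB]
  have key : ∀ p : M × Circle,
      HasDerivWithinAt (fun τ => warpedForm α β (fun _ => f τ) (S τ) p) (-liftBase η p) J t ↔
        -liftBase η p = ((liftBase A).wedge dsLift + liftBase B) p := fun p => by
    -- The point `p` is fixed, and the tangent spaces are identified with the Euclidean model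
    -- spaces, whose norms are used to differentiate.
    have h1 := hasDerivWithinAt_warped (E := EuclideanSpace ℝ (Fin 6))
      (F := EuclideanSpace ℝ (Fin 6) × EuclideanSpace ℝ (Fin 1)) (projBase p)
      (dsLiftFunctional p) α β (ω := fun τ => (S τ).ω p.1) (ψp := fun τ => (S τ).ψp p.1)
      (ψm := fun τ => (S τ).ψm p.1) hf (hω p.1) (hψp p.1) (hψm p.1)
    have h2 := hasDerivWithinAt_iff_eq (X := (EuclideanSpace ℝ (Fin 6) × EuclideanSpace ℝ (Fin 1))
      [⋀^Fin 3]→L[ℝ] ℝ) (g'' := -liftBase η p) h1 hJ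
    have h3 : (fun τ => warpedForm α β (fun _ => f τ) (S τ) p) = fun τ =>
      f τ • wedge (((S τ).ω p.1).compContinuousLinearMap (projBase p))
        (oneForm (dsLiftFunctional p))
        + (α • (S τ).ψp p.1 - β • (S τ).ψm p.1).compContinuousLinearMap (projBase p) :=
      funext fun τ => warpedForm_apply (S τ) α β (f τ) p
    rw [Pi.add_apply, liftBase_wedge_dsLift_apply, liftBase_apply B, h3]
    have h4 : A p.1 = derivWithin f J t • (S t).ω p.1
        + f t • derivWithin (fun τ => (S τ).ω p.1) J t := congrFun hA p.1
    have h5 : B p.1 = α • derivWithin (fun τ => (S τ).ψp p.1) J t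
        - β • derivWithin (fun τ => (S τ).ψm p.1) J t := congrFun hB p.1
    rw [h4, h5]
    exact h2
  rw [forall_congr' key]
  constructor
  · intro h
    -- Since `-η` has no `ds` part, moving it to the other side leaves an invariant form whose two
    -- components must vanish.
    have h1 : (liftBase A).wedge dsLift + liftBase (B + η) = 0 := by
      rw [liftBase_add, ← add_assoc]
      exact funext fun p => (congrArg (· + liftBase η p) (h p).symm).trans (neg_add_cancel _)
    obtain ⟨h2, h3⟩ := lift_components_eq_zero h1
    exact ⟨h2, eq_neg_of_add_eq_zero_left h3⟩
  · rintro ⟨h1, h2⟩ p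
    rw [h1, h2]
    have h3 : (liftBase (0 : DForm (𝓡 6) M 2)).wedge dsLift p = 0 := wedge_zero_left _
    exact ((congrArg (· + -liftBase η p) h3).trans (zero_add _)).symm

end Evolution

/-! ### The Laplacian flow of warped structures -/

theorem isLaplacianFlow_warpedForm_iff {M : Type*} [TopologicalSpace M]
    [ChartedSpace (EuclideanSpace ℝ (Fin 6)) M] [IsManifold (𝓡 6) (⊤ : ℕ∞) M]
    {α β : ℝ} (hαβ : α ^ 2 + β ^ 2 = 1) {J : Set ℝ} (hJ : J.OrdConnected) (hJ' : J.Nontrivial)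
    {f : ℝ → ℝ} (hf : DifferentiableOn ℝ f J) (hf0 : ∀ t ∈ J, f t ≠ 0) {S : ℝ → SU3Structure M}
    (hω : TimeDifferentiable J fun t => (S t).ω) (hψp : TimeDifferentiable J fun t => (S t).ψp)
    (hψm : TimeDifferentiable J fun t => (S t).ψm) {T : ℝ → TorsionData M}
    (hT : ∀ t ∈ J, (S t).IsTorsion (T t))
    (hclosed : ∀ t ∈ J, (warpedForm α β (fun _ => f t) (S t)).d = 0) :
    IsLaplacianFlow J (fun t => warpedForm α β (fun _ => f t) (S t)) ↔
      ∀ t ∈ J,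
        derivWithin f J t • (S t).ω + f t • timeDeriv J (fun τ => (S τ).ω) t = 0 ∧
        α • timeDeriv J (fun τ => (S τ).ψp) t - β • timeDeriv J (fun τ => (S τ).ψm) t
          = -(α • (T t).σ2 + β • (T t).π2).d := by
  have key : ∀ t ∈ J, (∀ p, HasDerivWithinAt (fun τ => warpedForm α β (fun _ => f τ) (S τ) p)
      ((warpedForm α β (fun _ => f t) (S t)).laplacian7
        (warpedForm α β (fun _ => f t) (S t)) p) J t) ↔
      derivWithin f J t • (S t).ω + f t • timeDeriv J (fun τ => (S τ).ω) t = 0 ∧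
        α • timeDeriv J (fun τ => (S τ).ψp) t - β • timeDeriv J (fun τ => (S τ).ψm) t
          = -(α • (T t).σ2 + β • (T t).π2).d := fun t ht => by
    rw [laplacian_warpedForm (hT t ht) hαβ (hf0 t ht) (hclosed t ht)]
    exact hasDerivWithinAt_warpedForm_iff (uniqueDiffOn_of_ordConnected hJ hJ' t ht) (hf t ht)
      (fun x => hω x t ht) (fun x => hψp x t ht) (fun x => hψm x t ht)
  exact ⟨fun h t ht => (key t ht).1 (h.evolution t ht), fun h =>
    ⟨fun t ht => warpedForm_isG2Structure (S t) hαβ (hf0 t ht),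
      fun t ht => (key t ht).2 (h t ht), hclosed⟩⟩

end WarpedG2

theorem mainTheorem6 {M : Type*} [TopologicalSpace M] [ChartedSpace (EuclideanSpace ℝ (Fin 6)) M]
    [IsManifold (𝓡 6) (⊤ : ℕ∞) M]
    (α β : ℝ) (hαβ : α ^ 2 + β ^ 2 = 1)
    (J : Set ℝ) (hJ : J.OrdConnected) (hJ' : J.Nontrivial)
    (f : ℝ → ℝ) (hf : DifferentiableOn ℝ f J) (hf0 : ∀ t ∈ J, f t ≠ 0)
    (S : ℝ → WarpedG2.SU3Structure M)
    (hω : WarpedG2.TimeDifferentiable J fun t => (S t).ω)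
    (hψp : WarpedG2.TimeDifferentiable J fun t => (S t).ψp)
    (hψm : WarpedG2.TimeDifferentiable J fun t => (S t).ψm)
    (T : ℝ → WarpedG2.TorsionData M) (hT : ∀ t ∈ J, (S t).IsTorsion (T t))
    (hclosed : ∀ t ∈ J, (WarpedG2.warpedForm α β (fun _ => f t) (S t)).d = 0) :
    (∀ t ∈ J, α • (T t).π2 - β • (T t).σ2 = 0) ∧
    (WarpedG2.IsLaplacianFlow J (fun t => WarpedG2.warpedForm α β (fun _ => f t) (S t)) ↔
      ∀ t ∈ J,
        derivWithin f J t • (S t).ω + f t • WarpedG2.timeDeriv J (fun τ => (S τ).ω) t = 0 ∧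
        α • WarpedG2.timeDeriv J (fun τ => (S τ).ψp) t
            - β • WarpedG2.timeDeriv J (fun τ => (S τ).ψm) t
          = -(α • (T t).σ2 + β • (T t).π2).d) ∧
    (α = 1 → β = 0 →
      (∀ t ∈ J, (T t).π2 = 0) ∧
      (WarpedG2.IsLaplacianFlow J
          (fun t => f t • (WarpedG2.liftBase (S t).ω).wedge WarpedG2.dsLift
            + WarpedG2.liftBase (S t).ψp) ↔
        ∀ t ∈ J,
          derivWithin f J t • (S t).ω + f t • WarpedG2.timeDeriv J (fun τ => (S τ).ω) t = 0 ∧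
          WarpedG2.timeDeriv J (fun τ => (S τ).ψp) t = -(T t).σ2.d)) := by
  have hπσ : ∀ t ∈ J, α • (T t).π2 - β • (T t).σ2 = 0 := fun t ht => funext fun x =>
    ((hT t ht).of_closed hαβ (hf0 t ht) (hclosed t ht) x).2
  have hflow := WarpedG2.isLaplacianFlow_warpedForm_iff hαβ hJ hJ' hf hf0 hω hψp hψm hT hclosed
  refine ⟨hπσ, hflow, ?_⟩
  rintro rfl rfl
  have hone : ∀ {k : ℕ} (η θ : WarpedG2.DForm (𝓡 6) M k), (1 : ℝ) • η - (0 : ℝ) • θ = η :=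
    fun η θ => funext fun x => by
      change (1 : ℝ) • η x - (0 : ℝ) • θ x = η x
      module
  have hone' : ∀ {k : ℕ} (η θ : WarpedG2.DForm (𝓡 6) M k), (1 : ℝ) • η + (0 : ℝ) • θ = η :=
    fun η θ => funext fun x => by
      change (1 : ℝ) • η x + (0 : ℝ) • θ x = η x
      module
  refine ⟨fun t ht => (hone _ _).symm.trans (hπσ t ht), ?_⟩
  have hform : (fun t => WarpedG2.warpedForm 1 0 (fun _ => f t) (S t)) = fun t =>
      f t • (WarpedG2.liftBase (S t).ω).wedge WarpedG2.dsLift + WarpedG2.liftBase (S t).ψp :=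
    funext fun t => by
      rw [WarpedG2.warpedForm_eq, WarpedG2.liftBase_smul_wedge_dsLift, hone]
  rw [← hform, hflow]
  simp only [hone, hone']

end
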